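/- Let $k$ be an algebraically closed field of arbitrary characteristic, let $q,r,s,t$ be positive integers, and put $a=q+r+s$, $b=t+r+s$, $p=s+r$, $G=GL(a+b)$ over $k$, $K=GL(a)\times GL(b)\le G$ (block diagonal), and let $K\backslash G$ be the quotient variety of $G$ by left multiplication by $K$; $G$ acts on it by right multiplication. Let $J$ denote a square matrix with ones on the antidiagonal and zeros elsewhere. Let $v_0\in G$ be the block matrix with block rows of sizes $q,r,s,t,r,s$, block columns of sizes $s,s,r,q,t,r$, and let $w\in G$ be the permutation matrix with block rows of sizes $s,r,q,t,r,s$ and the same block columns, where $$v_0=\begin{pmatrix}0&0&0&J&0&0\\0&0&J&0&0&0\\J&0&0&0&0&0\\0&0&0&0&1&0\\0&0&J&0&0&1\\J&1&0&0&0&0\end{pmatrix},\qquad w=\begin{pmatrix}0&J&0&0&0&0\\0&0&0&0&0&J\\0&0&0&J&0&0\\0&0&0&0&1&0\\0&0&J&0&0&0\\J&0&0&0&0&0\end{pmatrix}.$$ With rows and columns in blocks of sizes $p,q,t,p$, let $B'\le G$ be the group of matrices $$\begin{pmatrix}\ell&0&0&0\\ *&1&0&0\\ *&0&1&0\\ *&*&*&u\end{pmatrix},$$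 $\ell$ lower triangular and invertible, $u$ lower triangular with ones on the diagonal, and let $Q=Q_1\times Q_2\le G\times G$, where $Q_1$ (resp. $Q_2$) consists of the matrices that agree with the identity outside block row 2 and block column 3 (resp. block row 3 and block column 2), where the block is arbitrary. Let $U'$ be the unipotent radical of $B'$ and $T'$ its group of diagonal matrices; let $U_+$, $U_-$ be the groups of upper, resp. lower, triangular matrices in $G$ with ones on the diagonal, and let $U'_{+,w}=U'\cap wU_+w^{-1}$. Define * the slice $S=\{Kv_0u : u\in w^{-1}U'w\cap U_-\}\subseteq K\backslash G$, a locally closed subvariety (with its reduced structure); * $Z=(w^{-1}U'_{+,w}w)\times(w^{-1}T'w)\times(w^{-1}Q_1w\times w^{-1}Q_2w)$, with multiplication map $p\colon Z\to G$, $p(x,y,(y_1,y_2))=xyy_1y_2$, and $\Psi\colon S\times Z\to K\backslash G$, $\Psi(x,z)=x\,p(z)$; * the torus $T_S\le G$ of block diagonal matrices $\mathrm{diag}(Jt_1J,\,t_1,\,Jt_2J,\,Jt_3J,\,t_4,\,t_2)$ with blocks of sizes $s,s,r,q,t,r$ and $t_1,\dots,t_4$ diagonal and invertible, acting on $K\backslash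 G$ and $S$ by right multiplication and on each factor of $Z$ by conjugation, $g\cdot\tau=\tau^{-1}g\tau$; * the parabolic subgroup $P'\le G$ of block upper triangular matrices with $2s+r$ diagonal blocks of size $1$, then one of size $q+t$, then $r$ of size $1$. Theorem. $Z$ is smooth over $k$, $S$ is stable under $T_S$, and $\Psi$ is a $T_S$-equivariant open immersion of schemes. For every parabolic subgroup $P\le G$ containing $P'$ (in particular for $P=P'$, which is parabolic), and every $P$-orbit closure $\overline O\subseteq K\backslash G$ (with its reduced structure), $\Psi$ restricts to a $T_S$-equivariant isomorphism of schemes $$(\overline O\cap S)\times Z\;\cong\;\overline O\cap\operatorname{im}\Psi,$$ where the intersections are scheme-theoretic and $\operatorname{im}\Psi$ is an open subscheme of $K\backslash G$. -/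

import Mathlib

open CategoryTheory AlgebraicGeometry MonoidalCategory CartesianMonoidalCategory

universe u

namespace KGSlice

/-- A set of points with a `k`-algebra of `k`-valued functions on it. An affine variety over an
algebraically closed field `k` is given in this form, by its set of `k`-points and its algebra of
regular functions; the corresponding scheme is the spectrum of the algebra. -/
structure FunctionSpace (k : Type u) [Field k] where
  /-- the points -/
  pts : Type u
  /-- the regular functions -/
  fn : Subalgebra k (pts → k)

namespace FunctionSpace

/-- Pulling functions back along a map of sets. -/
def compAlgHom (k : Type u) [Field k] {A B : Type u} (φ : A → B) : (B → k) →ₐ[k] (A → k) where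
  toFun f := fun x => f (φ x)
  map_one' := rfl
  map_mul' _ _ := rfl
  map_zero' := rfl
  map_add' _ _ := rfl
  commutes' _ := rfl

variable {k : Type u} [Field k]

@[simp] lemma compAlgHom_apply {A B : Type u} (φ : A → B) (f : B → k) (x : A) :
    compAlgHom k φ f x = f (φ x) := rfl

/-- A regular map: a map of points that pulls regular functions back to regular functions. -/
structure Hom (X Y : FunctionSpace k) where
  /-- the map on points -/
  toFun : X.pts → Y.pts
  regular : ∀ f ∈ Y.fn, compAlgHom k toFun f ∈ X.fn

/-- The homomorphism of algebras of regular functions induced by a regular map. -/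
def Hom.pullback {X Y : FunctionSpace k} (φ : Hom X Y) : Y.fn →ₐ[k] X.fn :=
  ((compAlgHom k φ.toFun).comp Y.fn.val).codRestrict X.fn fun f => φ.regular f.1 f.2

/-- Composition of regular maps. -/
def Hom.comp {X Y Z : FunctionSpace k} (φ : Hom X Y) (ψ : Hom Y Z) : Hom X Z :=
  ⟨fun x => ψ.toFun (φ.toFun x), fun f hf => φ.regular _ (ψ.regular f hf)⟩

/-- `f ⊗ g ↦ ((x, y) ↦ f x * g y)`. -/
noncomputable def prodMap (X Y : FunctionSpace k) :
    TensorProduct k X.fn Y.fn →ₐ[k] (X.pts × Y.pts → k) :=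
  Algebra.TensorProduct.productMap
    ((compAlgHom k (Prod.fst : X.pts × Y.pts → X.pts)).comp X.fn.val)
    ((compAlgHom k (Prod.snd : X.pts × Y.pts → Y.pts)).comp Y.fn.val)

@[simp] lemma prodMap_tmul (X Y : FunctionSpace k) (f : X.fn) (g : Y.fn) (z : X.pts × Y.pts) :
    prodMap X Y (f ⊗ₜ g) z = f.1 z.1 * g.1 z.2 := by
  simp [prodMap]

/-- The product: pairs of points, with the functions `(x, y) ↦ ∑ i, fᵢ x * gᵢ y` where all
`fᵢ`, `gᵢ` are regular. -/
noncomputable abbrev prod (X Y : FunctionSpace k) : FunctionSpace k where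
  pts := X.pts × Y.pts
  fn := (prodMap X Y).range

/-- First projection. -/
def prodFst (X Y : FunctionSpace k) : Hom (X.prod Y) X :=
  ⟨Prod.fst, fun f hf => ⟨(⟨f, hf⟩ : X.fn) ⊗ₜ 1, by ext; simp⟩⟩

/-- Second projection. -/
def prodSnd (X Y : FunctionSpace k) : Hom (X.prod Y) Y :=
  ⟨Prod.snd, fun f hf => ⟨1 ⊗ₜ (⟨f, hf⟩ : Y.fn), by ext; simp⟩⟩

/-- The regular map into a product with given components. -/
def Hom.pair {X Y Z : FunctionSpace k} (φ : Hom X Y) (ψ : Hom X Z) : Hom X (Y.prod Z) where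
  toFun x := (φ.toFun x, ψ.toFun x)
  regular := by
    rintro _ ⟨a, rfl⟩
    change compAlgHom k _ (prodMap Y Z a) ∈ X.fn
    induction a using TensorProduct.induction_on with
    | zero => rw [map_zero, map_zero]; exact X.fn.zero_mem
    | add a b ha hb =>
      have h : prodMap Y Z (a + b) = prodMap Y Z a + prodMap Y Z b := map_add (prodMap Y Z) a b
      rw [h, map_add]
      exact X.fn.add_mem ha hb
    | tmul f g =>
      refine cast (congrArg (· ∈ X.fn) ?_) (X.fn.mul_mem (φ.regular f.1 f.2) (ψ.regular g.1 g.2))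
      ext x
      exact (prodMap_tmul Y Z f g (φ.toFun x, ψ.toFun x)).symm

/-- The (Zariski closed) subset `E`, with the restrictions to `E` of the regular functions. -/
abbrev sub (X : FunctionSpace k) (E : Set X.pts) : FunctionSpace k where
  pts := E
  fn := X.fn.map (compAlgHom k (Subtype.val : E → X.pts))

/-- The inclusion of a subset. -/
def incl (X : FunctionSpace k) (E : Set X.pts) : Hom (X.sub E) X :=
  ⟨Subtype.val, fun f hf => ⟨f, hf, rfl⟩⟩

/-- A regular map with values in `E`, as a regular map to `E`. -/
def Hom.codRestrict {X Y : FunctionSpace k} (φ : Hom X Y) (E : Set Y.pts)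
    (h : ∀ x, φ.toFun x ∈ E) : Hom X (Y.sub E) where
  toFun x := ⟨φ.toFun x, h x⟩
  regular := by
    rintro _ ⟨f, hf, rfl⟩
    exact φ.regular f hf

lemma exists_sum {X Y : FunctionSpace k} (z : TensorProduct k X.fn Y.fn) :
    ∃ (ι : Type u) (c : ι →₀ X.fn) (b : ι → Y.fn), LinearIndependent k b ∧
      z = c.sum fun i a => a ⊗ₜ[k] b i := by
  classical
  let b := Module.Basis.ofVectorSpace k Y.fn
  refine ⟨_, (Algebra.TensorProduct.basis X.fn b).repr z, b, b.linearIndependent, ?_⟩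
  conv_lhs => rw [← (Algebra.TensorProduct.basis X.fn b).linearCombination_repr z]
  simp [Finsupp.linearCombination_apply, TensorProduct.smul_tmul']

lemma coeff_zero {A B : Type u} {V : Subalgebra k (B → k)} {ι : Type u} (c : ι → A → k)
    (s : Finset ι) (b : ι → V) (hb : LinearIndependent k b)
    (h : ∀ x y, ∑ i ∈ s, c i x * (b i).1 y = 0) : ∀ i ∈ s, c i = 0 := by
  intro i hi
  ext x
  refine linearIndependent_iff'.1 hb s (fun i => c i x) ?_ i hi
  ext y
  simpa using h x y

lemma prodMap_injective (X Y : FunctionSpace k) : Function.Injective (prodMap X Y) := by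
  rw [injective_iff_map_eq_zero]
  intro z hz
  obtain ⟨ι, c, b, hb, rfl⟩ := exists_sum z
  have := coeff_zero (fun i => (c i).1) c.support b hb (fun x y => by
    simpa [Finsupp.sum] using congrFun hz (x, y))
  refine Finset.sum_eq_zero fun i hi => ?_
  have h0 : c i = 0 := Subtype.ext (this i hi)
  simp [h0]

/-- The scheme over `k` of a space with functions: the spectrum of its regular functions. -/
noncomputable abbrev toScheme (X : FunctionSpace k) : Over (Spec (CommRingCat.of k)) :=
  Over.mk (Spec.map (CommRingCat.ofHom (algebraMap k X.fn)))

/-- The morphism of schemes of a regular map. -/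
noncomputable def Hom.toScheme {X Y : FunctionSpace k} (φ : Hom X Y) : X.toScheme ⟶ Y.toScheme :=
  Over.homMk (Spec.map (CommRingCat.ofHom φ.pullback.toRingHom)) (by
    simp only [FunctionSpace.toScheme, Over.mk_hom, ← Spec.map_comp, ← CommRingCat.ofHom_comp]
    congr 2)

/-- The comparison from the scheme of a product to the fibre product over `k` of the schemes. -/
noncomputable def prodComparison (X Y : FunctionSpace k) :
    (X.prod Y).toScheme ⟶ X.toScheme ⊗ Y.toScheme :=
  lift (prodFst X Y).toScheme (prodSnd X Y).toScheme

instance isIso_prodComparison (X Y : FunctionSpace k) : IsIso (prodComparison X Y) := by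
  let e : TensorProduct k X.fn Y.fn ≃ₐ[k] (prodMap X Y).range :=
    AlgEquiv.ofInjective _ (prodMap_injective X Y)
  have key : (prodComparison X Y).left =
      Spec.map (RingEquiv.toCommRingCatIso e.toRingEquiv).hom ≫
      (pullbackSpecIso k X.fn Y.fn).inv := by
    apply Limits.pullback.hom_ext
    · rw [prodComparison, Over.lift_left, Limits.pullback.lift_fst]
      refine Eq.trans ?_ (Category.assoc _ _ _).symm
      refine Eq.trans ?_ (congrArg (_ ≫ ·) (pullbackSpecIso_inv_fst k X.fn Y.fn).symm)
      refine Eq.trans ?_ (Spec.map_comp _ _)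
      refine congrArg Spec.map ?_
      ext f z
      change _ = (prodMap X Y (f ⊗ₜ 1)) z
      simp
      rfl
    · rw [prodComparison, Over.lift_left, Limits.pullback.lift_snd]
      refine Eq.trans ?_ (Category.assoc _ _ _).symm
      refine Eq.trans ?_ (congrArg (_ ≫ ·) (pullbackSpecIso_inv_snd k X.fn Y.fn).symm)
      refine Eq.trans ?_ (Spec.map_comp _ _)
      refine congrArg Spec.map ?_
      ext f z
      change _ = (prodMap X Y (1 ⊗ₜ f)) z
      simp
      rfl
  have : IsIso (prodComparison X Y).left := by
    rw [key]
    exact IsIso.comp_isIso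
  have : IsIso ((Over.forget _).map (prodComparison X Y)) := this
  exact isIso_of_reflects_iso (prodComparison X Y) (Over.forget _)
end FunctionSpace

section GeneralLinear

variable (k : Type u) [Field k] (N : ℕ)

/-- The group `GL(N)` over `k`, with the functions generated by the matrix entries and the inverse
of the determinant. -/
abbrev glSpace : FunctionSpace k where
  pts := Matrix.GeneralLinearGroup (Fin N) k
  fn := Algebra.adjoin k
    ({f | ∃ i j, f = fun g => g.1 i j} ∪ {fun g => (g.1.det)⁻¹})

variable {k N}

/-- A map to `GL(N)` is regular when its entries and its inverse determinant are regular. -/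
def homToGL {X : FunctionSpace k} (φ : X.pts → Matrix.GeneralLinearGroup (Fin N) k)
    (h : ∀ i j, (fun x => (φ x).1 i j) ∈ X.fn) (hdet : (fun x => ((φ x).1.det)⁻¹) ∈ X.fn) :
    X.Hom (glSpace k N) where
  toFun := φ
  regular := by
    intro f hf
    change f ∈ X.fn.comap (FunctionSpace.compAlgHom k φ)
    refine Algebra.adjoin_le ?_ hf
    rintro _ (⟨i, j, rfl⟩ | rfl)
    · exact h i j
    · exact hdet

lemma entry_mem (i j : Fin N) :
    (fun g : Matrix.GeneralLinearGroup (Fin N) k => g.1 i j) ∈ (glSpace k N).fn :=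
  Algebra.subset_adjoin (Or.inl ⟨i, j, rfl⟩)

lemma det_inv_mem :
    (fun g : Matrix.GeneralLinearGroup (Fin N) k => (g.1.det)⁻¹) ∈ (glSpace k N).fn :=
  Algebra.subset_adjoin (Or.inr rfl)

lemma det_mem {X : FunctionSpace k} (A : X.pts → Matrix (Fin N) (Fin N) k)
    (h : ∀ i j, (fun x => A x i j) ∈ X.fn) : (fun x => (A x).det) ∈ X.fn := by
  have : (fun x => (A x).det) = ∑ σ : Equiv.Perm (Fin N),
      ((Equiv.Perm.sign σ : ℤ) : k) • ∏ i, (fun x => A x (σ i) i) := by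
    ext x
    simp [Matrix.det_apply, Finset.sum_apply, Finset.prod_apply, Units.smul_def]
  rw [this]
  exact X.fn.sum_mem fun σ _ => X.fn.smul_mem (X.fn.prod_mem fun i _ => h _ _) _

/-- Multiplication of `GL(N)`. -/
noncomputable def glMul : ((glSpace k N).prod (glSpace k N)).Hom (glSpace k N) :=
  homToGL (X := (glSpace k N).prod (glSpace k N)) (fun z => z.1 * z.2)
    (fun i j => by
      have : (fun z : Matrix.GeneralLinearGroup (Fin N) k × Matrix.GeneralLinearGroup (Fin N) k =>
          (z.1 * z.2).1 i j) = ∑ l, (fun z => z.1.1 i l) * (fun z => z.2.1 l j) := by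
        ext z
        simp [Matrix.mul_apply, Finset.sum_apply]
      rw [this]
      exact Subalgebra.sum_mem _ fun l _ => Subalgebra.mul_mem _
        ((FunctionSpace.prodFst _ _).regular _ (entry_mem i l))
        ((FunctionSpace.prodSnd _ _).regular _ (entry_mem l j)))
    (by
      have : (fun z : Matrix.GeneralLinearGroup (Fin N) k × Matrix.GeneralLinearGroup (Fin N) k =>
          ((z.1 * z.2).1.det)⁻¹) = (fun z => (z.1.1.det)⁻¹) * (fun z => (z.2.1.det)⁻¹) := by
        ext z
        simp [mul_comm]
      rw [this]
      exact Subalgebra.mul_mem _ ((FunctionSpace.prodFst _ _).regular _ det_inv_mem)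
        ((FunctionSpace.prodSnd _ _).regular _ det_inv_mem))

/-- Inversion of `GL(N)`. -/
def glInv : (glSpace k N).Hom (glSpace k N) :=
  homToGL (X := glSpace k N) (fun g => g⁻¹)
    (fun i j => by
      have : (fun g : Matrix.GeneralLinearGroup (Fin N) k => (g⁻¹).1 i j) =
          (fun g => (g.1.det)⁻¹) * (fun g => (g.1.updateRow j (Pi.single i 1)).det) := by
        ext g
        rw [Matrix.coe_units_inv, Matrix.inv_def, Matrix.smul_apply, Matrix.adjugate_apply,
          Ring.inverse_eq_inv', smul_eq_mul]
        rfl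
      rw [this]
      refine Subalgebra.mul_mem _ det_inv_mem (det_mem (X := glSpace k N) _ fun a b => ?_)
      by_cases h : a = j
      · subst h
        simp only [Matrix.updateRow_self]
        exact Subalgebra.algebraMap_mem (glSpace k N).fn ((Pi.single i 1 : Fin N → k) b)
      · simpa [h] using entry_mem a b)
    (by
      have : (fun g : Matrix.GeneralLinearGroup (Fin N) k => ((g⁻¹).1.det)⁻¹) =
          fun g => g.1.det := by
        ext g
        rw [Matrix.coe_units_inv, Matrix.det_nonsing_inv, Ring.inverse_eq_inv', inv_inv]
      rw [this]
      exact det_mem (X := glSpace k N) _ entry_mem)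

/-- The constant map with value `g`. -/
def glConst (X : FunctionSpace k) (g : Matrix.GeneralLinearGroup (Fin N) k) :
    X.Hom (glSpace k N) :=
  homToGL (X := X) (fun _ => g) (fun i j => X.fn.algebraMap_mem (g.1 i j))
    (X.fn.algebraMap_mem (g.1.det)⁻¹)

/-- The pointwise product of two regular maps to `GL(N)`. -/
noncomputable def mulHom {X : FunctionSpace k} (φ ψ : X.Hom (glSpace k N)) : X.Hom (glSpace k N) :=
  (φ.pair ψ).comp glMul

end GeneralLinear

section Quotient

variable {k : Type u} [Field k] {N : ℕ}

/-- The quotient `K\G` of `G = GL(N)` by left multiplication by `K`: the points are the cosets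
`Kg`, and the regular functions are those whose pull-back to `G` is regular, i.e. the `K`-invariant
regular functions on `G`. For reductive `K`, such as `GL(a) × GL(b)`, the quotient variety `K\G` is
affine and is the spectrum of this algebra. -/
abbrev quotSpace (K : Subgroup (Matrix.GeneralLinearGroup (Fin N) k)) : FunctionSpace k where
  pts := Quotient (QuotientGroup.rightRel K)
  fn := (glSpace k N).fn.comap (FunctionSpace.compAlgHom k (Quotient.mk (QuotientGroup.rightRel K)))

/-- The quotient map `g ↦ Kg`. -/
def quotMk (K : Subgroup (Matrix.GeneralLinearGroup (Fin N) k)) :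
    (glSpace k N).Hom (quotSpace K) :=
  ⟨Quotient.mk (QuotientGroup.rightRel K), fun _ hf => hf⟩

/-- The action of `G` on `K\G` by right multiplication, `(Kg, h) ↦ Kgh`. -/
def quotAct (K : Subgroup (Matrix.GeneralLinearGroup (Fin N) k)) :
    ((quotSpace K).prod (glSpace k N)).Hom (quotSpace K) where
  toFun z := Quotient.map (fun g => g * z.2) (fun g g' hg => by
    have hg' := QuotientGroup.rightRel_apply.1 hg
    refine QuotientGroup.rightRel_apply.2 ?_
    simpa [mul_assoc] using hg') z.1
  regular := by
    intro f hf
    obtain ⟨z, hz⟩ := (glMul (k := k) (N := N)).regular _ hf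
    obtain ⟨ι, c, b, hb, rfl⟩ := FunctionSpace.exists_sum z
    have hval : ∀ g h : Matrix.GeneralLinearGroup (Fin N) k,
        f (Quotient.mk (QuotientGroup.rightRel K) (g * h)) =
          ∑ i ∈ c.support, (c i).1 g * (b i).1 h := by
      intro g h
      refine (congrFun hz (g, h)).symm.trans ?_
      change FunctionSpace.prodMap (glSpace k N) (glSpace k N) (c.sum fun i a => a ⊗ₜ[k] b i) (g, h) = _
      rw [Finsupp.sum, map_sum, Finset.sum_apply]
      exact Finset.sum_congr rfl fun i _ => FunctionSpace.prodMap_tmul _ _ _ _ _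
    have hinv : ∀ i ∈ c.support, ∀ g g' : Matrix.GeneralLinearGroup (Fin N) k,
        (QuotientGroup.rightRel K) g g' → (c i).1 g = (c i).1 g' := by
      intro i hi g g' hgg
      have h0 := FunctionSpace.coeff_zero (A := PUnit.{u + 1})
        (fun i _ => (c i).1 g - (c i).1 g') c.support b hb (fun _ h => by
          simp only [sub_mul, Finset.sum_sub_distrib]
          rw [← hval, ← hval, sub_eq_zero]
          refine congrArg f (Quotient.sound ?_)
          have hg' := QuotientGroup.rightRel_apply.1 hgg
          refine QuotientGroup.rightRel_apply.2 ?_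
          simpa [mul_assoc] using hg') i hi
      exact sub_eq_zero.1 (congrFun h0 PUnit.unit)
    classical
    let c' : ι → (quotSpace K).fn := fun i =>
      if hi : i ∈ c.support then ⟨Quotient.lift (c i).1 (hinv i hi), (c i).2⟩ else 0
    refine ⟨∑ i ∈ c.support, c' i ⊗ₜ[k] b i, ?_⟩
    ext ⟨x, h⟩
    induction x using Quotient.inductionOn with
    | h g =>
      change FunctionSpace.prodMap (quotSpace K) (glSpace k N) (∑ i ∈ c.support, c' i ⊗ₜ[k] b i)
        (Quotient.mk (QuotientGroup.rightRel K) g, h) = f (Quotient.mk (QuotientGroup.rightRel K) (g * h))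
      rw [hval, map_sum, Finset.sum_apply]
      refine Finset.sum_congr rfl fun i hi => ?_
      rw [FunctionSpace.prodMap_tmul]
      simp only [c', dif_pos hi]
      rfl

end Quotient

section Subschemes

variable {B : Scheme.{u}}

/-- The closure of a set of points of a scheme, with its reduced induced structure. -/
noncomputable def reducedClosure (X : Over B) (E : Set X.left) : Over B :=
  Over.mk ((Scheme.IdealSheafData.vanishingIdeal
    (TopologicalSpace.Closeds.closure E)).subschemeι ≫ X.hom)

/-- The inclusion of the reduced closure. -/
noncomputable def reducedClosureι (X : Over B) (E : Set X.left) : reducedClosure X E ⟶ X :=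
  Over.homMk (Scheme.IdealSheafData.vanishingIdeal
    (TopologicalSpace.Closeds.closure E)).subschemeι

/-- The largest open set in which `E` is closed, for a locally closed set `E`. -/
def ambientOpen (X : Over B) (E : Set X.left) : X.left.Opens :=
  ⟨interior (coborder E), isOpen_interior⟩

/-- A locally closed set of points of a scheme, with its reduced induced structure: the part of the
reduced closure that lies in the open set obtained by removing `closure E \ E`. -/
noncomputable def reducedInduced (X : Over B) (E : Set X.left) : Over B :=
  Over.mk (((reducedClosureι X E).left ⁻¹ᵁ ambientOpen X E).ι ≫ (reducedClosure X E).hom)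

/-- The inclusion of a locally closed subscheme. -/
noncomputable def reducedInducedι (X : Over B) (E : Set X.left) : reducedInduced X E ⟶ X :=
  Over.homMk (((reducedClosureι X E).left ⁻¹ᵁ ambientOpen X E).ι) rfl ≫ reducedClosureι X E

/-- An open subset of a scheme as an open subscheme. -/
noncomputable def openSub (X : Over B) (U : X.left.Opens) : Over B := Over.mk (U.ι ≫ X.hom)

/-- The inclusion of an open subscheme. -/
noncomputable def openSubι (X : Over B) (U : X.left.Opens) : openSub X U ⟶ X := Over.homMk U.ι rfl

/-- The componentwise right operation of `T` on `X × Y`. -/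
noncomputable def diagAct {X Y T : Over B} (ρ : X ⊗ T ⟶ X) (σ : Y ⊗ T ⟶ Y) :
    (X ⊗ Y) ⊗ T ⟶ X ⊗ Y :=
  lift ((fst X Y ▷ T) ≫ ρ) ((snd X Y ▷ T) ≫ σ)

end Subschemes

section Blocks

/-- Positive integers `q, r, s, t`. -/
structure BlockSizes where
  q : ℕ
  r : ℕ
  s : ℕ
  t : ℕ
  q_pos : 0 < q
  r_pos : 0 < r
  s_pos : 0 < s
  t_pos : 0 < t

namespace BlockSizes

/-- `a = q + r + s`. -/
abbrev a (d : BlockSizes) : ℕ := d.q + d.r + d.s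

/-- `b = t + r + s`. -/
abbrev b (d : BlockSizes) : ℕ := d.t + d.r + d.s

/-- The size `a + b` of the matrices. -/
abbrev N (d : BlockSizes) : ℕ := d.a + d.b

/-- `p = s + r`. -/
abbrev p (d : BlockSizes) : ℕ := d.s + d.r

end BlockSizes

/-- `(i, j)` is an antidiagonal position of the `m × m` block with upper left corner `(x, y)`
(rows and columns are numbered from `0`). -/
abbrev AntiAt (x y m i j : ℕ) : Prop :=
  (x ≤ i ∧ i < x + m) ∧ (y ≤ j ∧ j < y + m) ∧ i + j + 1 = x + y + m

/-- `(i, j)` is a diagonal position of the `m × m` block with upper left corner `(x, y)`. -/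
abbrev DiagAt (x y m i j : ℕ) : Prop :=
  (x ≤ i ∧ i < x + m) ∧ (y ≤ j ∧ j < y + m) ∧ i + y = j + x

variable (k : Type u) [Field k] (d : BlockSizes)

/-- The positions of the ones of `v₀`; rows in blocks of sizes `q, r, s, t, r, s`, columns in
blocks of sizes `s, s, r, q, t, r`. -/
abbrev V0At (i j : ℕ) : Prop :=
  AntiAt 0 (2 * d.s + d.r) d.q i j ∨
  AntiAt d.q (2 * d.s) d.r i j ∨
  AntiAt (d.q + d.r) 0 d.s i j ∨
  DiagAt d.a (2 * d.s + d.r + d.q) d.t i j ∨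
  AntiAt (d.a + d.t) (2 * d.s) d.r i j ∨ DiagAt (d.a + d.t) (2 * d.s + d.r + d.q + d.t) d.r i j ∨
  AntiAt (d.a + d.t + d.r) 0 d.s i j ∨ DiagAt (d.a + d.t + d.r) d.s d.s i j

/-- The block matrix `v₀`:
```
     s  s  r  q  t  r
q    .  .  .  J  .  .
r    .  .  J  .  .  .
s    J  .  .  .  .  .
t    .  .  .  .  1  .
r    .  .  J  .  .  1
s    J  1  .  .  .  .
```
-/
def v0Matrix : Matrix (Fin d.N) (Fin d.N) k :=
  Matrix.of fun i j => if V0At d i j then 1 else 0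

/-- The positions of the ones of `w`; rows in blocks of sizes `s, r, q, t, r, s`, columns in
blocks of sizes `s, s, r, q, t, r`. -/
abbrev WAt (i j : ℕ) : Prop :=
  AntiAt 0 d.s d.s i j ∨
  AntiAt d.s (2 * d.s + d.r + d.q + d.t) d.r i j ∨
  AntiAt d.p (2 * d.s + d.r) d.q i j ∨
  DiagAt (d.p + d.q) (2 * d.s + d.r + d.q) d.t i j ∨
  AntiAt (d.p + d.q + d.t) (2 * d.s) d.r i j ∨
  AntiAt (d.p + d.q + d.t + d.r) 0 d.s i j

/-- The block matrix `w`: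
```
     s  s  r  q  t  r
s    .  J  .  .  .  .
r    .  .  .  .  .  J
q    .  .  .  J  .  .
t    .  .  .  .  1  .
r    .  .  J  .  .  .
s    J  .  .  .  .  .
```
-/
def wMatrix : Matrix (Fin d.N) (Fin d.N) k :=
  Matrix.of fun i j => if WAt d i j then 1 else 0

set_option maxHeartbeats 1000000 in
lemma v0Matrix_det_ne_zero : (v0Matrix k d).det ≠ 0 := by
  classical
  intro h
  obtain ⟨x, hx, hv⟩ := Matrix.exists_mulVec_eq_zero_iff.2 h
  have key : ∀ (i j : Fin d.N), V0At d i j → (∀ l : Fin d.N, V0At d i l → l ≠ j → x l = 0) →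
      x j = 0 := by
    intro i j hij hl
    have h0 := congrFun hv i
    rw [Matrix.mulVec, dotProduct, Finset.sum_eq_single j] at h0
    · simpa [v0Matrix, hij] using h0
    · intro l _ hlj
      by_cases hil : V0At d i l
      · rw [hl l hil hlj, mul_zero]
      · simp [v0Matrix, hil]
    · simp
  obtain ⟨q, hq⟩ : ∃ q, q = d.q := ⟨_, rfl⟩
  obtain ⟨r, hr⟩ : ∃ r, r = d.r := ⟨_, rfl⟩
  obtain ⟨s, hs⟩ : ∃ s, s = d.s := ⟨_, rfl⟩
  obtain ⟨t, ht⟩ : ∃ t, t = d.t := ⟨_, rfl⟩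
  have ha : d.a = d.q + d.r + d.s := rfl
  have hN : d.N = d.q + d.r + d.s + (d.t + d.r + d.s) := rfl
  have hp : d.p = d.s + d.r := rfl
  have h1 : ∀ j : Fin d.N, (j : ℕ) < s → x j = 0 := by
    intro j hj
    refine key ⟨q + r + (s - 1 - j), by omega⟩ j (Or.inr (Or.inr (Or.inl (by dsimp only; omega)))) fun l h1 h2 => ?_
    exact absurd (Fin.ext (by dsimp only [V0At] at h1; omega)) h2
  have h2 : ∀ j : Fin d.N, 2 * s ≤ (j : ℕ) → (j : ℕ) < 2 * s + r → x j = 0 := by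
    intro j hj hj'
    refine key ⟨q + (2 * s + r - 1 - j), by omega⟩ j (Or.inr (Or.inl (by dsimp only; omega))) fun l h1 h2 => ?_
    exact absurd (Fin.ext (by dsimp only [V0At] at h1; omega)) h2
  refine hx (funext fun j => ?_)
  have hj := j.2
  by_cases c1 : (j : ℕ) < s
  · exact h1 j c1
  by_cases c2 : (j : ℕ) < 2 * s
  · refine key ⟨q + r + s + t + r + (j - s), by omega⟩ j (Or.inr (Or.inr (Or.inr (Or.inr (Or.inr (Or.inr (Or.inr (by dsimp only; omega))))))))
      fun l hl hlj => h1 l ?_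
    by_contra hc
    exact hlj (Fin.ext (by dsimp only [V0At] at hl; omega))
  by_cases c3 : (j : ℕ) < 2 * s + r
  · exact h2 j (by omega) c3
  by_cases c4 : (j : ℕ) < 2 * s + r + q
  · refine key ⟨2 * s + r + q - 1 - j, by omega⟩ j (Or.inl (by dsimp only; omega)) fun l hl hlj => ?_
    exact absurd (Fin.ext (by dsimp only [V0At] at hl; omega)) hlj
  by_cases c5 : (j : ℕ) < 2 * s + r + q + t
  · refine key ⟨q + r + s + (j - (2 * s + r + q)), by omega⟩ j (Or.inr (Or.inr (Or.inr (Or.inl (by dsimp only; omega)))))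
      fun l hl hlj => ?_
    exact absurd (Fin.ext (by dsimp only [V0At] at hl; omega)) hlj
  · refine key ⟨q + r + s + t + (j - (2 * s + r + q + t)), by omega⟩ j (Or.inr (Or.inr (Or.inr (Or.inr (Or.inr (Or.inl (by dsimp only; omega)))))))
      fun l hl hlj => h2 l ?_ ?_
    · by_contra hc
      exact hlj (Fin.ext (by dsimp only [V0At] at hl; omega))
    · by_contra hc
      exact hlj (Fin.ext (by dsimp only [V0At] at hl; omega))

lemma WAt_right {i j j' : ℕ} (h : WAt d i j) (h' : WAt d i j') : j = j' := by
  dsimp only [WAt, BlockSizes.p] at h h'; omega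

lemma WAt_left {i i' j : ℕ} (h : WAt d i j) (h' : WAt d i' j) : i = i' := by
  dsimp only [WAt, BlockSizes.p] at h h'; omega

lemma WAt_exists (i : Fin d.N) : ∃ j : Fin d.N, WAt d i j := by
  obtain ⟨i, hi⟩ := i
  obtain ⟨q, hq⟩ : ∃ q, q = d.q := ⟨_, rfl⟩
  obtain ⟨r, hr⟩ : ∃ r, r = d.r := ⟨_, rfl⟩
  obtain ⟨s, hs⟩ : ∃ s, s = d.s := ⟨_, rfl⟩
  obtain ⟨t, ht⟩ : ∃ t, t = d.t := ⟨_, rfl⟩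
  have ha : d.a = d.q + d.r + d.s := rfl
  have hN : d.N = d.q + d.r + d.s + (d.t + d.r + d.s) := rfl
  have hp : d.p = d.s + d.r := rfl
  by_cases c1 : i < s
  · exact ⟨⟨2 * s - 1 - i, by omega⟩, Or.inl (by dsimp only; omega)⟩
  by_cases c2 : i < s + r
  · exact ⟨⟨s + 2 * s + r + q + t + r - 1 - i, by omega⟩, Or.inr (Or.inl (by dsimp only; omega))⟩
  by_cases c3 : i < s + r + q
  · exact ⟨⟨s + r + 2 * s + r + q - 1 - i, by omega⟩, Or.inr (Or.inr (Or.inl (by dsimp only; omega)))⟩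
  by_cases c4 : i < s + r + q + t
  · exact ⟨⟨i - (s + r + q) + (2 * s + r + q), by omega⟩, Or.inr (Or.inr (Or.inr (Or.inl (by dsimp only; omega))))⟩
  by_cases c5 : i < s + r + q + t + r
  · exact ⟨⟨s + r + q + t + 2 * s + r - 1 - i, by omega⟩, Or.inr (Or.inr (Or.inr (Or.inr (Or.inl (by dsimp only; omega)))))⟩
  · exact ⟨⟨s + r + q + t + r + s - 1 - i, by omega⟩, Or.inr (Or.inr (Or.inr (Or.inr (Or.inr (by dsimp only; omega)))))⟩

lemma wMatrix_mul_transpose : wMatrix k d * (wMatrix k d).transpose = 1 := by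
  ext i j
  obtain ⟨l, hl⟩ := WAt_exists d i
  rw [Matrix.mul_apply, Finset.sum_eq_single l]
  · by_cases h : i = j
    · subst h
      simp [wMatrix, hl]
    · have : ¬ WAt d j l := fun h' => h (Fin.ext (WAt_left d hl h'))
      simp [wMatrix, this, h]
  · intro m _ hm
    have : ¬ WAt d i m := fun h' => hm (Fin.ext (WAt_right d h' hl))
    simp [wMatrix, this]
  · simp

/-- `v₀` as an element of `G`. -/
noncomputable def v0 : Matrix.GeneralLinearGroup (Fin d.N) k :=
  Matrix.GeneralLinearGroup.mkOfDetNeZero (v0Matrix k d) (v0Matrix_det_ne_zero k d)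

/-- `w` as an element of `G`. -/
def w : Matrix.GeneralLinearGroup (Fin d.N) k where
  val := wMatrix k d
  inv := (wMatrix k d).transpose
  val_inv := wMatrix_mul_transpose k d
  inv_val := mul_eq_one_comm.1 (wMatrix_mul_transpose k d)

end Blocks

section Groups

variable (k : Type u) [Field k]

/-- Block upper triangular invertible matrices; `c i` is the label of the block of the index `i`. -/
def blockUpper {N : ℕ} {α : Type} [LinearOrder α] (c : Fin N → α) :
    Subgroup (Matrix.GeneralLinearGroup (Fin N) k) where
  carrier := {g | g.1.BlockTriangular c}
  mul_mem' := fun hg hh => Matrix.BlockTriangular.mul hg hh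
  one_mem' := Matrix.blockTriangular_one
  inv_mem' := by
    intro g hg
    change (g⁻¹).1.BlockTriangular c
    rw [Matrix.coe_units_inv]
    have := g.invertible
    exact Matrix.blockTriangular_inv_of_blockTriangular hg

/-- The Borel subgroup `B₊` of upper triangular matrices in `GL(N)`. -/
def borelUpper (N : ℕ) : Subgroup (Matrix.GeneralLinearGroup (Fin N) k) :=
  blockUpper k (fun i : Fin N => i)

/-- The unipotent radical `U₊` of `B₊`: upper triangular matrices with ones on the diagonal. -/
def unipUpper (N : ℕ) : Set (Matrix.GeneralLinearGroup (Fin N) k) :=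
  {g | (∀ i j, j < i → g.1 i j = 0) ∧ ∀ i, g.1 i i = 1}

/-- The unipotent radical `U₋` of `B₋`: lower triangular matrices with ones on the diagonal. -/
def unipLower (N : ℕ) : Set (Matrix.GeneralLinearGroup (Fin N) k) :=
  {g | (∀ i j, i < j → g.1 i j = 0) ∧ ∀ i, g.1 i i = 1}

variable {k} in
/-- A subgroup of `GL(N)` is parabolic if it is Zariski closed and contains a Borel subgroup, i.e. a
conjugate of `B₊`. -/
def IsParabolic {N : ℕ} (P : Subgroup (Matrix.GeneralLinearGroup (Fin N) k)) : Prop :=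
  (∃ I : Set (Matrix.GeneralLinearGroup (Fin N) k → k), I ⊆ (glSpace k N).fn ∧
    (P : Set (Matrix.GeneralLinearGroup (Fin N) k)) = {g | ∀ f ∈ I, f g = 0}) ∧
  ∃ h : Matrix.GeneralLinearGroup (Fin N) k, ∀ x ∈ borelUpper k N, h * x * h⁻¹ ∈ P

variable (d : BlockSizes)

/-- The group `K = GL(a) × GL(b)`, embedded as two blocks along the diagonal of `G = GL(a+b)`. -/
def groupK : Subgroup (Matrix.GeneralLinearGroup (Fin d.N) k) :=
  blockUpper k (fun i : Fin d.N => if (i : ℕ) < d.a then 0 else 1) ⊓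
    blockUpper k (fun i : Fin d.N => if (i : ℕ) < d.a then 1 else 0)

/-- The parabolic subgroup `P'` of block upper triangular matrices, with `2s+r` blocks of size `1`,
then a block of size `q+t`, then `r` blocks of size `1`. -/
def parabolicP' : Subgroup (Matrix.GeneralLinearGroup (Fin d.N) k) :=
  blockUpper k (fun i : Fin d.N =>
    if 2 * d.s + d.r ≤ (i : ℕ) ∧ (i : ℕ) < 2 * d.s + d.r + (d.q + d.t) then 2 * d.s + d.r
    else (i : ℕ))

/-- The group `B'` of lower triangular matrices of the block form
```
     p  q  t  p
p    ℓ  .  .  .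
q    *  1  .  .
t    *  .  1  .
p    *  *  *  u
```
with `p = s + r`, `ℓ` lower triangular and invertible, `u` lower triangular with ones on the
diagonal. -/
def groupB' : Set (Matrix.GeneralLinearGroup (Fin d.N) k) :=
  {g | (∀ i j, i < j → g.1 i j = 0) ∧
    (∀ i j : Fin d.N, d.p ≤ (i : ℕ) → (i : ℕ) < d.p + d.q + d.t → d.p ≤ (j : ℕ) →
      (j : ℕ) < d.p + d.q + d.t → g.1 i j = if i = j then 1 else 0) ∧
    ∀ i : Fin d.N, d.p + d.q + d.t ≤ (i : ℕ) → g.1 i i = 1}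

/-- The unipotent radical `U'` of the connected solvable group `B'`: its unipotent elements, i.e.
its elements with ones on the diagonal. -/
def groupU' : Set (Matrix.GeneralLinearGroup (Fin d.N) k) :=
  {g | g ∈ groupB' k d ∧ ∀ i, g.1 i i = 1}

/-- The maximal torus `T'` of diagonal matrices in `B'`. -/
def groupT' : Set (Matrix.GeneralLinearGroup (Fin d.N) k) :=
  {g | g ∈ groupB' k d ∧ ∀ i j, i ≠ j → g.1 i j = 0}

/-- The factor `Q₁` of `Q = Q₁ × Q₂`: matrices that differ from `1` only in block row `q` and block
column `t`, for rows and columns in blocks of sizes `p, q, t, p`. -/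
def groupQ1 : Set (Matrix.GeneralLinearGroup (Fin d.N) k) :=
  {g | ∀ i j : Fin d.N, ¬ ((d.p ≤ (i : ℕ) ∧ (i : ℕ) < d.p + d.q) ∧
    (d.p + d.q ≤ (j : ℕ) ∧ (j : ℕ) < d.p + d.q + d.t)) → g.1 i j = if i = j then 1 else 0}

/-- The factor `Q₂` of `Q = Q₁ × Q₂`: matrices that differ from `1` only in block row `t` and block
column `q`, for rows and columns in blocks of sizes `p, q, t, p`. -/
def groupQ2 : Set (Matrix.GeneralLinearGroup (Fin d.N) k) :=
  {g | ∀ i j : Fin d.N, ¬ ((d.p + d.q ≤ (i : ℕ) ∧ (i : ℕ) < d.p + d.q + d.t) ∧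
    (d.p ≤ (j : ℕ) ∧ (j : ℕ) < d.p + d.q)) → g.1 i j = if i = j then 1 else 0}

/-- The torus `T_S` of block diagonal matrices `(J t₁ J, t₁, J t₂ J, J t₃ J, t₄, t₂)`, with blocks of
sizes `s, s, r, q, t, r` and `t₁, …, t₄` diagonal and invertible. -/
def torusTS : Set (Matrix.GeneralLinearGroup (Fin d.N) k) :=
  {g | (∀ i j, i ≠ j → g.1 i j = 0) ∧
    (∀ i j : Fin d.N, AntiAt 0 d.s d.s i j → g.1 i i = g.1 j j) ∧
    ∀ i j : Fin d.N, AntiAt (2 * d.s) (2 * d.s + d.r + d.q + d.t) d.r i j → g.1 i i = g.1 j j}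

/-- `w⁻¹ Γ w`. -/
def conjInvW (Γ : Set (Matrix.GeneralLinearGroup (Fin d.N) k)) :
    Set (Matrix.GeneralLinearGroup (Fin d.N) k) :=
  {g | w k d * g * (w k d)⁻¹ ∈ Γ}

/-- `U'_{+,w} = U' ∩ w U₊ w⁻¹`. -/
def groupU'plus : Set (Matrix.GeneralLinearGroup (Fin d.N) k) :=
  {g | g ∈ groupU' k d ∧ (w k d)⁻¹ * g * w k d ∈ unipUpper k d.N}

/-- `w⁻¹ U' w ∩ U₋`. -/
def groupSlice : Set (Matrix.GeneralLinearGroup (Fin d.N) k) :=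
  conjInvW k d (groupU' k d) ∩ unipLower k d.N

end Groups

section Stability

variable {k : Type u} [Field k] {N : ℕ}

lemma conj_diag {t g : Matrix.GeneralLinearGroup (Fin N) k} (ht : ∀ i j, i ≠ j → t.1 i j = 0)
    (i j : Fin N) : t.1 i i * (t⁻¹ * g * t).1 i j = g.1 i j * t.1 j j := by
  have h1 : (t * (t⁻¹ * g * t)).1 i j = (g * t).1 i j := by
    rw [← mul_assoc, ← mul_assoc, mul_inv_cancel, one_mul]
  have h2 : (t * (t⁻¹ * g * t)).1 i j = t.1 i i * (t⁻¹ * g * t).1 i j :=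
    (Matrix.mul_apply (M := t.1) (N := (t⁻¹ * g * t).1)).trans
      (Finset.sum_eq_single i (fun l _ hl => by rw [ht i l hl.symm, zero_mul]) (by simp))
  have h3 : (g * t).1 i j = g.1 i j * t.1 j j :=
    (Matrix.mul_apply (M := g.1) (N := t.1)).trans
      (Finset.sum_eq_single j (fun l _ hl => by rw [ht l j hl, mul_zero]) (by simp))
  rw [← h2, ← h3, h1]

lemma diag_ne_zero {t : Matrix.GeneralLinearGroup (Fin N) k} (ht : ∀ i j, i ≠ j → t.1 i j = 0)
    (i : Fin N) : t.1 i i ≠ 0 := by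
  intro h
  have h1 : (t * t⁻¹).1 i i = 1 := by rw [mul_inv_cancel]; simp
  rw [Units.val_mul, Matrix.mul_apply] at h1
  refine one_ne_zero (h1.symm.trans (Finset.sum_eq_zero fun l _ => ?_))
  by_cases hl : i = l
  · subst hl; rw [h, zero_mul]
  · rw [ht i l hl, zero_mul]

lemma conj_apply_self {t g : Matrix.GeneralLinearGroup (Fin N) k}
    (ht : ∀ i j, i ≠ j → t.1 i j = 0) (i : Fin N) : (t⁻¹ * g * t).1 i i = g.1 i i :=
  mul_left_cancel₀ (diag_ne_zero ht i) ((conj_diag ht i i).trans (mul_comm _ _))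

lemma conj_apply_zero {t g : Matrix.GeneralLinearGroup (Fin N) k}
    (ht : ∀ i j, i ≠ j → t.1 i j = 0) {i j : Fin N} (h : g.1 i j = 0) :
    (t⁻¹ * g * t).1 i j = 0 :=
  mul_left_cancel₀ (diag_ne_zero ht i) (by rw [conj_diag ht, h, zero_mul, mul_zero])

lemma conj_apply_one {t g : Matrix.GeneralLinearGroup (Fin N) k}
    (ht : ∀ i j, i ≠ j → t.1 i j = 0) {i j : Fin N} (h : g.1 i j = if i = j then 1 else 0) :
    (t⁻¹ * g * t).1 i j = if i = j then 1 else 0 := by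
  by_cases hij : i = j
  · subst hij; rw [conj_apply_self ht, h]
  · rw [if_neg hij] at h ⊢; exact conj_apply_zero ht h

variable (d : BlockSizes)

lemma w_conj_diag {t : Matrix.GeneralLinearGroup (Fin d.N) k} (ht : ∀ i j, i ≠ j → t.1 i j = 0) :
    ∀ i j, i ≠ j → (w k d * t * (w k d)⁻¹).1 i j = 0 := by
  intro i j hij
  change (wMatrix k d * t.1 * (wMatrix k d).transpose) i j = 0
  rw [Matrix.mul_apply]
  refine Finset.sum_eq_zero fun l _ => ?_
  rw [Matrix.mul_apply, Finset.sum_eq_single l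
    (fun m _ hm => by rw [ht m l hm, mul_zero]) (by simp)]
  by_cases h1 : WAt d i l
  · have h2 : ¬ WAt d j l := fun h => hij (Fin.ext (WAt_left d h1 h))
    simp [wMatrix, h2]
  · simp [wMatrix, h1]

/-- `Γ` is stable under conjugation by diagonal matrices. -/
def DiagStable (Γ : Set (Matrix.GeneralLinearGroup (Fin N) k)) : Prop :=
  ∀ g ∈ Γ, ∀ t : Matrix.GeneralLinearGroup (Fin N) k, (∀ i j, i ≠ j → t.1 i j = 0) →
    t⁻¹ * g * t ∈ Γ

lemma diagStable_conjInvW {Γ : Set (Matrix.GeneralLinearGroup (Fin d.N) k)} (h : DiagStable Γ) :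
    DiagStable (conjInvW k d Γ) := by
  intro g hg t ht
  have := h _ hg _ (w_conj_diag d ht)
  change w k d * (t⁻¹ * g * t) * (w k d)⁻¹ ∈ Γ
  convert this using 1
  group

lemma diagStable_B' : DiagStable (groupB' k d) := fun _ hg _ ht =>
  ⟨fun i j hij => conj_apply_zero ht (hg.1 i j hij),
    fun i j h1 h2 h3 h4 => conj_apply_one ht (hg.2.1 i j h1 h2 h3 h4),
    fun i hi => (conj_apply_self ht i).trans (hg.2.2 i hi)⟩

lemma diagStable_U' : DiagStable (groupU' k d) := fun _ hg t ht =>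
  ⟨diagStable_B' d _ hg.1 t ht, fun i => (conj_apply_self ht i).trans (hg.2 i)⟩

lemma diagStable_T' : DiagStable (groupT' k d) := fun _ hg t ht =>
  ⟨diagStable_B' d _ hg.1 t ht, fun i j hij => conj_apply_zero ht (hg.2 i j hij)⟩

lemma diagStable_Q1 : DiagStable (groupQ1 k d) := fun _ hg _ ht i j hij =>
  conj_apply_one ht (hg i j hij)

lemma diagStable_Q2 : DiagStable (groupQ2 k d) := fun _ hg _ ht i j hij =>
  conj_apply_one ht (hg i j hij)

lemma diagStable_zU : DiagStable (conjInvW k d (groupU'plus k d)) := by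
  intro g hg t ht
  refine ⟨diagStable_conjInvW d (diagStable_U' d) g hg.1 t ht, ?_⟩
  have e : ∀ x : Matrix.GeneralLinearGroup (Fin d.N) k,
      (w k d)⁻¹ * (w k d * x * (w k d)⁻¹) * w k d = x := fun x => by group
  have hg2 := hg.2
  rw [e] at hg2 ⊢
  exact ⟨fun i j hij => conj_apply_zero ht (hg2.1 i j hij),
    fun i => (conj_apply_self ht i).trans (hg2.2 i)⟩

end Stability

section Main

variable (k : Type u) [Field k] (d : BlockSizes)

/-- The symmetric variety `K\G`. -/
noncomputable abbrev KG : Over (Spec (CommRingCat.of k)) := (quotSpace (groupK k d)).toScheme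

/-- The orbit map `Γ → K\G`, `γ ↦ Kgγ`. -/
noncomputable def orbitMap (g : Matrix.GeneralLinearGroup (Fin d.N) k)
    (Γ : Set (Matrix.GeneralLinearGroup (Fin d.N) k)) :
    ((glSpace k d.N).sub Γ).Hom (quotSpace (groupK k d)) :=
  (mulHom (glConst _ g) ((glSpace k d.N).incl Γ)).comp (quotMk (groupK k d))

/-- The orbit of the point `Kg` under `Γ`, as a set of points of the scheme `K\G`. -/
def orbit (g : Matrix.GeneralLinearGroup (Fin d.N) k)
    (Γ : Set (Matrix.GeneralLinearGroup (Fin d.N) k)) : Set (KG k d).left :=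
  Set.range fun x => (orbitMap k d g Γ).toScheme.left x

/-- The orbit closure of `Kg` under `Γ`, with its reduced structure. -/
noncomputable abbrev orbitClosure (g : Matrix.GeneralLinearGroup (Fin d.N) k)
    (Γ : Set (Matrix.GeneralLinearGroup (Fin d.N) k)) : Over (Spec (CommRingCat.of k)) :=
  reducedClosure (KG k d) (orbit k d g Γ)

/-- The inclusion of an orbit closure in `K\G`. -/
noncomputable abbrev orbitClosureι (g : Matrix.GeneralLinearGroup (Fin d.N) k)
    (Γ : Set (Matrix.GeneralLinearGroup (Fin d.N) k)) : orbitClosure k d g Γ ⟶ KG k d :=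
  reducedClosureι (KG k d) (orbit k d g Γ)

/-- The slice `S`: the orbit of `Kv₀` under `w⁻¹ U' w ∩ U₋`, a locally closed subvariety of
`K\G`. -/
noncomputable abbrev slice : Over (Spec (CommRingCat.of k)) :=
  reducedInduced (KG k d) (orbit k d (v0 k d) (groupSlice k d))

/-- The inclusion of the slice in `K\G`. -/
noncomputable abbrev sliceι : slice k d ⟶ KG k d :=
  reducedInducedι (KG k d) (orbit k d (v0 k d) (groupSlice k d))

/-- The torus `T_S`. -/
noncomputable abbrev TSSpace : FunctionSpace k := (glSpace k d.N).sub (torusTS k d)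

/-- `Z = (w⁻¹ U'_{+,w} w) × (w⁻¹ T' w) × (w⁻¹ Q₁ w × w⁻¹ Q₂ w)`. -/
noncomputable abbrev ZSpace : FunctionSpace k :=
  ((glSpace k d.N).sub (conjInvW k d (groupU'plus k d))).prod
    (((glSpace k d.N).sub (conjInvW k d (groupT' k d))).prod
      (((glSpace k d.N).sub (conjInvW k d (groupQ1 k d))).prod
        ((glSpace k d.N).sub (conjInvW k d (groupQ2 k d)))))

/-- The scheme `T_S`. -/
noncomputable abbrev TS : Over (Spec (CommRingCat.of k)) := (TSSpace k d).toScheme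

/-- The scheme `Z`. -/
noncomputable abbrev Z : Over (Spec (CommRingCat.of k)) := (ZSpace k d).toScheme

/-- The multiplication map `p : Z → G`, `(x, y, (y₁, y₂)) ↦ x y y₁ y₂`. -/
noncomputable def pMap : (ZSpace k d).Hom (glSpace k d.N) :=
  let tail := FunctionSpace.prodSnd ((glSpace k d.N).sub (conjInvW k d (groupU'plus k d)))
    (((glSpace k d.N).sub (conjInvW k d (groupT' k d))).prod
      (((glSpace k d.N).sub (conjInvW k d (groupQ1 k d))).prod
        ((glSpace k d.N).sub (conjInvW k d (groupQ2 k d)))))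
  let tail' := tail.comp (FunctionSpace.prodSnd _ _)
  mulHom ((FunctionSpace.prodFst _ _).comp (FunctionSpace.incl _ _))
    (mulHom ((tail.comp (FunctionSpace.prodFst _ _)).comp (FunctionSpace.incl _ _))
      (mulHom ((tail'.comp (FunctionSpace.prodFst _ _)).comp (FunctionSpace.incl _ _))
        ((tail'.comp (FunctionSpace.prodSnd _ _)).comp (FunctionSpace.incl _ _))))

/-- The action `K\G × G → K\G` by right multiplication. -/
noncomputable def actG : KG k d ⊗ (glSpace k d.N).toScheme ⟶ KG k d :=
  inv (FunctionSpace.prodComparison (quotSpace (groupK k d)) (glSpace k d.N)) ≫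
    (quotAct (groupK k d)).toScheme

/-- The action of `T_S` on `K\G` by right multiplication. -/
noncomputable def actTS : KG k d ⊗ TS k d ⟶ KG k d :=
  (KG k d ◁ ((glSpace k d.N).incl (torusTS k d)).toScheme) ≫ actG k d

/-- The morphism `Ψ : S × Z → K\G`, `(x, z) ↦ x p(z)`. -/
noncomputable def Psi : slice k d ⊗ Z k d ⟶ KG k d :=
  (sliceι k d ⊗ₘ (pMap k d).toScheme) ≫ actG k d

variable {k} in
/-- The regular map `x ↦ (ψ x)⁻¹ (φ x) (ψ x)`, for `φ` with values in a set `Γ` of matrices that is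
stable under conjugation by diagonal matrices, and `ψ` with values in `T_S`. -/
noncomputable def conjTS {Γ : Set (Matrix.GeneralLinearGroup (Fin d.N) k)} (h : DiagStable Γ)
    {X : FunctionSpace k} (φ : X.Hom ((glSpace k d.N).sub Γ)) (ψ : X.Hom (TSSpace k d)) :
    X.Hom ((glSpace k d.N).sub Γ) :=
  (mulHom (mulHom ((ψ.comp (FunctionSpace.incl _ _)).comp glInv)
      (φ.comp (FunctionSpace.incl _ _))) (ψ.comp (FunctionSpace.incl _ _))).codRestrict Γ
    fun x => h _ (φ.toFun x).2 _ (ψ.toFun x).2.1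

/-- `T_S` acting by conjugation on each factor of `Z`, as a map `(z, t) ↦ z · t`. -/
noncomputable def conjZ : ((ZSpace k d).prod (TSSpace k d)).Hom (ZSpace k d) :=
  let z := FunctionSpace.prodFst (ZSpace k d) (TSSpace k d)
  let t := FunctionSpace.prodSnd (ZSpace k d) (TSSpace k d)
  let z' := z.comp (FunctionSpace.prodSnd _ _)
  let z'' := z'.comp (FunctionSpace.prodSnd _ _)
  (conjTS d (diagStable_zU d) (z.comp (FunctionSpace.prodFst _ _)) t).pair
    ((conjTS d (diagStable_conjInvW d (diagStable_T' d)) (z'.comp (FunctionSpace.prodFst _ _)) t).pair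
      ((conjTS d (diagStable_conjInvW d (diagStable_Q1 d))
          (z''.comp (FunctionSpace.prodFst _ _)) t).pair
        (conjTS d (diagStable_conjInvW d (diagStable_Q2 d))
          (z''.comp (FunctionSpace.prodSnd _ _)) t)))

/-- The action of `T_S` on `Z` by conjugation on each factor. -/
noncomputable def actZ : Z k d ⊗ TS k d ⟶ Z k d :=
  inv (FunctionSpace.prodComparison (ZSpace k d) (TSSpace k d)) ≫ (conjZ k d).toScheme

end Main

end KGSlice

open KGSlice

/-! ### Open immersions of affine varieties from local sections -/

namespace KGSlice

/-! The heart of the matter is a normal form for cosets. In suitable orders of rows and columns,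
`rowEquiv` and `colEquiv`, the matrix v₀ consists of identity and zero blocks (`v0_submatrix`), and
products v₀ b y₁ y₂ with b in w⁻¹B'w and yᵢ in w⁻¹Qᵢw are exactly the matrices `BlockData.mat`.
Whether a coset Kg meets this set becomes linear algebra: one looks for a block diagonal κ that
brings the reordered g into this shape. The columns W₃, W₄ of the lower half fix κ up to a few
blocks, then V₂ − V₃Y and V₄ do the same for the upper half, and what remains is an LU-factorization
of a single p × p matrix. Hence the normal form is unique (`BlockData.mat_unique`), and near any
coset that has one it exists and depends regularly on the coset (`exists_local_blockData`).

Two further ingredients turn this into an open immersion. Cosets have regular local representatives,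
because K is the centralizer of a projection F and Kg ↦ g⁻¹Fg is regular
(`exists_local_representative`). Elements of w⁻¹B'w factor uniquely and regularly into a part in
w⁻¹U'w ∩ U₋, a part in w⁻¹U'₊w and a part in w⁻¹T'w (`exists_factorization`,
`factorization_unique`). So (u, z) ↦ Kv₀ u p(z) is injective on points and has regular local
sections. Over an algebraically closed field such a map of affine varieties is an open immersion
(`FunctionSpace.isOpenImmersion_of_localSections`). No tangent spaces are compared, so the
characteristic plays no role.

Restricting this open immersion to z = 1 shows that the orbit map of the slice is an immersion, and
hence that S is isomorphic to the group w⁻¹U'w ∩ U₋ (`exists_iso_slice`). This makes Ψ itself an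
open immersion.

For orbit closures the point is that p takes values in P' (`pMap_mem_parabolicP'`). Multiplication
by p(z) and by p(z)⁻¹ therefore preserves the closure of every P-orbit, so x p(z) lies in it if and
only if x does. `exists_iso_pullback` is the scheme-theoretic form of this remark. Finally T_S
consists of diagonal matrices that fix the point Kv₀ (`quotMk_v0_conj`); diagonal conjugation
preserves all groups involved, which gives stability and equivariance. -/

lemma isOpenImmersion_Spec_map {A B : Type u} [CommRing A] [CommRing B] (ψ : A →+* B)
    {ι : Type*} (f : ι → A) (hspan : Ideal.span (Set.range fun i => ψ (f i)) = ⊤)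
    (hf : ∀ i, Function.Bijective (Localization.awayMap ψ (f i))) :
    IsOpenImmersion (Spec.map (CommRingCat.ofHom ψ)) := by
  -- The `f i` need not generate the unit ideal of `A`. The hypothesis on their images says that the
  -- image of the morphism lies in the union of the sets D(f i), and over these the morphism is an
  -- isomorphism.
  let U : ι → (Spec (CommRingCat.of A)).Opens := fun i => PrimeSpectrum.basicOpen (f i)
  refine IsZariskiLocalAtTarget.of_range_subset_iSup (P := @IsOpenImmersion) U ?_ fun i => ?_
  · rintro _ ⟨p, rfl⟩
    by_contra hp
    let p' : PrimeSpectrum B := p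
    refine p'.2.ne_top (top_le_iff.1 (hspan ▸ Ideal.span_le.2 ?_))
    rintro _ ⟨i, rfl⟩
    by_contra hi
    exact hp (TopologicalSpace.Opens.mem_iSup.2 ⟨i, hi⟩)
  · refine (MorphismProperty.arrow_mk_iso_iff @IsOpenImmersion
      (SpecMapRestrictBasicOpenIso (CommRingCat.ofHom ψ) (f i))).2 ?_
    have : IsIso (CommRingCat.ofHom (Localization.awayMap ψ (f i))) :=
      (ConcreteCategory.isIso_iff_bijective _).2 (hf i)
    exact inferInstanceAs (IsOpenImmersion (Spec.map
      (CommRingCat.ofHom (Localization.awayMap ψ (f i)))))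

namespace FunctionSpace

variable {k : Type u} [Field k]

/-- The functions that are quotients of regular functions near `x₀`. The values away from a
neighbourhood of `x₀` are arbitrary. -/
def locFn (X : FunctionSpace k) (x₀ : X.pts) : Subalgebra k (X.pts → k) where
  carrier := {a | ∃ f ∈ X.fn, f x₀ ≠ 0 ∧ f * a ∈ X.fn}
  mul_mem' := by
    rintro a b ⟨f, hf, hf0, hfa⟩ ⟨g, hg, hg0, hgb⟩
    refine ⟨f * g, X.fn.mul_mem hf hg, mul_ne_zero hf0 hg0, ?_⟩
    rw [mul_mul_mul_comm]
    exact X.fn.mul_mem hfa hgb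
  add_mem' := by
    rintro a b ⟨f, hf, hf0, hfa⟩ ⟨g, hg, hg0, hgb⟩
    refine ⟨f * g, X.fn.mul_mem hf hg, mul_ne_zero hf0 hg0, ?_⟩
    have : f * g * (a + b) = g * (f * a) + f * (g * b) := by ring
    rw [this]
    exact X.fn.add_mem (X.fn.mul_mem hg hfa) (X.fn.mul_mem hf hgb)
  algebraMap_mem' c := ⟨1, X.fn.one_mem, one_ne_zero, by
    rw [one_mul]; exact X.fn.algebraMap_mem c⟩

/-- The Zariski neighbourhoods of `x₀`. -/
def nhd (X : FunctionSpace k) (x₀ : X.pts) : Filter X.pts where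
  sets := {E | ∃ f ∈ X.fn, f x₀ ≠ 0 ∧ ∀ x, f x ≠ 0 → x ∈ E}
  univ_sets := ⟨1, X.fn.one_mem, one_ne_zero, fun _ _ => trivial⟩
  sets_of_superset := fun ⟨f, hf, hf0, h⟩ hE => ⟨f, hf, hf0, fun x hx => hE (h x hx)⟩
  inter_sets := fun ⟨f, hf, hf0, h⟩ ⟨g, hg, hg0, h'⟩ => ⟨f * g, X.fn.mul_mem hf hg,
    mul_ne_zero hf0 hg0, fun x hx => ⟨h x (left_ne_zero_of_mul hx), h' x (right_ne_zero_of_mul hx)⟩⟩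

/-- The space `X` with the functions that are regular near `x₀`. -/
abbrev localAt (X : FunctionSpace k) (x₀ : X.pts) : FunctionSpace k := ⟨X.pts, X.locFn x₀⟩

section Local

variable {X : FunctionSpace k} {x₀ : X.pts}

lemma fn_le_locFn : X.fn ≤ X.locFn x₀ := fun f hf =>
  ⟨1, X.fn.one_mem, one_ne_zero, by rwa [one_mul]⟩

/-- Multiplication by a regular function that vanishes off the neighbourhood removes the
discrepancy. Only the germ at `x₀` matters, so values elsewhere may be chosen freely. -/
lemma locFn_congr {a b : X.pts → k} (ha : a ∈ X.locFn x₀) (h : ∀ᶠ x in X.nhd x₀, b x = a x) :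
    b ∈ X.locFn x₀ := by
  obtain ⟨f, hf, hf0, hfa⟩ := ha
  obtain ⟨g, hg, hg0, h⟩ := h
  refine ⟨g * f, X.fn.mul_mem hg hf, mul_ne_zero hg0 hf0, ?_⟩
  have : g * f * b = g * (f * a) := by
    ext x
    by_cases hx : g x = 0
    · simp [hx]
    · have h' : b x = a x := h x hx
      simp [h', mul_assoc]
  rw [this]
  exact X.fn.mul_mem hg hfa

lemma eventually_ne_zero {a : X.pts → k} (ha : a ∈ X.locFn x₀) (h : a x₀ ≠ 0) :
    ∀ᶠ x in X.nhd x₀, a x ≠ 0 := by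
  obtain ⟨f, hf, hf0, hfa⟩ := ha
  exact ⟨f * a, hfa, mul_ne_zero hf0 h, fun x hx => right_ne_zero_of_mul hx⟩

lemma locFn_inv {a : X.pts → k} (ha : a ∈ X.locFn x₀) (h : a x₀ ≠ 0) :
    (fun x => (a x)⁻¹) ∈ X.locFn x₀ := by
  obtain ⟨f, hf, hf0, hfa⟩ := ha
  -- As 0⁻¹ = 0, a single factor f a would give f only where a ≠ 0, which need not be regular. The
  -- square gives f (f a) everywhere.
  refine ⟨(f * a) * (f * a), X.fn.mul_mem hfa hfa,
    mul_ne_zero (mul_ne_zero hf0 h) (mul_ne_zero hf0 h), ?_⟩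
  have : ((f * a) * (f * a) * fun x => (a x)⁻¹) = f * (f * a) := by
    ext x
    by_cases hx : a x = 0
    · simp [hx]
    · simp only [Pi.mul_apply]
      field_simp
  rw [this]
  exact X.fn.mul_mem hf hfa

end Local

/-- `X` is the set of `k`-points of an affine scheme of finite type: every homomorphism from the
regular functions to `k` is the evaluation at a point. -/
structure IsVariety (X : FunctionSpace k) : Prop where
  finiteType : Algebra.FiniteType k X.fn
  exists_eval : ∀ χ : X.fn →ₐ[k] k, ∃ x, ∀ f : X.fn, χ f = f.1 x

/-- A character of a tensor product is determined by its restrictions to the two factors, which are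
evaluations at points x and y. -/
lemma IsVariety.prod {X Y : FunctionSpace k} (hX : X.IsVariety) (hY : Y.IsVariety) :
    (X.prod Y).IsVariety := by
  have := hX.finiteType
  have := hY.finiteType
  have : Algebra.FiniteType k (TensorProduct k X.fn Y.fn) :=
    .trans (S := X.fn) inferInstance inferInstance
  refine ⟨.of_surjective (prodMap X Y).rangeRestrict (AlgHom.rangeRestrict_surjective _), ?_⟩
  intro χ
  obtain ⟨x, hx⟩ := hX.exists_eval (χ.comp (prodFst X Y).pullback)
  obtain ⟨y, hy⟩ := hY.exists_eval (χ.comp (prodSnd X Y).pullback)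
  refine ⟨(x, y), ?_⟩
  rintro ⟨_, a, rfl⟩
  change χ ((prodMap X Y).rangeRestrict a) = prodMap X Y a (x, y)
  induction a using TensorProduct.induction_on with
  | zero => simp
  | add a b ha hb => rw [map_add, map_add, map_add, ha, hb]; rfl
  | tmul f g =>
    rw [prodMap_tmul, ← hx, ← hy]
    change _ = χ _ * χ _
    rw [← map_mul]
    refine congrArg χ (Subtype.ext (funext fun z => ?_))
    change prodMap X Y (f ⊗ₜ g) z = _
    rw [prodMap_tmul]
    rfl

/-- Nullstellensatz: the residue field of a maximal ideal containing `E` would be k, so the ideal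
would be that of a point at which all of `E` vanishes. -/
lemma IsVariety.span_eq_top [IsAlgClosed k] {X : FunctionSpace k} (hX : X.IsVariety)
    (E : Set X.fn) (h : ∀ x, ∃ f ∈ E, f.1 x ≠ 0) : Ideal.span E = ⊤ := by
  by_contra hE
  obtain ⟨m, hm, hle⟩ := Ideal.exists_le_maximal _ hE
  have := hX.finiteType
  let : Field (X.fn ⧸ m) := Ideal.Quotient.field m
  have : Algebra.FiniteType k (X.fn ⧸ m) :=
    .of_surjective (Ideal.Quotient.mkₐ k m) (Ideal.Quotient.mkₐ_surjective k m)
  have : Module.Finite k (X.fn ⧸ m) := finite_of_finite_type_of_isJacobsonRing k _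
  have : Algebra.IsIntegral k (X.fn ⧸ m) := Algebra.IsIntegral.of_finite k _
  have hb : Function.Bijective (algebraMap k (X.fn ⧸ m)) :=
    IsAlgClosed.algebraMap_bijective_of_isIntegral (k := k) (K := X.fn ⧸ m)
  let e : k ≃ₐ[k] (X.fn ⧸ m) := AlgEquiv.ofBijective (Algebra.ofId k _) hb
  obtain ⟨x, hx⟩ := hX.exists_eval (e.symm.toAlgHom.comp (Ideal.Quotient.mkₐ k m))
  obtain ⟨f, hf, hfx⟩ := h x
  refine hfx ((hx f).symm.trans ?_)
  have : Ideal.Quotient.mk m f = 0 := Ideal.Quotient.eq_zero_iff_mem.2 (hle (Ideal.subset_span hf))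
  change e.symm (Ideal.Quotient.mk m f) = 0
  rw [this, map_zero]


/-- A regular map `φ` that is injective on points and has local sections near each point of its
image is an open immersion. -/
theorem isOpenImmersion_of_localSections [IsAlgClosed k] {X Y : FunctionSpace k} (φ : Y.Hom X)
    (hY : Y.IsVariety) (hinj : Function.Injective φ.toFun)
    (hsec : ∀ y, ∃ s : (X.localAt (φ.toFun y)).Hom Y,
      ∀ᶠ x in X.nhd (φ.toFun y), φ.toFun (s.toFun x) = x) :
    IsOpenImmersion φ.toScheme.left := by
  have key : ∀ y, ∃ f : X.fn, f.1 (φ.toFun y) ≠ 0 ∧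
      Function.Bijective (Localization.awayMap φ.pullback.toRingHom f) := by
    intro y
    obtain ⟨s, g, hg, hg0, hs⟩ := hsec y
    obtain ⟨T, hT⟩ := hY.finiteType.out
    choose f hf hf0 hfa using fun a : Y.fn => s.regular a.1 a.2
    -- `F` clears the denominators of the pull-backs under s of finitely many generators, and
    -- vanishes wherever s is not known to be a section.
    let F : X.fn := ⟨g, hg⟩ * ∏ a ∈ T, ⟨f a, hf a⟩
    have hF : ∀ a ∈ T, ∃ F' : X.fn, F = F' * ⟨f a, hf a⟩ := fun a ha => by
      classical
      refine ⟨⟨g, hg⟩ * ∏ a ∈ T.erase a, ⟨f a, hf a⟩, ?_⟩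
      rw [mul_assoc, Finset.prod_erase_mul _ _ ha]
    have hFs : ∀ x, F.1 x ≠ 0 → φ.toFun (s.toFun x) = x := fun x hx =>
      hs x (left_ne_zero_of_mul hx)
    refine ⟨F, ?_, Localization.awayMap_injective_iff.2 ?_,
      Localization.awayMap_surjective_iff.2 ?_⟩
    · change ((X.fn.val.comp (AlgHom.id k _)) F) _ ≠ 0
      simp only [F, map_mul, map_prod, Pi.mul_apply, Finset.prod_apply]
      exact mul_ne_zero hg0 (Finset.prod_ne_zero_iff.2 fun a _ => hf0 a)
    -- Every point of D(F) has the form φ(s x), so a function whose pull-back is zero vanishes on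
    -- D(F) and is killed by `F`.
    · intro a ha
      refine ⟨1, Subtype.ext (funext fun x => ?_)⟩
      change (F ^ 1).1 x * a.1 x = 0
      rw [pow_one]
      by_cases hx : F.1 x = 0
      · rw [hx, zero_mul]
      · rw [← hFs x hx]
        have : a.1 (φ.toFun (s.toFun x)) = 0 := congrFun (congrArg Subtype.val ha) (s.toFun x)
        rw [this, mul_zero]
    -- For a generator a, the function F · (a ∘ s) is regular on X. Its pull-back is that of F times
    -- a, because injectivity turns the right inverse s into a two-sided inverse over D(F).
    · intro a
      have ha : a ∈ Algebra.adjoin k (T : Set Y.fn) := hT ▸ Algebra.mem_top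
      induction ha using Algebra.adjoin_induction with
      | mem a ha =>
        obtain ⟨F', hF'⟩ := hF a ha
        refine ⟨F' * ⟨_, hfa a⟩, 1, Subtype.ext (funext fun y => ?_)⟩
        change F'.1 (φ.toFun y) * (f a (φ.toFun y) * a.1 (s.toFun (φ.toFun y))) =
          (φ.pullback F ^ 1).1 y * a.1 y
        rw [pow_one, ← mul_assoc]
        have h1 : F'.1 (φ.toFun y) * f a (φ.toFun y) = F.1 (φ.toFun y) := by
          rw [hF']; rfl
        rw [h1]
        change _ = F.1 (φ.toFun y) * a.1 y
        by_cases hx : F.1 (φ.toFun y) = 0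
        · rw [hx, zero_mul, zero_mul]
        · rw [hinj (hFs _ hx)]
      | algebraMap c => exact ⟨algebraMap k X.fn c, 0, by simp⟩
      | add a b _ _ ha hb =>
        obtain ⟨A, m, hA⟩ := ha
        obtain ⟨B, n, hB⟩ := hb
        refine ⟨F ^ n * A + F ^ m * B, m + n, ?_⟩
        simp only [map_add, map_mul, map_pow, hA, hB]
        simp only [AlgHom.toRingHom_eq_coe, RingHom.coe_coe]
        ring
      | mul a b _ _ ha hb =>
        obtain ⟨A, m, hA⟩ := ha
        obtain ⟨B, n, hB⟩ := hb
        refine ⟨A * B, m + n, ?_⟩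
        simp only [map_mul, hA, hB]
        ring
  choose f hf0 hf using key
  refine isOpenImmersion_Spec_map φ.pullback.toRingHom f (hY.span_eq_top _ ?_) hf
  exact fun y => ⟨_, ⟨y, rfl⟩, hf0 y⟩

end FunctionSpace

end KGSlice

/-! ### Reduced subschemes as images of morphisms -/

namespace KGSlice

section Subschemes

open Scheme IdealSheafData TopologicalSpace

/-- The kernel is a radical ideal because the source is reduced, and by quasi-compactness its
support is the closure of the image. A radical ideal is the vanishing ideal of its support. -/
lemma ker_eq_vanishingIdeal {R X : Scheme.{u}} [IsReduced R] (g : R ⟶ X) [QuasiCompact g] :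
    g.ker = vanishingIdeal (Closeds.closure (Set.range g)) := by
  have h1 : g.ker.radical = g.ker := by
    ext U : 2
    rw [radical_ideal, Hom.ker_apply]
    refine Ideal.IsRadical.radical ?_
    intro x ⟨n, hn⟩
    rw [RingHom.mem_ker, map_pow] at hn
    exact eq_zero_of_pow_eq_zero hn
  rw [← h1, ← vanishingIdeal_support]
  congr 1
  exact SetLike.coe_injective (Hom.support_ker g)

instance isReduced_vanishingIdeal {X : Scheme.{u}} (F : Closeds X) :
    IsReduced (vanishingIdeal F).subscheme := by
  have : ∀ U, IsReduced ((vanishingIdeal F).subschemeCover.openCover.X U) := by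
    intro (U : X.affineOpens)
    have hU : _root_.IsReduced (Γ(X, U.1) ⧸ (vanishingIdeal F).ideal U) := by
      rw [← Ideal.isRadical_iff_quotient_reduced, vanishingIdeal_ideal]
      exact PrimeSpectrum.isRadical_vanishingIdeal _
    exact inferInstanceAs (IsReduced (Spec (.of (Γ(X, U.1) ⧸ (vanishingIdeal F).ideal U))))
  exact IsReduced.of_openCover _ (vanishingIdeal F).subschemeCover.openCover

variable {B : Scheme.{u}} {R X : Over B}

lemma isReduced_reducedClosure (E : Set X.left) : IsReduced (reducedClosure X E).left :=
  isReduced_vanishingIdeal (Closeds.closure E)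

lemma isReduced_reducedInduced (E : Set X.left) : IsReduced (reducedInduced X E).left := by
  have := isReduced_reducedClosure E
  exact inferInstanceAs (IsReduced ((reducedClosureι X E).left ⁻¹ᵁ ambientOpen X E).toScheme)

instance isClosedImmersion_reducedClosureι (E : Set X.left) :
    IsClosedImmersion (reducedClosureι X E).left :=
  inferInstanceAs (IsClosedImmersion (vanishingIdeal (Closeds.closure E)).subschemeι)

lemma range_reducedClosureι (E : Set X.left) :
    Set.range (reducedClosureι X E).left = closure E := by
  change Set.range (vanishingIdeal (Closeds.closure E)).subschemeι = closure E
  rw [range_subschemeι]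
  rfl

/-- A closed immersion lifts a morphism whose kernel contains its ideal. Here both are vanishing
ideals, so an inclusion of closed sets is enough. -/
lemma exists_lift_reducedClosure [IsReduced R.left] (g : R ⟶ X) [QuasiCompact g.left]
    {E : Set X.left} (h : Set.range g.left ⊆ closure E) :
    ∃ l : R ⟶ reducedClosure X E, l ≫ reducedClosureι X E = g := by
  have hker : (reducedClosureι X E).left.ker ≤ g.left.ker := by
    rw [ker_eq_vanishingIdeal g.left]
    change (vanishingIdeal (Closeds.closure E)).subschemeι.ker ≤ _
    rw [ker_subschemeι]
    exact vanishingIdeal_antimono (closure_minimal h isClosed_closure)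
  have hl := IsClosedImmersion.lift_fac (reducedClosureι X E).left g.left hker
  refine ⟨Over.homMk (IsClosedImmersion.lift _ _ hker) ?_, Over.OverMorphism.ext hl⟩
  rw [← Over.w (reducedClosureι X E), ← Category.assoc, hl, Over.w]

/-- A closed immersion with reduced source is the inclusion of the reduced closure of any set with
the same closure as its image. -/
lemma exists_iso_reducedClosure [IsReduced R.left] (g : R ⟶ X) [IsClosedImmersion g.left]
    {E : Set X.left} (h : Set.range g.left = closure E) :
    ∃ e : R ≅ reducedClosure X E, e.hom ≫ reducedClosureι X E = g := by
  obtain ⟨l, hl⟩ := exists_lift_reducedClosure g h.subset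
  have hl' : l.left ≫ (reducedClosureι X E).left = g.left := congrArg CommaMorphism.left hl
  have : IsClosedImmersion (l.left ≫ (reducedClosureι X E).left) := by rw [hl']; infer_instance
  have : IsClosedImmersion l.left := .of_comp_isClosedImmersion _ (reducedClosureι X E).left
  have : Surjective l.left := ⟨fun y => by
    have hy : (reducedClosureι X E).left y ∈ Set.range g.left := by
      rw [h, ← range_reducedClosureι]
      exact ⟨y, rfl⟩
    obtain ⟨x, hx⟩ := hy
    refine ⟨x, (reducedClosureι X E).left.isEmbedding.injective ?_⟩
    rw [← Scheme.Hom.comp_apply, hl', hx]⟩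
  have := isReduced_reducedClosure E
  -- A surjective closed immersion into a reduced scheme has no equations.
  have : IsIso l.left := isIso_of_isClosedImmersion_of_surjective _
  have : IsIso ((Over.forget _).map l) := this
  have := isIso_of_reflects_iso l (Over.forget _)
  exact ⟨asIso l, hl⟩

instance isImmersion_reducedInducedι (E : Set X.left) :
    IsImmersion (reducedInducedι X E).left :=
  inferInstanceAs (IsImmersion (((reducedClosureι X E).left ⁻¹ᵁ ambientOpen X E).ι ≫
    (reducedClosureι X E).left))

lemma reducedInducedι_mem (E : Set X.left) (y : (reducedInduced X E).left) :
    (reducedInducedι X E).left y ∈ closure E ∩ coborder E := by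
  constructor
  · rw [← range_reducedClosureι]
    exact ⟨((reducedClosureι X E).left ⁻¹ᵁ ambientOpen X E).ι y, rfl⟩
  · have hy : (reducedClosureι X E).left (((reducedClosureι X E).left ⁻¹ᵁ ambientOpen X E).ι y) ∈
        interior (coborder E) := y.2
    exact interior_subset hy

/-- A quasi-compact immersion with reduced source is the inclusion of its image with the reduced
induced structure. -/
lemma exists_iso_reducedInduced [IsReduced R.left] (g : R ⟶ X) [IsImmersion g.left]
    [QuasiCompact g.left] {E : Set X.left} (h : Set.range g.left = E) :
    ∃ e : R ≅ reducedInduced X E, e.hom ≫ reducedInducedι X E = g := by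
  have hE : IsLocallyClosed E := h ▸ g.left.isLocallyClosed_range
  obtain ⟨l, hl⟩ := exists_lift_reducedClosure g (E := E) (h.subset.trans subset_closure)
  have hl' : l.left ≫ (reducedClosureι X E).left = g.left := congrArg CommaMorphism.left hl
  let U := (reducedClosureι X E).left ⁻¹ᵁ ambientOpen X E
  -- Local closedness of `E` makes its coborder open, so passing to the interior in `ambientOpen`
  -- loses nothing.
  have hU : Set.range l.left ⊆ Set.range U.ι := by
    rw [Scheme.Opens.range_ι]
    rintro _ ⟨x, rfl⟩
    change (reducedClosureι X E).left (l.left x) ∈ interior (coborder E)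
    rw [← Scheme.Hom.comp_apply, hl', hE.isOpen_coborder.interior_eq]
    exact subset_coborder (h ▸ ⟨x, rfl⟩)
  let m' := IsOpenImmersion.lift U.ι l.left hU
  have hm' : m' ≫ U.ι = l.left := IsOpenImmersion.lift_fac _ _ _
  let m : R ⟶ reducedInduced X E := Over.homMk m' (by
    change m' ≫ U.ι ≫ (reducedClosure X E).hom = _
    rw [← Category.assoc, hm', Over.w])
  have hm : m ≫ reducedInducedι X E = g := by
    rw [← hl]
    refine Over.OverMorphism.ext ?_
    change m' ≫ U.ι ≫ _ = l.left ≫ _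
    rw [← Category.assoc, hm']
  have hmg : m.left ≫ (reducedInducedι X E).left = g.left := congrArg CommaMorphism.left hm
  have : IsImmersion (m.left ≫ (reducedInducedι X E).left) := by rw [hmg]; infer_instance
  have : IsImmersion m.left := .of_comp _ (reducedInducedι X E).left
  have hs : Function.Surjective m.left := fun y => by
    have hy : (reducedInducedι X E).left y ∈ Set.range g.left := by
      rw [h]
      exact closure_inter_coborder.subset (reducedInducedι_mem E y)
    obtain ⟨x, hx⟩ := hy
    refine ⟨x, (reducedInducedι X E).left.isEmbedding.injective ?_⟩
    rw [← Scheme.Hom.comp_apply, hmg, hx]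
  have : Surjective m.left := ⟨hs⟩
  have : IsClosedImmersion m.left := .of_isPreimmersion _ (by
    rw [hs.range_eq]; exact isClosed_univ)
  have := isReduced_reducedInduced E
  have : IsIso m.left := isIso_of_isClosedImmersion_of_surjective _
  have : IsIso ((Over.forget _).map m) := this
  have := isIso_of_reflects_iso m (Over.forget _)
  exact ⟨asIso m, hm⟩

instance mono_reducedClosureι (E : Set X.left) : Mono (reducedClosureι X E) :=
  Over.mono_of_mono_left _

instance mono_reducedInducedι (E : Set X.left) : Mono (reducedInducedι X E) :=
  Over.mono_of_mono_left _

end Subschemes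

/-! ### From regular maps to morphisms of schemes -/

namespace FunctionSpace

variable {k : Type u} [Field k] {X Y Z W : FunctionSpace k}

lemma Hom.ext {φ ψ : X.Hom Y} (h : ∀ x, φ.toFun x = ψ.toFun x) : φ = ψ := by
  obtain ⟨f, hf⟩ := φ
  obtain ⟨g, hg⟩ := ψ
  obtain rfl : f = g := funext h
  rfl

lemma toScheme_comp (φ : X.Hom Y) (ψ : Y.Hom Z) :
    (φ.comp ψ).toScheme = φ.toScheme ≫ ψ.toScheme := by
  refine Over.OverMorphism.ext ?_
  change _ = Spec.map _ ≫ Spec.map _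
  rw [← Spec.map_comp, ← CommRingCat.ofHom_comp]
  rfl

lemma toScheme_pair (φ : X.Hom Y) (ψ : X.Hom Z) :
    (φ.pair ψ).toScheme ≫ prodComparison Y Z = lift φ.toScheme ψ.toScheme := by
  rw [prodComparison, comp_lift, ← toScheme_comp, ← toScheme_comp]
  rfl

lemma lift_toScheme_inv (φ : X.Hom Y) (ψ : X.Hom Z) :
    lift φ.toScheme ψ.toScheme ≫ inv (prodComparison Y Z) = (φ.pair ψ).toScheme := by
  rw [← toScheme_pair, Category.assoc, IsIso.hom_inv_id, Category.comp_id]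

instance isReduced_toScheme : IsReduced X.toScheme.left := by
  have : _root_.IsReduced X.fn := isReduced_of_injective X.fn.val Subtype.val_injective
  exact inferInstanceAs (IsReduced (Spec (CommRingCat.of X.fn)))

lemma isClosedImmersion_toScheme (φ : X.Hom Y) (h : ∀ f ∈ X.fn, ∃ g ∈ Y.fn, ∀ x, g (φ.toFun x) = f x) :
    IsClosedImmersion φ.toScheme.left :=
  IsClosedImmersion.spec_of_surjective _ fun f => by
    obtain ⟨g, hg, hgf⟩ := h f.1 f.2
    exact ⟨⟨g, hg⟩, Subtype.ext (funext hgf)⟩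

/-- The image of a morphism of schemes given by a regular map `φ` has the same closure as the image
of the inclusion of the set of values of `φ`. -/
lemma closure_range_toScheme (φ : X.Hom Y) :
    closure (Set.range φ.toScheme.left) =
      Set.range (Y.incl (Set.range φ.toFun)).toScheme.left := by
  have h1 : closure (Set.range φ.toScheme.left) =
      PrimeSpectrum.zeroLocus (RingHom.ker φ.pullback.toRingHom : Set Y.fn) :=
    PrimeSpectrum.closure_range_comap φ.pullback.toRingHom
  have h2 : Set.range (Y.incl (Set.range φ.toFun)).toScheme.left =
      PrimeSpectrum.zeroLocus
        (RingHom.ker (Y.incl (Set.range φ.toFun)).pullback.toRingHom : Set Y.fn) := by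
    refine range_comap_of_surjective _ (Y.incl (Set.range φ.toFun)).pullback.toRingHom ?_
    rintro ⟨_, f, hf, rfl⟩
    exact ⟨⟨f, hf⟩, rfl⟩
  -- It remains to compare the two ideals: a regular function vanishes on the set of values of φ
  -- exactly when its pull-back is zero.
  rw [h1, h2]
  congr 1
  ext f
  simp only [SetLike.mem_coe, RingHom.mem_ker]
  refine ⟨fun h => Subtype.ext (funext ?_), fun h => Subtype.ext (funext fun x => ?_)⟩
  · rintro ⟨_, x, rfl⟩
    exact congrFun (congrArg Subtype.val h) x
  · exact congrFun (congrArg Subtype.val h) ⟨_, x, rfl⟩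

end FunctionSpace

/-! ### Operations and inverse images of subobjects -/

section Formal

variable {C : Type*} [Category C] [CartesianMonoidalCategory C] [Limits.HasPullbacks C]

/-- If `Z` operates on `X`, compatibly with a subobject `O` of `X`, then the operation identifies the
product of `O ∩ S` and `Z` with the inverse image of `O` in `S ⊗ Z`. -/
lemma exists_iso_pullback {X Z O S : C} (α α' : X ⊗ Z ⟶ X) (h : lift α (snd X Z) ≫ α' = fst X Z)
    (i : O ⟶ X) [Mono i] (β β' : O ⊗ Z ⟶ O) (hβ : β ≫ i = (i ▷ Z) ≫ α)
    (hβ' : β' ≫ i = (i ▷ Z) ≫ α') (j : S ⟶ X) [Mono j] :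
    ∃ e : Limits.pullback i j ⊗ Z ≅ Limits.pullback i ((j ▷ Z) ≫ α),
      e.hom ≫ Limits.pullback.snd _ _ = Limits.pullback.snd _ _ ▷ Z := by
  let f : Limits.pullback i j ⊗ Z ⟶ Limits.pullback i ((j ▷ Z) ≫ α) :=
    Limits.pullback.lift ((Limits.pullback.fst i j ▷ Z) ≫ β) (Limits.pullback.snd i j ▷ Z) (by
      rw [Category.assoc, hβ, ← Category.assoc, ← Category.assoc, ← comp_whiskerRight,
        ← comp_whiskerRight, Limits.pullback.condition])
  let a := Limits.pullback.fst i ((j ▷ Z) ≫ α)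
  let b := Limits.pullback.snd i ((j ▷ Z) ≫ α)
  have hab : a ≫ i = b ≫ (j ▷ Z) ≫ α := Limits.pullback.condition
  -- The inverse morphism sends (o, (s, z)) with o = s z to ((o z⁻¹, s), z). The identity here is o
  -- z⁻¹ = s, computed in X. Only the relation (x z) z⁻¹ = x on X is used; both composites are then
  -- identified by cancelling monomorphisms.
  have hg : (lift a (b ≫ snd S Z) ≫ β') ≫ i = (b ≫ fst S Z) ≫ j := by
    have h1 : lift (b ≫ (j ▷ Z) ≫ α) (b ≫ snd S Z) = b ≫ (j ▷ Z) ≫ lift α (snd X Z) := by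
      simp
    rw [Category.assoc, hβ', lift_whiskerRight_assoc, hab]
    erw [h1]
    simp only [Category.assoc, h, whiskerRight_fst]
  let g : Limits.pullback i ((j ▷ Z) ≫ α) ⟶ Limits.pullback i j ⊗ Z :=
    lift (Limits.pullback.lift (lift a (b ≫ snd S Z) ≫ β') (b ≫ fst S Z) hg) (b ≫ snd S Z)
  have hf : f ≫ b = Limits.pullback.snd i j ▷ Z := Limits.pullback.lift_snd _ _ _
  have hgs : g ≫ (Limits.pullback.snd i j ▷ Z) = b := by
    simp only [g, lift_whiskerRight, Limits.pullback.lift_snd]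
    exact (comp_lift b (fst S Z) (snd S Z)).symm.trans (by simp)
  have : Mono (Limits.pullback.snd i j ▷ Z) := ⟨fun u v huv => by
    have h1 := congrArg (· ≫ fst S Z) huv
    have h2 := congrArg (· ≫ snd S Z) huv
    simp only [Category.assoc, whiskerRight_fst, whiskerRight_snd] at h1 h2
    refine CartesianMonoidalCategory.hom_ext _ _ ?_ h2
    rw [← cancel_mono (Limits.pullback.snd i j), Category.assoc, Category.assoc, h1]⟩
  refine ⟨⟨f, g, ?_, ?_⟩, hf⟩
  · rw [← cancel_mono (Limits.pullback.snd i j ▷ Z), Category.assoc, hgs, hf, Category.id_comp]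
  · rw [← cancel_mono b, Category.assoc, hf, hgs, Category.id_comp]

end Formal

end KGSlice

/-! ### Matrix groups given by prescribed entries, and their smoothness -/

namespace KGSlice

variable {k : Type u} [Field k] {N : ℕ}

/-- The invertible matrices that agree with the identity matrix at all positions outside `R`. -/
def pat (k : Type u) [Field k] (R : Fin N → Fin N → Prop) :
    Set (Matrix.GeneralLinearGroup (Fin N) k) :=
  {g | ∀ i j, ¬ R i j → g.1 i j = if i = j then 1 else 0}

lemma finiteType_glSpace : Algebra.FiniteType k (glSpace k N).fn := by
  rw [← Subalgebra.fg_iff_finiteType]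
  refine Subalgebra.fg_def.2 ⟨_, Set.Finite.union ?_ (Set.finite_singleton _), rfl⟩
  refine (Set.finite_range fun p : Fin N × Fin N =>
    fun g : Matrix.GeneralLinearGroup (Fin N) k => g.1 p.1 p.2).subset ?_
  rintro _ ⟨i, j, rfl⟩
  exact ⟨(i, j), rfl⟩

/-- The values of χ on the matrix entries form a matrix, which is invertible because χ also has a
value on the inverse determinant. That this matrix lies in `Γ` requires equations for `Γ` and is
settled in `isVariety_pat`. -/
lemma exists_eval_sub (Γ : Set (Matrix.GeneralLinearGroup (Fin N) k))
    (χ : ((glSpace k N).sub Γ).fn →ₐ[k] k) :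
    ∃ g, ∀ f : (glSpace k N).fn, χ (((glSpace k N).incl Γ).pullback f) = f.1 g := by
  let χ' : (glSpace k N).fn →ₐ[k] k := χ.comp ((glSpace k N).incl Γ).pullback
  let A : Matrix (Fin N) (Fin N) k := Matrix.of fun i j => χ' ⟨_, entry_mem i j⟩
  have hdet : A.det * χ' ⟨_, det_inv_mem⟩ = 1 := by
    let P : Matrix (Fin N) (Fin N) (glSpace k N).fn := Matrix.of fun i j => ⟨_, entry_mem i j⟩
    have h1 : A.det = χ' P.det := (AlgHom.map_det χ' P).symm
    have h2 : P.det * ⟨_, det_inv_mem⟩ = 1 := by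
      refine Subtype.ext (funext fun g => ?_)
      let ev : (glSpace k N).fn →ₐ[k] k := (Pi.evalAlgHom k _ g).comp (glSpace k N).fn.val
      change ev P.det * (g.1.det)⁻¹ = 1
      rw [AlgHom.map_det]
      exact mul_inv_cancel₀ g.det.ne_zero
    rw [h1, ← map_mul, h2, map_one]
  have hA : A.det ≠ 0 := left_ne_zero_of_mul_eq_one hdet
  let g := Matrix.GeneralLinearGroup.mkOfDetNeZero A hA
  refine ⟨g, fun f => ?_⟩
  change χ' f = f.1 g
  obtain ⟨f, hf⟩ := f
  induction hf using Algebra.adjoin_induction with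
  | mem f h =>
    obtain ⟨i, j, rfl⟩ | rfl := h
    · rfl
    · exact eq_inv_of_mul_eq_one_right hdet
  | algebraMap c => exact χ'.commutes c
  | add a b ha hb iha ihb => exact (map_add χ' ⟨a, ha⟩ ⟨b, hb⟩).trans (congrArg₂ (· + ·) iha ihb)
  | mul a b ha hb iha ihb => exact (map_mul χ' ⟨a, ha⟩ ⟨b, hb⟩).trans (congrArg₂ (· * ·) iha ihb)

lemma isVariety_pat (R : Fin N → Fin N → Prop) : ((glSpace k N).sub (pat k R)).IsVariety := by
  refine ⟨?_, fun χ => ?_⟩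
  · have := finiteType_glSpace (k := k) (N := N)
    refine .of_surjective ((glSpace k N).incl (pat k R)).pullback ?_
    rintro ⟨_, f, hf, rfl⟩
    exact ⟨⟨f, hf⟩, rfl⟩
  · obtain ⟨g, hg⟩ := exists_eval_sub _ χ
    refine ⟨⟨g, fun i j hij => ?_⟩, ?_⟩
    · refine (hg ⟨_, entry_mem i j⟩).symm.trans ?_
      refine (congrArg χ (?_ : _ = algebraMap k _ (if i = j then 1 else 0))).trans (χ.commutes _)
      exact Subtype.ext (funext fun x => x.2 i j hij)
    · rintro ⟨_, f, hf, rfl⟩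
      exact hg ⟨f, hf⟩

section Smooth

variable (R : Fin N → Fin N → Prop)

/-- Polynomials in the entries at the positions in `R`, as regular functions on `pat k R`. -/
noncomputable def patHom (k : Type u) [Field k] :
    MvPolynomial {p : Fin N × Fin N // R p.1 p.2} k →ₐ[k] ((glSpace k N).sub (pat k R)).fn :=
  MvPolynomial.aeval fun p => ((glSpace k N).incl (pat k R)).pullback ⟨_, entry_mem p.1.1 p.1.2⟩

lemma patHom_apply (P : MvPolynomial {p : Fin N × Fin N // R p.1 p.2} k) (g : pat k R) :
    (patHom R k P).1 g = MvPolynomial.eval (fun p => g.1.1 p.1.1 p.1.2) P := by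
  let ev : ((glSpace k N).sub (pat k R)).fn →ₐ[k] k :=
    (Pi.evalAlgHom k _ g).comp ((glSpace k N).sub (pat k R)).fn.val
  have : ev.comp (patHom R k) = MvPolynomial.aeval fun p => g.1.1 p.1.1 p.1.2 := by
    ext p
    simp [patHom, ev]
    rfl
  exact (AlgHom.congr_fun this P).trans rfl

variable [DecidableRel R]

/-- The matrix with independent entries at the positions in `R` that agrees with the identity matrix
elsewhere. -/
noncomputable def patMatrix (k : Type u) [Field k] :
    Matrix (Fin N) (Fin N) (MvPolynomial {p : Fin N × Fin N // R p.1 p.2} k) :=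
  Matrix.of fun i j => if h : R i j then MvPolynomial.X ⟨(i, j), h⟩ else if i = j then 1 else 0

lemma eval_patMatrix (v : {p : Fin N × Fin N // R p.1 p.2} → k) (i j : Fin N) :
    (MvPolynomial.eval v).mapMatrix (patMatrix R k) i j =
      if h : R i j then v ⟨(i, j), h⟩ else if i = j then 1 else 0 := by
  simp only [patMatrix, RingHom.mapMatrix_apply, Matrix.map_apply, Matrix.of_apply]
  split_ifs <;> simp

lemma eval_patMatrix_self (g : pat k R) :
    (MvPolynomial.eval fun p => g.1.1 p.1.1 p.1.2).mapMatrix (patMatrix R k) = g.1.1 := by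
  ext i j
  rw [eval_patMatrix]
  split_ifs with h1 h2 <;> [rfl; (rw [g.2 i j h1, if_pos h2]); (rw [g.2 i j h1, if_neg h2])]

lemma patHom_det (g : pat k R) : (patHom R k (patMatrix R k).det).1 g = g.1.1.det := by
  rw [patHom_apply, RingHom.map_det, eval_patMatrix_self]

/-- The regular functions on a pattern form the localization at the determinant of a polynomial ring
in the free entries. The field must be infinite for polynomials to be determined by their values. -/
lemma smooth_pat [Infinite k] : Algebra.Smooth k ((glSpace k N).sub (pat k R)).fn := by
  let A := MvPolynomial {p : Fin N × Fin N // R p.1 p.2} k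
  let V := ((glSpace k N).sub (pat k R)).fn
  let : Algebra A V := (patHom R k).toRingHom.toAlgebra
  have : IsScalarTower k A V := .of_algebraMap_eq fun c => ((patHom R k).commutes c).symm
  let D : A := (patMatrix R k).det
  let I : V := ((glSpace k N).incl (pat k R)).pullback ⟨_, det_inv_mem⟩
  have hDI : algebraMap A V D * I = 1 := by
    refine Subtype.ext (funext fun g => ?_)
    change (patHom R k (patMatrix R k).det).1 g * (g.1.1.det)⁻¹ = 1
    rw [patHom_det]
    exact mul_inv_cancel₀ g.1.det.ne_zero
  have : IsLocalization.Away D V := by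
    refine ⟨?_, ?_, ?_⟩
    · rintro ⟨_, n, rfl⟩
      simp only [map_pow]
      exact (IsUnit.of_mul_eq_one _ hDI).pow n
    · rintro ⟨_, f, hf, rfl⟩
      suffices h : ∃ (n : ℕ) (a : A), ((glSpace k N).incl (pat k R)).pullback ⟨f, hf⟩ *
          algebraMap A V D ^ n = algebraMap A V a by
        obtain ⟨n, a, h⟩ := h
        refine ⟨(a, ⟨D ^ n, n, rfl⟩), ?_⟩
        rw [← h, map_pow]
        rfl
      induction hf using Algebra.adjoin_induction with
      | mem f h =>
        obtain ⟨i, j, rfl⟩ | rfl := h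
        · refine ⟨0, patMatrix R k i j, ?_⟩
          rw [pow_zero, mul_one]
          refine Subtype.ext (funext fun g => ?_)
          refine (congrFun (congrFun (eval_patMatrix_self R g) i) j).symm.trans ?_
          exact (patHom_apply R (patMatrix R k i j) g).symm
        · exact ⟨1, 1, by rw [pow_one, map_one, mul_comm]; exact hDI⟩
      | algebraMap c =>
        refine ⟨0, algebraMap k A c, ?_⟩
        rw [pow_zero, mul_one, ← IsScalarTower.algebraMap_apply]
        rfl
      | add a b ha hb iha ihb =>
        obtain ⟨m, x, hx⟩ := iha
        obtain ⟨n, y, hy⟩ := ihb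
        refine ⟨m + n, x * D ^ n + y * D ^ m, ?_⟩
        have : ((glSpace k N).incl (pat k R)).pullback ⟨a + b, (glSpace k N).fn.add_mem ha hb⟩ =
            ((glSpace k N).incl (pat k R)).pullback ⟨a, ha⟩ +
              ((glSpace k N).incl (pat k R)).pullback ⟨b, hb⟩ := rfl
        rw [this, map_add, map_mul, map_mul, map_pow, map_pow, ← hx, ← hy]
        ring
      | mul a b ha hb iha ihb =>
        obtain ⟨m, x, hx⟩ := iha
        obtain ⟨n, y, hy⟩ := ihb
        refine ⟨m + n, x * y, ?_⟩
        have : ((glSpace k N).incl (pat k R)).pullback ⟨a * b, (glSpace k N).fn.mul_mem ha hb⟩ =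
            ((glSpace k N).incl (pat k R)).pullback ⟨a, ha⟩ *
              ((glSpace k N).incl (pat k R)).pullback ⟨b, hb⟩ := rfl
        rw [this, map_mul, ← hx, ← hy]
        ring
    -- The polynomials D a and D b agree at every v: where D vanishes both are zero, and elsewhere v
    -- is the family of free entries of an actual matrix of the pattern.
    · intro a b hab
      refine ⟨⟨D, 1, pow_one D⟩, MvPolynomial.funext fun v => ?_⟩
      change MvPolynomial.eval v (D * a) = MvPolynomial.eval v (D * b)
      rw [map_mul, map_mul]
      by_cases hv : MvPolynomial.eval v D = 0
      · rw [hv, zero_mul, zero_mul]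
      · rw [RingHom.map_det] at hv
        let g : pat k R := ⟨Matrix.GeneralLinearGroup.mkOfDetNeZero _ hv, fun i j hij =>
          (eval_patMatrix R v i j).trans (dif_neg hij)⟩
        have hg : (fun p : {p : Fin N × Fin N // R p.1 p.2} => g.1.1 p.1.1 p.1.2) = v :=
          funext fun p => (eval_patMatrix R v _ _).trans (dif_pos p.2)
        have h := congrFun (congrArg Subtype.val hab) g
        have h' : (patHom R k a).1 g = (patHom R k b).1 g := h
        rw [patHom_apply, patHom_apply, hg] at h'
        rw [h']
  have : Algebra.Smooth k A := {}
  have : Algebra.Smooth A V := .of_isLocalization_Away D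
  exact Algebra.Smooth.comp k A V

end Smooth

lemma smooth_prod {X Y : FunctionSpace k} (hX : Algebra.Smooth k X.fn)
    (hY : Algebra.Smooth k Y.fn) : Algebra.Smooth k (X.prod Y).fn := by
  have : Algebra.Smooth X.fn (TensorProduct k X.fn Y.fn) := inferInstance
  have : Algebra.Smooth k (TensorProduct k X.fn Y.fn) := .comp k X.fn _
  exact Algebra.Smooth.of_equiv (A := TensorProduct k X.fn Y.fn) (B := (FunctionSpace.prodMap X Y).range) (AlgEquiv.ofInjective _ (FunctionSpace.prodMap_injective X Y))

lemma smooth_toScheme {X : FunctionSpace k} (hX : Algebra.Smooth k X.fn) :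
    Smooth X.toScheme.hom := by
  change Smooth (Spec.map _)
  rw [HasRingHomProperty.Spec_iff (P := @Smooth)]
  exact RingHom.smooth_algebraMap.2 hX

end KGSlice

/-! ### Triangular matrices and unipotent factorization -/

namespace KGSlice

section Triangular

variable {k : Type*} [Field k] {n : Type*} [Fintype n] [LinearOrder n]

/-- Lower triangular matrices with ones on the diagonal. -/
def IsUnipLower {A : Type*} [Zero A] [One A] (M : Matrix n n A) : Prop :=
  (∀ i j, i < j → M i j = 0) ∧ ∀ i, M i i = 1

/-- Upper triangular matrices. -/
def IsUpper {A : Type*} [Zero A] (M : Matrix n n A) : Prop := ∀ i j, j < i → M i j = 0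

lemma isUpper_mul {M M' : Matrix n n k} (h : IsUpper M) (h' : IsUpper M') : IsUpper (M * M') :=
  fun _ _ hij => Matrix.BlockTriangular.mul (b := id) (M := M) (N := M')
    (fun i j hij => h i j hij) (fun i j hij => h' i j hij) hij

lemma mul_apply_self_of_lower {M M' : Matrix n n k} (h : ∀ i j, i < j → M i j = 0)
    (h' : ∀ i j, i < j → M' i j = 0) (i : n) : (M * M') i i = M i i * M' i i := by
  rw [Matrix.mul_apply]
  refine Finset.sum_eq_single i (fun j _ hj => ?_) (by simp)
  rcases lt_or_gt_of_ne hj with hj | hj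
  · rw [h' j i hj, mul_zero]
  · rw [h i j hj, zero_mul]

lemma lower_mul {M M' : Matrix n n k} (h : ∀ i j, i < j → M i j = 0)
    (h' : ∀ i j, i < j → M' i j = 0) : ∀ i j, i < j → (M * M') i j = 0 :=
  fun _ _ hij => Matrix.BlockTriangular.mul (b := OrderDual.toDual) (M := M) (N := M')
    (fun i j hij => h i j hij) (fun i j hij => h' i j hij) hij

variable [DecidableEq n]

lemma IsUnipLower.det {M : Matrix n n k} (h : IsUnipLower M) : M.det = 1 := by
  rw [Matrix.det_of_isLowerTriangular M h.1]
  exact Finset.prod_eq_one fun i _ => h.2 i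

lemma IsUpper.inv {M : Matrix n n k} (h : IsUpper M) (hM : IsUnit M.det) : IsUpper M⁻¹ := by
  have := M.invertibleOfIsUnitDet hM
  exact fun i j hij => Matrix.blockTriangular_inv_of_blockTriangular (b := id) (M := M)
    (fun i j hij => h i j hij) hij

lemma lower_inv {M : Matrix n n k} (h : ∀ i j, i < j → M i j = 0) (hM : IsUnit M.det) :
    ∀ i j, i < j → M⁻¹ i j = 0 := by
  have := M.invertibleOfIsUnitDet hM
  exact fun i j hij => Matrix.blockTriangular_inv_of_blockTriangular (b := OrderDual.toDual) (M := M)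
    (fun i j hij => h i j hij) hij

lemma IsUnipLower.inv {M : Matrix n n k} (h : IsUnipLower M) : IsUnipLower M⁻¹ := by
  have hM : IsUnit M.det := h.det ▸ isUnit_one
  refine ⟨lower_inv h.1 hM, fun i => ?_⟩
  have h1 := mul_apply_self_of_lower h.1 (lower_inv h.1 hM) i
  rw [Matrix.mul_nonsing_inv _ hM, h.2, one_mul, Matrix.one_apply_eq] at h1
  exact h1.symm

/-- A matrix that takes a unipotent lower triangular matrix to one, and an invertible upper
triangular matrix to one, is the identity. -/
lemma eq_one_of_mul_triangular {c u u' l l' : Matrix n n k} (hu : IsUnipLower u)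
    (hu' : IsUnipLower u') (hcu : c * u = u') (hl : IsUpper l) (hdet : IsUnit l.det)
    (hl' : IsUpper l') (hcl : c * l = l') : c = 1 := by
  have hud : IsUnit u.det := hu.det ▸ isUnit_one
  -- The first relation makes c lower triangular with ones on the diagonal, the second makes it
  -- upper triangular.
  have h1 : c = u' * u⁻¹ := by rw [← hcu, Matrix.mul_nonsing_inv_cancel_right _ _ hud]
  have h2 : c = l' * l⁻¹ := by rw [← hcl, Matrix.mul_nonsing_inv_cancel_right _ _ hdet]
  have h3 : ∀ i j, i < j → c i j = 0 := h1 ▸ lower_mul hu'.1 hu.inv.1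
  have h4 : ∀ i j, j < i → c i j = 0 := h2 ▸ isUpper_mul hl' (hl.inv hdet)
  ext i j
  rcases lt_trichotomy i j with h | rfl | h
  · rw [h3 i j h, Matrix.one_apply_ne h.ne]
  · have := mul_apply_self_of_lower h3 hu.1 i
    rw [hcu, hu.2, hu'.2, mul_one] at this
    rw [← this, Matrix.one_apply_eq]
  · rw [h4 i j h, Matrix.one_apply_ne h.ne']

end Triangular

section PatternFactorization

variable {A : Type*} [CommRing A] {n : Type*} [Fintype n] [DecidableEq n]

/-- A unipotent matrix with pattern a transitive relation `R` is the product of unipotent matrices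
with patterns `R ∩ L` and `R ∩ U`, if `R` is the disjoint union of these. -/
lemma exists_unipotent_factorization (R L U : n → n → Prop) (τ : n → ℕ)
    (hτ : ∀ i j, R i j → τ j < τ i) (htrans : ∀ i j l, R i j → R j l → R i l)
    (hLU : ∀ i j, R i j → (L i j ↔ ¬ U i j)) (h : Matrix n n A) (h1 : ∀ i, h i i = 1)
    (h0 : ∀ i j, i ≠ j → ¬ R i j → h i j = 0) :
    ∃ u x : Matrix n n A, u * x = h ∧ (∀ i, u i i = 1) ∧ (∀ i, x i i = 1) ∧
      (∀ i j, i ≠ j → ¬ (R i j ∧ L i j) → u i j = 0) ∧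
      ∀ i j, i ≠ j → ¬ (R i j ∧ U i j) → x i j = 0 := by
  classical
  have hne : ∀ i, ¬ R i i := fun i hi => lt_irrefl _ (hτ i i hi)
  let a : Matrix n n A → Matrix n n A := fun c => Matrix.of fun i j => if R i j ∧ L i j then c i j else 0
  let b : Matrix n n A → Matrix n n A := fun c => Matrix.of fun i j => if R i j ∧ U i j then c i j else 0
  -- The equation (1 + a)(1 + b) = h, where a and b are the two parts of one matrix c, reads c = h −
  -- a b on `R`. It is solved by recursion on τ i − τ j: a nonzero term of the product uses
  -- positions (i, l) and (l, j) in `R`, for which this difference is strictly smaller.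
  have key : ∀ m : ℕ, ∃ c : Matrix n n A, ∀ i j, R i j → τ i < τ j + m →
      c i j = h i j - ∑ l, a c i l * b c l j := by
    intro m
    induction m with
    | zero => exact ⟨0, fun i j hij hm => absurd (hτ i j hij) (by omega)⟩
    | succ m ih =>
      obtain ⟨c, hc⟩ := ih
      refine ⟨Matrix.of fun i j => if τ i < τ j + m then c i j else
        h i j - ∑ l, a c i l * b c l j, fun i j hij hm => ?_⟩
      have hsum : ∑ l, a (Matrix.of fun i j => if τ i < τ j + m then c i j else
          h i j - ∑ l, a c i l * b c l j) i l * b (Matrix.of fun i j => if τ i < τ j + m then c i j else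
          h i j - ∑ l, a c i l * b c l j) l j = ∑ l, a c i l * b c l j := by
        refine Finset.sum_congr rfl fun l _ => ?_
        simp only [a, b, Matrix.of_apply]
        by_cases h1 : R i l ∧ L i l
        · by_cases h2 : R l j ∧ U l j
          · have e1 := hτ i l h1.1
            have e2 := hτ l j h2.1
            rw [if_pos h1, if_pos h2, if_pos h1, if_pos h2, if_pos (by omega), if_pos (by omega)]
          · rw [if_neg h2, if_neg h2, mul_zero, mul_zero]
        · rw [if_neg h1, if_neg h1, zero_mul, zero_mul]
      rw [hsum, Matrix.of_apply]
      split_ifs with h3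
      · exact hc i j hij h3
      · rfl
  -- This bound exceeds every value of τ, so no position of `R` is left out.
  obtain ⟨c, hc⟩ := key (∑ i, τ i + 1)
  have hc' : ∀ i j, R i j → c i j = h i j - ∑ l, a c i l * b c l j := fun i j hij =>
    hc i j hij (by
      have := Finset.single_le_sum (f := τ) (fun _ _ => Nat.zero_le _) (Finset.mem_univ i)
      omega)
  refine ⟨1 + a c, 1 + b c, ?_, ?_, ?_, ?_, ?_⟩
  · rw [mul_add, add_mul, add_mul, one_mul, mul_one, one_mul]
    ext i j
    simp only [Matrix.add_apply, Matrix.mul_apply]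
    by_cases hij : R i j
    · have hne' : i ≠ j := fun e => hne i (by rw [e] at hij ⊢; exact hij)
      have hab : a c i j + b c i j = c i j := by
        simp only [a, b, Matrix.of_apply]
        by_cases hL : L i j
        · rw [if_pos ⟨hij, hL⟩, if_neg fun h => (hLU i j hij).1 hL h.2, add_zero]
        · rw [if_neg fun h => hL h.2, if_pos ⟨hij, by_contra fun h => hL ((hLU i j hij).2 h)⟩,
            zero_add]
      rw [Matrix.one_apply_ne hne', zero_add, ← add_assoc, hab, hc' i j hij, sub_add_cancel]
    · have ha : a c i j = 0 := if_neg fun h => hij h.1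
      have hb : b c i j = 0 := if_neg fun h => hij h.1
      have hs : ∑ l, a c i l * b c l j = 0 := Finset.sum_eq_zero fun l _ => by
        simp only [a, b, Matrix.of_apply]
        by_cases e1 : R i l ∧ L i l
        · rw [if_neg (fun e2 : R l j ∧ U l j => hij (htrans i l j e1.1 e2.1)), mul_zero]
        · rw [if_neg e1, zero_mul]
      rw [ha, hb, hs, add_zero, add_zero, add_zero]
      by_cases e : i = j
      · rw [e, Matrix.one_apply_eq, h1]
      · rw [Matrix.one_apply_ne e, h0 i j e hij]
  · intro i
    rw [Matrix.add_apply, Matrix.one_apply_eq]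
    simp [a, hne i]
  · intro i
    rw [Matrix.add_apply, Matrix.one_apply_eq]
    simp [b, hne i]
  · intro i j hij h
    rw [Matrix.add_apply, Matrix.one_apply_ne hij]
    simp [a, h]
  · intro i j hij h
    rw [Matrix.add_apply, Matrix.one_apply_ne hij]
    simp [b, h]

end PatternFactorization

/-! ### Matrices of regular functions and local LU-factorization -/

section RegMat

variable {k : Type u} [Field k] {X : FunctionSpace k}

/-- A matrix of regular functions. -/
def RegMat (X : FunctionSpace k) {m n : Type*} (A : X.pts → Matrix m n k) : Prop :=
  ∀ i j, (fun x => A x i j) ∈ X.fn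

variable {l m n o : Type*} {A B : X.pts → Matrix m n k}

lemma RegMat.const (M : Matrix m n k) : RegMat X fun _ => M := fun i j =>
  X.fn.algebraMap_mem (M i j)

lemma RegMat.add (hA : RegMat X A) (hB : RegMat X B) : RegMat X fun x => A x + B x :=
  fun i j => X.fn.add_mem (hA i j) (hB i j)

lemma RegMat.sub (hA : RegMat X A) (hB : RegMat X B) : RegMat X fun x => A x - B x :=
  fun i j => X.fn.sub_mem (hA i j) (hB i j)

lemma RegMat.mul [Fintype n] {C : X.pts → Matrix n o k} (hA : RegMat X A) (hC : RegMat X C) :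
    RegMat X fun x => A x * C x := fun i j => by
  have : (fun x => (A x * C x) i j) = ∑ l, (fun x => A x i l) * fun x => C x l j := by
    ext x
    simp [Matrix.mul_apply, Finset.sum_apply]
  rw [this]
  exact X.fn.sum_mem fun l _ => X.fn.mul_mem (hA i l) (hC l j)

lemma RegMat.det [Fintype n] [DecidableEq n] {A : X.pts → Matrix n n k} (hA : RegMat X A) :
    (fun x => (A x).det) ∈ X.fn := by
  have : (fun x => (A x).det) = ∑ σ : Equiv.Perm n,
      ((Equiv.Perm.sign σ : ℤ) : k) • ∏ i, (fun x => A x (σ i) i) := by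
    ext x
    simp [Matrix.det_apply, Finset.sum_apply, Finset.prod_apply, Units.smul_def]
  rw [this]
  exact X.fn.sum_mem fun σ _ => X.fn.smul_mem (X.fn.prod_mem fun i _ => hA _ _) _

lemma RegMat.adjugate [Fintype n] [DecidableEq n] {A : X.pts → Matrix n n k} (hA : RegMat X A) :
    RegMat X fun x => (A x).adjugate := fun i j => by
  simp only [Matrix.adjugate_apply]
  refine RegMat.det fun a b => ?_
  by_cases h : a = j
  · subst h
    simp only [Matrix.updateRow_self]
    exact X.fn.algebraMap_mem ((Pi.single i 1 : n → k) b)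
  · simpa [h] using hA a b

lemma RegMat.inv {x₀ : X.pts} [Fintype n] [DecidableEq n] {A : X.pts → Matrix n n k}
    (hA : RegMat (X.localAt x₀) A) (h : (A x₀).det ≠ 0) :
    RegMat (X.localAt x₀) fun x => (A x)⁻¹ := fun i j => by
  have : (fun x => (A x)⁻¹ i j) = (fun x => ((A x).det)⁻¹) * fun x => (A x).adjugate i j := by
    ext x
    rw [Matrix.inv_def, Matrix.smul_apply, Ring.inverse_eq_inv', smul_eq_mul]
    rfl
  rw [this]
  exact (X.locFn x₀).mul_mem (FunctionSpace.locFn_inv hA.det h) (hA.adjugate i j)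

lemma RegMat.eventually_det {x₀ : X.pts} [Fintype n] [DecidableEq n] {A : X.pts → Matrix n n k}
    (hA : RegMat (X.localAt x₀) A) (h : (A x₀).det ≠ 0) : ∀ᶠ x in X.nhd x₀, (A x).det ≠ 0 :=
  FunctionSpace.eventually_ne_zero hA.det h

/-- A matrix of functions that are regular near `x₀` has an `LU`-factorization near `x₀` if its value
at `x₀` has one. -/
lemma exists_local_LU {x₀ : X.pts} {p : ℕ} (M : X.pts → Matrix (Fin p) (Fin p) k)
    (hM : RegMat (X.localAt x₀) M) (u₀ l₀ : Matrix (Fin p) (Fin p) k) (hu₀ : IsUnipLower u₀)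
    (hl₀ : IsUpper l₀) (hdiag : ∀ i, l₀ i i ≠ 0) (hM₀ : M x₀ = u₀ * l₀) :
    ∃ u l : X.pts → Matrix (Fin p) (Fin p) k, RegMat (X.localAt x₀) u ∧ RegMat (X.localAt x₀) l ∧
      (∀ x, IsUnipLower (u x)) ∧ (∀ x, IsUpper (l x)) ∧
      ∀ᶠ x in X.nhd x₀, M x = u x * l x ∧ ∀ i, l x i i ≠ 0 := by
  induction p with
  | zero =>
    exact ⟨M, M, hM, hM, fun x => ⟨fun i => i.elim0, fun i => i.elim0⟩, fun x i => i.elim0,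
      .of_forall fun x => ⟨Matrix.ext fun i => i.elim0, fun i => i.elim0⟩⟩
  | succ p ih =>
    have h00 : ∀ i, M x₀ i 0 = u₀ i 0 * l₀ 0 0 := fun i => by
      rw [hM₀, Matrix.mul_apply]
      refine Finset.sum_eq_single 0 (fun j _ hj => ?_) (by simp)
      rw [hl₀ j 0 (Fin.pos_iff_ne_zero.2 hj), mul_zero]
    have h0j : ∀ j, M x₀ 0 j = l₀ 0 j := fun j => by
      rw [hM₀, Matrix.mul_apply, Finset.sum_eq_single 0 (fun i _ hi => ?_) (by simp), hu₀.2, one_mul]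
      rw [hu₀.1 0 i (Fin.pos_iff_ne_zero.2 hi), zero_mul]
    have hne : M x₀ 0 0 ≠ 0 := by rw [h0j]; exact hdiag 0
    have hinv := FunctionSpace.locFn_inv (hM 0 0) hne
    -- One step of Gaussian elimination with pivot `M x 0 0`, which is nonzero at `x₀`. At `x₀` this
    -- Schur complement is the product of the lower right parts of `u₀` and `l₀`, so the induction
    -- hypothesis applies.
    let M' : X.pts → Matrix (Fin p) (Fin p) k := fun x =>
      Matrix.of fun i j => M x i.succ j.succ - M x i.succ 0 * (M x 0 0)⁻¹ * M x 0 j.succ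
    have hM' : RegMat (X.localAt x₀) M' := fun i j => (X.locFn x₀).sub_mem (hM _ _)
      ((X.locFn x₀).mul_mem ((X.locFn x₀).mul_mem (hM _ _) hinv) (hM _ _))
    obtain ⟨u, l, hu, hl, hu', hl', hul⟩ := ih M' hM' (u₀.submatrix Fin.succ Fin.succ)
      (l₀.submatrix Fin.succ Fin.succ)
      ⟨fun i j hij => hu₀.1 _ _ (Fin.succ_lt_succ_iff.2 hij), fun i => hu₀.2 _⟩
      (fun i j hij => hl₀ _ _ (Fin.succ_lt_succ_iff.2 hij)) (fun i => hdiag _) (by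
        ext i j
        simp only [M', Matrix.of_apply, Matrix.mul_apply, Matrix.submatrix_apply]
        rw [h00, h00, h0j, hM₀, Matrix.mul_apply, Fin.sum_univ_succ, hu₀.2]
        have := hdiag 0
        field_simp
        ring)
    refine ⟨fun x => Matrix.of (Fin.cons (Fin.cons 1 0) fun i => Fin.cons (M x i.succ 0 * (M x 0 0)⁻¹) (u x i)),
      fun x => Matrix.of (Fin.cons (M x 0) fun i => Fin.cons 0 (l x i)), ?_, ?_, ?_, ?_, ?_⟩
    · intro i j
      refine Fin.cases ?_ (fun i => ?_) i <;> refine Fin.cases ?_ (fun j => ?_) j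
      · exact (X.locFn x₀).one_mem
      · exact (X.locFn x₀).zero_mem
      · exact (X.locFn x₀).mul_mem (hM _ _) hinv
      · exact hu i j
    · intro i j
      refine Fin.cases ?_ (fun i => ?_) i <;> refine Fin.cases ?_ (fun j => ?_) j
      · exact hM _ _
      · exact hM _ _
      · exact (X.locFn x₀).zero_mem
      · exact hl i j
    · refine fun x => ⟨fun i j => ?_, fun i => ?_⟩
      · refine Fin.cases ?_ (fun i => ?_) i <;> refine Fin.cases ?_ (fun j => ?_) j
        · simp
        · simp
        · simp
        · intro hij
          simpa using (hu' x).1 i j (Fin.succ_lt_succ_iff.1 hij)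
      · refine Fin.cases ?_ (fun i => ?_) i
        · simp
        · simpa using (hu' x).2 i
    · refine fun x i j => ?_
      refine Fin.cases ?_ (fun i => ?_) i <;> refine Fin.cases ?_ (fun j => ?_) j
      · simp
      · simp
      · simp
      · intro hij
        simpa using hl' x i j (Fin.succ_lt_succ_iff.1 hij)
    · filter_upwards [hul, FunctionSpace.eventually_ne_zero (hM 0 0) hne] with x ⟨h1, h2⟩ h3
      refine ⟨?_, fun i => Fin.cases ?_ (fun i => ?_) i⟩
      · ext i j
        rw [Matrix.mul_apply, Fin.sum_univ_succ]
        refine Fin.cases ?_ (fun i => ?_) i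
        · simp
        · have h4 : ∀ j : Fin p, M x i.succ j.succ =
              M x i.succ 0 * (M x 0 0)⁻¹ * M x 0 j.succ + (u x * l x) i j := fun j => by
            rw [← h1]
            simp [M']
          refine Fin.cases ?_ (fun j => ?_) j
          · simp [h3]
          · rw [h4, Matrix.mul_apply]
            simp
      · simpa using h3
      · simpa using h2 i

end RegMat

end KGSlice

/-! ### The normal form in blocks: uniqueness -/

namespace KGSlice

section Blocks

open Matrix

variable {k : Type u} [Field k] {p : ℕ} {Q T : Type*} [Fintype Q] [DecidableEq Q] [Fintype T]
  [DecidableEq T]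

/-- The entries of elements of `B' Q`, in blocks. -/
structure BlockData (k : Type u) (p : ℕ) (Q T : Type*) where
  l : Matrix (Fin p) (Fin p) k
  b₂₁ : Matrix Q (Fin p) k
  b₃₁ : Matrix T (Fin p) k
  b₄₁ : Matrix (Fin p) (Fin p) k
  b₄₂ : Matrix (Fin p) Q k
  b₄₃ : Matrix (Fin p) T k
  u : Matrix (Fin p) (Fin p) k
  X : Matrix Q T k
  Y : Matrix T Q k

/-- The triangularity conditions on the diagonal blocks of an element of `B' Q`. -/
structure BlockData.Good (D : BlockData k p Q T) : Prop where
  l_upper : IsUpper D.l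
  l_diag : ∀ i, D.l i i ≠ 0
  u_lower : IsUnipLower D.u

/-- The first block column of a matrix that consists of the rows of the product of `v₀` and an
element of `B' Q`. -/
def BlockData.V₁ (D : BlockData k p Q T) : Matrix (Q ⊕ Fin p) (Fin p) k := fromRows D.b₂₁ D.b₄₁

/-- The second block column of the upper half. -/
def BlockData.V₂ (D : BlockData k p Q T) : Matrix (Q ⊕ Fin p) Q k :=
  fromRows (1 + D.X * D.Y) (D.b₄₂ * (1 + D.X * D.Y) + D.b₄₃ * D.Y)

/-- The third block column of the upper half. -/
def BlockData.V₃ (D : BlockData k p Q T) : Matrix (Q ⊕ Fin p) T k :=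
  fromRows D.X (D.b₄₂ * D.X + D.b₄₃)

/-- The fourth block column of the upper half. -/
def BlockData.V₄ (D : BlockData k p Q T) : Matrix (Q ⊕ Fin p) (Fin p) k := fromRows 0 D.u

/-- The first block column of the lower half. -/
def BlockData.W₁ (D : BlockData k p Q T) : Matrix (T ⊕ Fin p) (Fin p) k :=
  fromRows D.b₃₁ (D.l + D.b₄₁)

/-- The second block column of the lower half. -/
def BlockData.W₂ (D : BlockData k p Q T) : Matrix (T ⊕ Fin p) Q k :=
  fromRows D.Y (D.b₄₂ * (1 + D.X * D.Y) + D.b₄₃ * D.Y)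

/-- The third block column of the lower half. -/
def BlockData.W₃ (D : BlockData k p Q T) : Matrix (T ⊕ Fin p) T k :=
  fromRows 1 (D.b₄₂ * D.X + D.b₄₃)

/-- The fourth block column of the lower half. -/
def BlockData.W₄ (D : BlockData k p Q T) : Matrix (T ⊕ Fin p) (Fin p) k := fromRows 0 D.u

/-- The product of `v₀` and an element of `B' Q`. -/
def BlockData.mat (D : BlockData k p Q T) :
    Matrix ((Q ⊕ Fin p) ⊕ (T ⊕ Fin p)) ((Fin p ⊕ Q) ⊕ (T ⊕ Fin p)) k :=
  fromBlocks (fromCols D.V₁ D.V₂) (fromCols D.V₃ D.V₄) (fromCols D.W₁ D.W₂) (fromCols D.W₃ D.W₄)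

/-- The factor in `B'`. -/
def BlockData.matB (D : BlockData k p Q T) :
    Matrix ((Fin p ⊕ Q) ⊕ (T ⊕ Fin p)) ((Fin p ⊕ Q) ⊕ (T ⊕ Fin p)) k :=
  fromBlocks (fromBlocks D.l 0 D.b₂₁ 1) 0 (fromBlocks D.b₃₁ 0 D.b₄₁ D.b₄₂)
    (fromBlocks 1 0 D.b₄₃ D.u)

/-- The factor in `Q₁`. -/
def BlockData.mat₁ (D : BlockData k p Q T) :
    Matrix ((Fin p ⊕ Q) ⊕ (T ⊕ Fin p)) ((Fin p ⊕ Q) ⊕ (T ⊕ Fin p)) k :=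
  fromBlocks 1 (fromBlocks 0 0 D.X 0) 0 1

/-- The factor in `Q₂`. -/
def BlockData.mat₂ (D : BlockData k p Q T) :
    Matrix ((Fin p ⊕ Q) ⊕ (T ⊕ Fin p)) ((Fin p ⊕ Q) ⊕ (T ⊕ Fin p)) k :=
  fromBlocks 1 0 (fromBlocks 0 D.Y 0 0) 1

/-- The matrix `v₀`, in blocks. -/
def blockV0 (k : Type u) [Field k] (p : ℕ) (Q T : Type*) [DecidableEq Q] [DecidableEq T] :
    Matrix ((Q ⊕ Fin p) ⊕ (T ⊕ Fin p)) ((Fin p ⊕ Q) ⊕ (T ⊕ Fin p)) k :=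
  fromBlocks (fromBlocks 0 1 0 0) (fromBlocks 0 0 0 1) (fromBlocks 0 0 1 0) (fromBlocks 1 0 0 1)

lemma blockV0_mul (D : BlockData k p Q T) :
    blockV0 k p Q T * D.matB * D.mat₁ * D.mat₂ = D.mat := by
  simp only [blockV0, BlockData.matB, BlockData.mat₁, BlockData.mat₂, BlockData.mat, BlockData.V₁,
    BlockData.V₂, BlockData.V₃, BlockData.V₄, BlockData.W₁, BlockData.W₂, BlockData.W₃,
    BlockData.W₄, fromCols_fromRows_eq_fromBlocks, ← fromBlocks_one, fromBlocks_multiply,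
    fromBlocks_add, Matrix.mul_zero, Matrix.zero_mul, Matrix.mul_one, Matrix.one_mul, add_zero,
    zero_add, Matrix.mul_add, Matrix.add_mul, Matrix.mul_assoc]
  congr 2 <;> abel

lemma eq_and_eq_of_fromRows_eq {R m n l : Type*} {A A' : Matrix m l R} {B B' : Matrix n l R}
    (h : fromRows A B = fromRows A' B') : A = A' ∧ B = B' :=
  ⟨by simpa using congrArg toRows₁ h, by simpa using congrArg toRows₂ h⟩

lemma eq_and_eq_of_fromCols_eq {R m n l : Type*} {A A' : Matrix l m R} {B B' : Matrix l n R}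
    (h : fromCols A B = fromCols A' B') : A = A' ∧ B = B' :=
  ⟨by simpa using congrArg toCols₁ h, by simpa using congrArg toCols₂ h⟩

/-- The representation of a coset of `K` by the product of `v₀` and an element of `B' Q` is
unique. -/
lemma BlockData.mat_unique {D D' : BlockData k p Q T} (hD : D.Good) (hD' : D'.Good)
    (κ₁ : Matrix (Q ⊕ Fin p) (Q ⊕ Fin p) k) (κ₂ : Matrix (T ⊕ Fin p) (T ⊕ Fin p) k)
    (h : fromBlocks κ₁ 0 0 κ₂ * D.mat = D'.mat) : D = D' := by
  obtain ⟨a, b, c, d, rfl⟩ : ∃ a b c d, κ₁ = fromBlocks a b c d :=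
    ⟨_, _, _, _, (fromBlocks_toBlocks κ₁).symm⟩
  obtain ⟨a', b', c', d', rfl⟩ : ∃ a b c d, κ₂ = fromBlocks a b c d :=
    ⟨_, _, _, _, (fromBlocks_toBlocks κ₂).symm⟩
  have hu : IsUnit D.u.det := hD.u_lower.det ▸ isUnit_one
  have hl : IsUnit D.l.det := by
    rw [Matrix.det_of_isUpperTriangular (M := D.l) fun i j hij => hD.l_upper i j hij]
    exact isUnit_iff_ne_zero.2 (Finset.prod_ne_zero_iff.2 fun i _ => hD.l_diag i)
  rw [mat, mat, fromBlocks_multiply, fromBlocks_inj] at h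
  simp only [Matrix.zero_mul, add_zero, zero_add, mul_fromCols] at h
  obtain ⟨h1, h2, h3, h4⟩ := h
  obtain ⟨v1, v2⟩ := eq_and_eq_of_fromCols_eq h1
  obtain ⟨v3, v4⟩ := eq_and_eq_of_fromCols_eq h2
  obtain ⟨w1, w2⟩ := eq_and_eq_of_fromCols_eq h3
  obtain ⟨w3, w4⟩ := eq_and_eq_of_fromCols_eq h4
  simp only [V₁, V₂, V₃, V₄, W₁, W₂, W₃, W₄, fromBlocks_mul_fromRows] at v1 v2 v3 v4 w1 w2 w3 w4
  replace v1 := eq_and_eq_of_fromRows_eq v1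
  replace v2 := eq_and_eq_of_fromRows_eq v2
  replace v3 := eq_and_eq_of_fromRows_eq v3
  replace v4 := eq_and_eq_of_fromRows_eq v4
  replace w1 := eq_and_eq_of_fromRows_eq w1
  replace w2 := eq_and_eq_of_fromRows_eq w2
  replace w3 := eq_and_eq_of_fromRows_eq w3
  replace w4 := eq_and_eq_of_fromRows_eq w4
  simp only [Matrix.mul_zero, zero_add] at v4 w4
  -- The fourth block columns have zero upper part and invertible lower part in both halves; this
  -- kills b and b' and forces d = d'.
  have hb : b = 0 := by rw [← Matrix.mul_nonsing_inv_cancel_right _ b hu, v4.1, Matrix.zero_mul]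
  have hb' : b' = 0 := by rw [← Matrix.mul_nonsing_inv_cancel_right _ b' hu, w4.1, Matrix.zero_mul]
  obtain rfl : d = d' := by
    rw [← Matrix.mul_nonsing_inv_cancel_right _ d hu, v4.2, ← w4.2,
      Matrix.mul_nonsing_inv_cancel_right _ d' hu]
  subst hb hb'
  simp only [Matrix.zero_mul, add_zero, Matrix.mul_one] at v1 v2 v3 w1 w2 w3
  obtain rfl : a' = 1 := w3.1
  simp only [Matrix.one_mul] at w1 w2
  obtain ⟨hY, w2⟩ := w2
  obtain ⟨hb31, w1⟩ := w1
  -- The top of the second column gives a + (aX)Y = 1 + X'Y', where aX = X' by the third column and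
  -- Y = Y' by the lower half.
  have ha : a = 1 := by
    have := v2.1
    rw [Matrix.mul_add, Matrix.mul_one, ← Matrix.mul_assoc, v3.1, hY] at this
    exact add_right_cancel this
  subst ha
  simp only [Matrix.one_mul] at v1 v2 v3
  obtain ⟨hX, v3⟩ := v3
  obtain ⟨hb21, v1⟩ := v1
  -- In the bottom rows, subtracting the third column times Y from the second isolates b₄₂. The
  -- lower half then yields d b₄₂ = b₄₂', and the same subtraction in the upper half leaves c + d
  -- b₄₂ = b₄₂', so c = 0.
  have e1 : d * (D.b₄₂ * (1 + D.X * D.Y) + D.b₄₃ * D.Y) =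
      d * D.b₄₂ + d * (D.b₄₂ * D.X + D.b₄₃) * D.Y := by
    simp only [Matrix.mul_add, Matrix.add_mul, Matrix.mul_one, Matrix.mul_assoc]
    abel
  have e2 : D'.b₄₂ * (1 + D'.X * D'.Y) + D'.b₄₃ * D'.Y =
      D'.b₄₂ + (D'.b₄₂ * D'.X + D'.b₄₃) * D'.Y := by
    simp only [Matrix.mul_add, Matrix.add_mul, Matrix.mul_one, Matrix.mul_assoc]
    abel
  have h42 : d * D.b₄₂ = D'.b₄₂ := by
    have := w2
    rw [e1, e2, ← w3.2, hY, Matrix.add_mul, ← add_assoc, add_comm (c' * D'.Y)] at this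
    rw [add_assoc] at this
    exact add_right_cancel this
  have hc : c = 0 := by
    have := v2.2
    rw [Matrix.mul_add, Matrix.mul_one, ← Matrix.mul_assoc, e1, e2, ← v3, hY, Matrix.add_mul, h42,
      hX] at this
    have e3 : c + c * D'.X * D'.Y + (D'.b₄₂ + d * (D.b₄₂ * D'.X + D.b₄₃) * D'.Y) =
      c + (D'.b₄₂ + (c * D'.X * D'.Y + d * (D.b₄₂ * D'.X + D.b₄₃) * D'.Y)) := by abel
    rw [e3] at this
    exact add_eq_right.1 this
  subst hc
  simp only [Matrix.zero_mul, zero_add] at v1 v3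
  have hc' : c' = 0 := by
    have := w3.2
    rw [← v3] at this
    exact add_eq_right.1 this
  subst hc'
  simp only [Matrix.zero_mul, zero_add] at w1
  have hdl : d * D.l = D'.l := by
    rw [Matrix.mul_add, v1] at w1
    exact add_right_cancel w1
  -- The only freedom left is d. It takes u to u' and l to l', so it is both unipotent lower
  -- triangular and upper triangular.
  obtain rfl := eq_one_of_mul_triangular hD.u_lower hD'.u_lower v4.2 hD.l_upper hl hD'.l_upper hdl
  simp only [Matrix.one_mul] at hdl v1 v3 v4 h42
  have h43 : D.b₄₃ = D'.b₄₃ := by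
    rw [h42, hX] at v3
    exact add_left_cancel v3
  obtain ⟨_, _, _, _, _, _, _, _, _⟩ := D
  obtain ⟨_, _, _, _, _, _, _, _, _⟩ := D'
  simp only [BlockData.mk.injEq]
  exact ⟨hdl, hb21, hb31, v1, h42, h43, v4.2, hX, hY⟩

end Blocks

end KGSlice

/-! ### The normal form in blocks: regular existence near a point -/

namespace KGSlice

section BlockExistence

open Matrix

variable {k : Type u} [Field k] {p : ℕ} {Q T : Type*} [Fintype Q] [DecidableEq Q] [Fintype T]
  [DecidableEq T]

lemma nonsing_inv_mul_eq {m n : Type*} [Fintype m] [DecidableEq m] {H : Matrix m m k}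
    {B C : Matrix m n k} (hH : H.det ≠ 0) (h : H * C = B) : H⁻¹ * B = C := by
  rw [← h, nonsing_inv_mul_cancel_left _ _ (isUnit_iff_ne_zero.2 hH)]

/-- A representative in `v₀ B' Q` of the coset of a matrix, from the normal forms of its block
columns. -/
lemma mul_eq_mat {V₁ : Matrix (Q ⊕ Fin p) (Fin p) k} {V₂ : Matrix (Q ⊕ Fin p) Q k}
    {V₃ : Matrix (Q ⊕ Fin p) T k} {V₄ : Matrix (Q ⊕ Fin p) (Fin p) k}
    {W₁ : Matrix (T ⊕ Fin p) (Fin p) k} {W₂ : Matrix (T ⊕ Fin p) Q k}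
    {W₃ : Matrix (T ⊕ Fin p) T k} {W₄ : Matrix (T ⊕ Fin p) (Fin p) k}
    {κ₁ : Matrix (Q ⊕ Fin p) (Q ⊕ Fin p) k} {κ₂ : Matrix (T ⊕ Fin p) (T ⊕ Fin p) k}
    {b₂₁ : Matrix Q (Fin p) k} {b₃₁ : Matrix T (Fin p) k} {X : Matrix Q T k} {Y : Matrix T Q k}
    {w v u l : Matrix (Fin p) (Fin p) k} {Y₄ : Matrix (Fin p) Q k} {X₄ : Matrix (Fin p) T k}
    (hW₁ : κ₂ * W₁ = fromRows b₃₁ w) (hW₂ : κ₂ * W₂ = fromRows Y Y₄)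
    (hW₃ : κ₂ * W₃ = fromRows 1 0) (hW₄ : κ₂ * W₄ = fromRows 0 1)
    (hV₁ : κ₁ * V₁ = fromRows b₂₁ v) (hV₂ : κ₁ * (V₂ - V₃ * Y) = fromRows 1 0)
    (hV₃ : κ₁ * V₃ = fromRows X X₄) (hV₄ : κ₁ * V₄ = fromRows 0 1)
    (hl : u * (w + Y₄ * X * b₃₁ - v - Y₄ * b₂₁ + X₄ * b₃₁) = l) :
    fromBlocks (fromBlocks 1 0 (u * Y₄) u * κ₁) 0 0
        (fromBlocks 1 0 (u * Y₄ * X + u * X₄) u * κ₂) *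
      fromBlocks (fromCols V₁ V₂) (fromCols V₃ V₄) (fromCols W₁ W₂) (fromCols W₃ W₄) =
    (⟨l, b₂₁, b₃₁, u * v + u * Y₄ * b₂₁, u * Y₄, u * X₄, u, X, Y⟩ : BlockData k p Q T).mat := by
  have hV₂' : κ₁ * V₂ = fromRows (1 + X * Y) (X₄ * Y) := by
    have : κ₁ * V₂ = κ₁ * (V₂ - V₃ * Y) + κ₁ * V₃ * Y := by
      rw [Matrix.mul_sub, Matrix.mul_assoc, sub_add_cancel]
    rw [this, hV₂, hV₃, fromRows_mul]
    ext (i | i) j <;> simp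
  have hl' : l = u * w + u * Y₄ * X * b₃₁ - u * v - u * Y₄ * b₂₁ + u * X₄ * b₃₁ := by
    rw [← hl]
    simp only [Matrix.mul_add, Matrix.mul_sub, Matrix.mul_assoc]
  rw [BlockData.mat, fromBlocks_multiply]
  simp only [Matrix.zero_mul, add_zero, zero_add, mul_fromCols, Matrix.mul_assoc, hW₁, hW₂, hW₃,
    hW₄, hV₁, hV₂', hV₃, hV₄, fromBlocks_mul_fromRows, BlockData.V₁, BlockData.V₂, BlockData.V₃,
    BlockData.V₄, BlockData.W₁, BlockData.W₂, BlockData.W₃, BlockData.W₄, Matrix.one_mul,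
    Matrix.mul_zero, Matrix.mul_one, Matrix.mul_add, Matrix.add_mul, hl']
  congr 3 <;> abel_nf

variable {S : FunctionSpace k} {x₀ : S.pts}

lemma RegMat.fromCols {m n n' : Type*} {A : S.pts → Matrix m n k} {B : S.pts → Matrix m n' k}
    (hA : RegMat S A) (hB : RegMat S B) : RegMat S fun x => Matrix.fromCols (A x) (B x) := by
  rintro i (j | j)
  · exact hA i j
  · exact hB i j

lemma RegMat.submatrix {m n m' n' : Type*} {A : S.pts → Matrix m n k} (hA : RegMat S A)
    (f : m' → m) (g : n' → n) : RegMat S fun x => (A x).submatrix f g := fun i j => hA (f i) (g j)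

/-- All entries of the blocks are regular. -/
structure BlockData.Regular (S : FunctionSpace k) (D : S.pts → BlockData k p Q T) : Prop where
  l : RegMat S fun x => (D x).l
  b₂₁ : RegMat S fun x => (D x).b₂₁
  b₃₁ : RegMat S fun x => (D x).b₃₁
  b₄₁ : RegMat S fun x => (D x).b₄₁
  b₄₂ : RegMat S fun x => (D x).b₄₂
  b₄₃ : RegMat S fun x => (D x).b₄₃
  u : RegMat S fun x => (D x).u
  X : RegMat S fun x => (D x).X
  Y : RegMat S fun x => (D x).Y

/-- Near a point of the image of `v₀ B' Q`, cosets of `K` have representatives in `v₀ B' Q` that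
depend regularly on the coset. -/
lemma exists_local_blockData
    (A : S.pts → Matrix ((Q ⊕ Fin p) ⊕ (T ⊕ Fin p)) ((Fin p ⊕ Q) ⊕ (T ⊕ Fin p)) k)
    (hA : RegMat (S.localAt x₀) A) (D₀ : BlockData k p Q T) (hD₀ : D₀.Good) (h₀ : A x₀ = D₀.mat) :
    ∃ D : S.pts → BlockData k p Q T, BlockData.Regular (S.localAt x₀) D ∧
      ∀ᶠ x in S.nhd x₀, (D x).Good ∧
        ∃ (κ₁ : Matrix (Q ⊕ Fin p) (Q ⊕ Fin p) k) (κ₂ : Matrix (T ⊕ Fin p) (T ⊕ Fin p) k),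
          fromBlocks κ₁ 0 0 κ₂ * A x = (D x).mat := by
  have hu₀ : IsUnit D₀.u.det := hD₀.u_lower.det ▸ isUnit_one
  let V₁ := fun x => (A x).toBlocks₁₁.toCols₁
  let V₂ := fun x => (A x).toBlocks₁₁.toCols₂
  let V₃ := fun x => (A x).toBlocks₁₂.toCols₁
  let V₄ := fun x => (A x).toBlocks₁₂.toCols₂
  let W₁ := fun x => (A x).toBlocks₂₁.toCols₁
  let W₂ := fun x => (A x).toBlocks₂₁.toCols₂
  let W₃ := fun x => (A x).toBlocks₂₂.toCols₁
  let W₄ := fun x => (A x).toBlocks₂₂.toCols₂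
  have hA' : ∀ x, A x = fromBlocks (Matrix.fromCols (V₁ x) (V₂ x)) (Matrix.fromCols (V₃ x) (V₄ x))
      (Matrix.fromCols (W₁ x) (W₂ x)) (Matrix.fromCols (W₃ x) (W₄ x)) := fun x => by
    simp only [V₁, V₂, V₃, V₄, W₁, W₂, W₃, W₄, fromCols_toCols, fromBlocks_toBlocks]
  have hV₁ : RegMat (S.localAt x₀) V₁ := fun i j => hA _ _
  have hV₂ : RegMat (S.localAt x₀) V₂ := fun i j => hA _ _
  have hV₃ : RegMat (S.localAt x₀) V₃ := fun i j => hA _ _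
  have hV₄ : RegMat (S.localAt x₀) V₄ := fun i j => hA _ _
  have hW₁ : RegMat (S.localAt x₀) W₁ := fun i j => hA _ _
  have hW₂ : RegMat (S.localAt x₀) W₂ := fun i j => hA _ _
  have hW₃ : RegMat (S.localAt x₀) W₃ := fun i j => hA _ _
  have hW₄ : RegMat (S.localAt x₀) W₄ := fun i j => hA _ _
  have h1 := h₀
  rw [hA', BlockData.mat, fromBlocks_inj] at h1
  obtain ⟨h1, h2, h3, h4⟩ := h1
  obtain ⟨v1, v2⟩ := eq_and_eq_of_fromCols_eq h1
  obtain ⟨v3, v4⟩ := eq_and_eq_of_fromCols_eq h2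
  obtain ⟨w1, w2⟩ := eq_and_eq_of_fromCols_eq h3
  obtain ⟨w3, w4⟩ := eq_and_eq_of_fromCols_eq h4
  let H₂ := fun x => Matrix.fromCols (W₃ x) (W₄ x)
  have hH₂ : RegMat (S.localAt x₀) H₂ := hW₃.fromCols hW₄
  have hH₂0 : H₂ x₀ = fromBlocks 1 0 (D₀.b₄₂ * D₀.X + D₀.b₄₃) D₀.u := by
    simp only [H₂, w3, w4, BlockData.W₃, BlockData.W₄, fromCols_fromRows_eq_fromBlocks]
  have hH₂d : (H₂ x₀).det ≠ 0 := by
    rw [hH₂0, det_fromBlocks_zero₁₂, det_one, one_mul]; exact hu₀.ne_zero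
  -- This makes the third and fourth columns of the lower half standard. The blocks Y and b₃₁ of the
  -- normal form can then be read off, since the later correction changes only the bottom rows.
  let κ₂ := fun x => (H₂ x)⁻¹
  have hκ₂ : RegMat (S.localAt x₀) κ₂ := hH₂.inv hH₂d
  let Y := fun x => (κ₂ x * W₂ x).toRows₁
  let Y₄ := fun x => (κ₂ x * W₂ x).toRows₂
  let b₃₁ := fun x => (κ₂ x * W₁ x).toRows₁
  let w := fun x => (κ₂ x * W₁ x).toRows₂
  have hY : RegMat (S.localAt x₀) Y := fun i j => (hκ₂.mul hW₂) (Sum.inl i) j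
  have hY₄ : RegMat (S.localAt x₀) Y₄ := fun i j => (hκ₂.mul hW₂) (Sum.inr i) j
  have hb₃₁ : RegMat (S.localAt x₀) b₃₁ := fun i j => (hκ₂.mul hW₁) (Sum.inl i) j
  have hw : RegMat (S.localAt x₀) w := fun i j => (hκ₂.mul hW₁) (Sum.inr i) j
  have e2 : κ₂ x₀ * W₂ x₀ = fromRows D₀.Y (D₀.u⁻¹ * D₀.b₄₂) := by
    refine nonsing_inv_mul_eq hH₂d ?_
    rw [hH₂0, w2, fromBlocks_mul_fromRows, BlockData.W₂, mul_nonsing_inv_cancel_left _ _ hu₀]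
    simp only [Matrix.one_mul, Matrix.zero_mul, add_zero, Matrix.mul_add, Matrix.add_mul,
      Matrix.mul_one, Matrix.mul_assoc]
    congr 1; abel
  have e1 : κ₂ x₀ * W₁ x₀ = fromRows D₀.b₃₁
      (D₀.u⁻¹ * (D₀.l + D₀.b₄₁ - (D₀.b₄₂ * D₀.X + D₀.b₄₃) * D₀.b₃₁)) := by
    refine nonsing_inv_mul_eq hH₂d ?_
    rw [hH₂0, w1, fromBlocks_mul_fromRows, BlockData.W₁, mul_nonsing_inv_cancel_left _ _ hu₀]
    simp only [Matrix.one_mul, Matrix.zero_mul, add_zero]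
    congr 1; abel
  have hY0 : Y x₀ = D₀.Y := by simp only [Y, e2, toRows₁_fromRows]
  have hY₄0 : Y₄ x₀ = D₀.u⁻¹ * D₀.b₄₂ := by simp only [Y₄, e2, toRows₂_fromRows]
  have hb₃₁0 : b₃₁ x₀ = D₀.b₃₁ := by simp only [b₃₁, e1, toRows₁_fromRows]
  have hw0 : w x₀ = D₀.u⁻¹ * (D₀.l + D₀.b₄₁ - (D₀.b₄₂ * D₀.X + D₀.b₄₃) * D₀.b₃₁) := by
    simp only [w, e1, toRows₂_fromRows]
  -- The second column of the upper half starts with 1 + XY, which may be singular. Subtracting the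
  -- third column times Y, known from the lower half, replaces it by 1, so that this matrix is
  -- invertible at `x₀`.
  let H₁ := fun x => Matrix.fromCols (V₂ x - V₃ x * Y x) (V₄ x)
  have hH₁ : RegMat (S.localAt x₀) H₁ := (hV₂.sub (hV₃.mul hY)).fromCols hV₄
  have hH₁0 : H₁ x₀ = fromBlocks 1 0 D₀.b₄₂ D₀.u := by
    simp only [H₁, v2, v3, v4, hY0, BlockData.V₂, BlockData.V₃, BlockData.V₄, fromRows_mul]
    rw [← fromCols_fromRows_eq_fromBlocks]
    congr 1
    ext (i | i) j
    · simp
    · rw [Matrix.sub_apply]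
      simp only [fromRows_apply_inr, Matrix.mul_add, Matrix.add_mul, Matrix.mul_one,
        Matrix.mul_assoc, Matrix.add_apply]
      abel
  have hH₁d : (H₁ x₀).det ≠ 0 := by
    rw [hH₁0, det_fromBlocks_zero₁₂, det_one, one_mul]; exact hu₀.ne_zero
  let κ₁ := fun x => (H₁ x)⁻¹
  have hκ₁ : RegMat (S.localAt x₀) κ₁ := hH₁.inv hH₁d
  let X := fun x => (κ₁ x * V₃ x).toRows₁
  let X₄ := fun x => (κ₁ x * V₃ x).toRows₂
  let b₂₁ := fun x => (κ₁ x * V₁ x).toRows₁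
  let v := fun x => (κ₁ x * V₁ x).toRows₂
  have hX : RegMat (S.localAt x₀) X := fun i j => (hκ₁.mul hV₃) (Sum.inl i) j
  have hX₄ : RegMat (S.localAt x₀) X₄ := fun i j => (hκ₁.mul hV₃) (Sum.inr i) j
  have hb₂₁ : RegMat (S.localAt x₀) b₂₁ := fun i j => (hκ₁.mul hV₁) (Sum.inl i) j
  have hv : RegMat (S.localAt x₀) v := fun i j => (hκ₁.mul hV₁) (Sum.inr i) j
  have e3 : κ₁ x₀ * V₃ x₀ = fromRows D₀.X (D₀.u⁻¹ * D₀.b₄₃) := by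
    refine nonsing_inv_mul_eq hH₁d ?_
    rw [hH₁0, v3, fromBlocks_mul_fromRows, BlockData.V₃, mul_nonsing_inv_cancel_left _ _ hu₀]
    simp only [Matrix.one_mul, Matrix.zero_mul, add_zero]
  have e4 : κ₁ x₀ * V₁ x₀ = fromRows D₀.b₂₁ (D₀.u⁻¹ * (D₀.b₄₁ - D₀.b₄₂ * D₀.b₂₁)) := by
    refine nonsing_inv_mul_eq hH₁d ?_
    rw [hH₁0, v1, fromBlocks_mul_fromRows, BlockData.V₁, mul_nonsing_inv_cancel_left _ _ hu₀]
    simp only [Matrix.one_mul, Matrix.zero_mul, add_zero]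
    congr 1; abel
  have hX0 : X x₀ = D₀.X := by simp only [X, e3, toRows₁_fromRows]
  have hX₄0 : X₄ x₀ = D₀.u⁻¹ * D₀.b₄₃ := by simp only [X₄, e3, toRows₂_fromRows]
  have hb₂₁0 : b₂₁ x₀ = D₀.b₂₁ := by simp only [b₂₁, e4, toRows₁_fromRows]
  have hv0 : v x₀ = D₀.u⁻¹ * (D₀.b₄₁ - D₀.b₄₂ * D₀.b₂₁) := by
    simp only [v, e4, toRows₂_fromRows]
  -- After both normalizations a common factor u on the bottom rows is still free, and the lower
  -- left corners of the corrections are forced by it. The difference of the bottom blocks of W₁ and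
  -- V₁ becomes u M, which has to be the upper triangular block l. Thus M = u⁻¹ l is an
  -- LU-factorization, available at `x₀` from `D₀`.
  let M := fun x => w x + Y₄ x * X x * b₃₁ x - v x - Y₄ x * b₂₁ x + X₄ x * b₃₁ x
  have hM : RegMat (S.localAt x₀) M :=
    (((hw.add ((hY₄.mul hX).mul hb₃₁)).sub hv).sub (hY₄.mul hb₂₁)).add (hX₄.mul hb₃₁)
  obtain ⟨u', l, hu', hl, hu'u, hlu, hLU⟩ := exists_local_LU M hM D₀.u⁻¹ D₀.l hD₀.u_lower.inv
    hD₀.l_upper hD₀.l_diag (by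
      simp only [M, hw0, hY₄0, hX0, hb₃₁0, hv0, hb₂₁0, hX₄0, Matrix.mul_add, Matrix.mul_sub,
        Matrix.add_mul, Matrix.mul_assoc]
      abel)
  have hu'd : ∀ x, IsUnit (u' x).det := fun x => (hu'u x).det ▸ isUnit_one
  let u := fun x => (u' x)⁻¹
  have hu : RegMat (S.localAt x₀) u := hu'.inv (hu'd x₀).ne_zero
  refine ⟨fun x => ⟨l x, b₂₁ x, b₃₁ x, u x * v x + u x * Y₄ x * b₂₁ x, u x * Y₄ x, u x * X₄ x, u x,
    X x, Y x⟩, ⟨hl, hb₂₁, hb₃₁, (hu.mul hv).add ((hu.mul hY₄).mul hb₂₁), hu.mul hY₄, hu.mul hX₄,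
      hu, hX, hY⟩, ?_⟩
  filter_upwards [hLU, hH₁.eventually_det hH₁d, hH₂.eventually_det hH₂d] with x ⟨hx, hxl⟩ hx1 hx2
  have i1 := nonsing_inv_mul _ (isUnit_iff_ne_zero.2 hx1)
  have i2 := nonsing_inv_mul _ (isUnit_iff_ne_zero.2 hx2)
  rw [← fromBlocks_one, ← fromCols_fromRows_eq_fromBlocks, mul_fromCols] at i1 i2
  obtain ⟨i1, i1'⟩ := eq_and_eq_of_fromCols_eq i1
  obtain ⟨i2, i2'⟩ := eq_and_eq_of_fromCols_eq i2
  have h := mul_eq_mat (κ₁ := κ₁ x) (κ₂ := κ₂ x) (u := u x) (l := l x)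
    (fromRows_toRows _).symm (fromRows_toRows _).symm i2 i2' (fromRows_toRows (κ₁ x * V₁ x)).symm
    i1 (fromRows_toRows _).symm i1' (by
      change u x * M x = l x
      rw [hx, nonsing_inv_mul_cancel_left _ _ (hu'd x)])
  rw [← hA' x] at h
  exact ⟨⟨hlu x, hxl, (hu'u x).inv⟩, _, _, h⟩

end BlockExistence

end KGSlice

/-! ### The groups as patterns, transported by the permutation of w -/

namespace KGSlice

section Groups

variable (k : Type u) [Field k] (d : BlockSizes)

lemma exists_perm_WAt : ∃ σ : Equiv.Perm (Fin d.N), ∀ i j : Fin d.N, WAt d i j ↔ j = σ i := by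
  choose f hf using WAt_exists d
  have hinj : Function.Injective f := fun i i' h => Fin.ext (WAt_left d (hf i) (h ▸ hf i'))
  refine ⟨Equiv.ofBijective f (Finite.injective_iff_bijective.1 hinj), fun i j => ⟨fun h => ?_, ?_⟩⟩
  · exact Fin.ext (WAt_right d h (hf i))
  · rintro rfl
    exact hf i

/-- The permutation of the matrix `w`. -/
noncomputable def wPerm : Equiv.Perm (Fin d.N) := (exists_perm_WAt d).choose

lemma WAt_iff (i j : Fin d.N) : WAt d i j ↔ j = wPerm d i := (exists_perm_WAt d).choose_spec i j

lemma WAt_wPerm (i : Fin d.N) : WAt d i (wPerm d i) := (WAt_iff d _ _).2 rfl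

variable {k d}

lemma w_conj_apply (g : Matrix.GeneralLinearGroup (Fin d.N) k) (i j : Fin d.N) :
    (w k d * g * (w k d)⁻¹).1 i j = g.1 (wPerm d i) (wPerm d j) := by
  change (wMatrix k d * g.1 * (wMatrix k d).transpose) i j = _
  rw [Matrix.mul_apply, Finset.sum_eq_single (wPerm d j), Matrix.mul_apply,
    Finset.sum_eq_single (wPerm d i)]
  · simp only [wMatrix, Matrix.transpose_apply, Matrix.of_apply, if_pos (WAt_wPerm d i),
      if_pos (WAt_wPerm d j), one_mul, mul_one]
  · intro l _ hl
    rw [wMatrix, Matrix.of_apply, if_neg fun h => hl ((WAt_iff d _ _).1 h), zero_mul]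
  · simp
  · intro l _ hl
    rw [wMatrix, Matrix.transpose_apply, Matrix.of_apply, if_neg fun h => hl ((WAt_iff d _ _).1 h),
      mul_zero]
  · simp

lemma mem_conjInvW_pat {R : Fin d.N → Fin d.N → Prop} {g : Matrix.GeneralLinearGroup (Fin d.N) k} :
    g ∈ conjInvW k d (pat k R) ↔
      g ∈ pat k fun i j => R ((wPerm d).symm i) ((wPerm d).symm j) := by
  refine ⟨fun h i j hij => ?_, fun h i j hij => ?_⟩
  · have := h _ _ hij
    rw [w_conj_apply, Equiv.apply_symm_apply, Equiv.apply_symm_apply] at this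
    rw [this]
    simp only [EmbeddingLike.apply_eq_iff_eq]
  · rw [w_conj_apply, h _ _ (by simpa using hij)]
    simp only [EmbeddingLike.apply_eq_iff_eq]

variable (d)

/-- The positions off the diagonal of the entries of `U'`. -/
abbrev uRel (i j : Fin d.N) : Prop :=
  (j : ℕ) < i ∧ ¬ ((d.p ≤ (i : ℕ) ∧ (i : ℕ) < d.p + d.q + d.t) ∧
    d.p ≤ (j : ℕ) ∧ (j : ℕ) < d.p + d.q + d.t)

/-- The positions of the entries of `T'`. -/
abbrev tRel (i j : Fin d.N) : Prop := i = j ∧ (i : ℕ) < d.p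

variable {d}

/-- If i and l lie in the middle range, so does j, which is between them. Transitivity is the
hypothesis of `exists_unipotent_factorization` on patterns. -/
lemma uRel_trans {i j l : Fin d.N} (h : uRel d i j) (h' : uRel d j l) : uRel d i l := by
  obtain ⟨h1, h2⟩ := h
  obtain ⟨h3, h4⟩ := h'
  exact ⟨h3.trans h1, fun h5 => h2 (by omega)⟩

lemma groupU'_eq : groupU' k d = pat k (uRel d) := by
  ext g
  refine ⟨fun ⟨⟨h1, h2, h3⟩, h4⟩ i j hij => ?_, fun h => ⟨⟨fun i j hij => ?_, fun i j h1 h2 h3 h4 => ?_,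
    fun i hi => ?_⟩, fun i => ?_⟩⟩
  · by_cases hm : (d.p ≤ (i : ℕ) ∧ (i : ℕ) < d.p + d.q + d.t) ∧
      d.p ≤ (j : ℕ) ∧ (j : ℕ) < d.p + d.q + d.t
    · exact h2 i j hm.1.1 hm.1.2 hm.2.1 hm.2.2
    · split_ifs with e
      · rw [← e, h4]
      · refine h1 i j (lt_of_le_of_ne (not_lt.1 fun h => hij ⟨h, hm⟩) e)
  · rw [h i j fun h' => absurd h'.1 (not_lt.2 (le_of_lt hij)), if_neg (ne_of_lt hij)]
  · exact h i j fun h' => h'.2 ⟨⟨h1, h2⟩, h3, h4⟩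
  · rw [h i i fun h' => lt_irrefl _ h'.1, if_pos rfl]
  · rw [h i i fun h' => lt_irrefl _ h'.1, if_pos rfl]

lemma groupT'_eq : groupT' k d = pat k (tRel d) := by
  ext g
  refine ⟨fun ⟨⟨h1, h2, h3⟩, h4⟩ i j hij => ?_, fun h => ?_⟩
  · split_ifs with e
    · subst e
      have hi : d.p ≤ (i : ℕ) := not_lt.1 fun h => hij ⟨rfl, h⟩
      by_cases h : (i : ℕ) < d.p + d.q + d.t
      · rw [h2 i i hi h hi h, if_pos rfl]
      · exact h3 i (not_lt.1 h)
    · exact h4 i j e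
  · have h4 : ∀ i j, i ≠ j → g.1 i j = 0 := fun i j hij => by
      rw [h i j fun h' => hij h'.1, if_neg hij]
    refine ⟨⟨fun i j hij => h4 i j (ne_of_lt hij), fun i j h1 h2 h3 h4 => ?_, fun i hi => ?_⟩, h4⟩
    · exact h i j fun h' => absurd h'.2 (not_lt.2 h1)
    · rw [h i i fun h' => absurd h'.2 (by omega), if_pos rfl]

lemma groupQ1_eq : groupQ1 k d = pat k fun i j => (d.p ≤ (i : ℕ) ∧ (i : ℕ) < d.p + d.q) ∧
    (d.p + d.q ≤ (j : ℕ) ∧ (j : ℕ) < d.p + d.q + d.t) := rfl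

lemma groupQ2_eq : groupQ2 k d = pat k fun i j =>
    (d.p + d.q ≤ (i : ℕ) ∧ (i : ℕ) < d.p + d.q + d.t) ∧
      (d.p ≤ (j : ℕ) ∧ (j : ℕ) < d.p + d.q) := rfl

lemma mem_conjInvW {Γ : Set (Matrix.GeneralLinearGroup (Fin d.N) k)}
    {g : Matrix.GeneralLinearGroup (Fin d.N) k} :
    g ∈ conjInvW k d Γ ↔ w k d * g * (w k d)⁻¹ ∈ Γ := Iff.rfl

/-- The positions off the diagonal of the entries of `w⁻¹ U' w`. -/
abbrev conjRel (d : BlockSizes) (i j : Fin d.N) : Prop :=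
  uRel d ((wPerm d).symm i) ((wPerm d).symm j)

lemma not_conjRel_self (i : Fin d.N) : ¬ conjRel d i i := fun h => lt_irrefl _ h.1

lemma mem_unipUpper_inter_pat {R : Fin d.N → Fin d.N → Prop} (hR : ∀ i, ¬ R i i)
    {g : Matrix.GeneralLinearGroup (Fin d.N) k} :
    g ∈ pat k R ∧ g ∈ unipUpper k d.N ↔ g ∈ pat k fun i j => R i j ∧ i < j := by
  refine ⟨fun ⟨h1, h2, h3⟩ i j hij => ?_, fun h => ⟨fun i j hij => h i j fun h' => hij h'.1, ?_, ?_⟩⟩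
  · by_cases hr : R i j
    · have hne : i ≠ j := fun e => hR i (by rw [← e] at hr; exact hr)
      rw [if_neg hne]
      exact h2 i j (lt_of_le_of_ne (not_lt.1 fun h => hij ⟨hr, h⟩) hne.symm)
    · exact h1 i j hr
  · exact fun i j hij => by rw [h i j fun h' => lt_asymm hij h'.2, if_neg (ne_of_gt hij)]
  · exact fun i => by rw [h i i fun h' => lt_irrefl _ h'.2, if_pos rfl]

lemma mem_unipLower_inter_pat {R : Fin d.N → Fin d.N → Prop} (hR : ∀ i, ¬ R i i)
    {g : Matrix.GeneralLinearGroup (Fin d.N) k} :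
    g ∈ pat k R ∧ g ∈ unipLower k d.N ↔ g ∈ pat k fun i j => R i j ∧ j < i := by
  refine ⟨fun ⟨h1, h2, h3⟩ i j hij => ?_, fun h => ⟨fun i j hij => h i j fun h' => hij h'.1, ?_, ?_⟩⟩
  · by_cases hr : R i j
    · have hne : i ≠ j := fun e => hR i (by rw [← e] at hr; exact hr)
      rw [if_neg hne]
      exact h2 i j (lt_of_le_of_ne (not_lt.1 fun h => hij ⟨hr, h⟩) hne)
    · exact h1 i j hr
  · exact fun i j hij => by rw [h i j fun h' => lt_asymm hij h'.2, if_neg (ne_of_lt hij)]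
  · exact fun i => by rw [h i i fun h' => lt_irrefl _ h'.2, if_pos rfl]

lemma conjInvW_U'plus_eq :
    conjInvW k d (groupU'plus k d) = pat k fun i j => conjRel d i j ∧ i < j := by
  ext g
  rw [← mem_unipUpper_inter_pat not_conjRel_self, ← mem_conjInvW_pat (R := uRel d), ← groupU'_eq]
  have : (w k d)⁻¹ * (w k d * g * (w k d)⁻¹) * w k d = g := by group
  rw [mem_conjInvW, groupU'plus, Set.mem_ofPred_eq, this]
  rfl

lemma groupSlice_eq : groupSlice k d = pat k fun i j => conjRel d i j ∧ j < i := by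
  ext g
  rw [← mem_unipLower_inter_pat not_conjRel_self, ← mem_conjInvW_pat (R := uRel d), ← groupU'_eq]
  rfl

lemma conjInvW_T'_eq : conjInvW k d (groupT' k d) =
    pat k fun i j => tRel d ((wPerm d).symm i) ((wPerm d).symm j) := by
  rw [groupT'_eq]
  exact Set.ext fun g => mem_conjInvW_pat

lemma conjInvW_Q1_eq : ∃ R, conjInvW k d (groupQ1 k d) = pat k R := by
  rw [groupQ1_eq]
  exact ⟨_, Set.ext fun g => mem_conjInvW_pat⟩

lemma conjInvW_Q2_eq : ∃ R, conjInvW k d (groupQ2 k d) = pat k R := by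
  rw [groupQ2_eq]
  exact ⟨_, Set.ext fun g => mem_conjInvW_pat⟩

end Groups

/-! ### Index orders in which v₀ has identity blocks -/

section Indices

variable (d : BlockSizes)

lemma BlockSizes.sizes (d : BlockSizes) : d.N = d.q + d.r + d.s + (d.t + d.r + d.s) ∧
    d.a = d.q + d.r + d.s ∧ d.p = d.s + d.r := ⟨rfl, rfl, rfl⟩

/-- The map of `embEquiv`. -/
def embFun : (Fin d.p ⊕ Fin d.q) ⊕ (Fin d.t ⊕ Fin d.p) → Fin d.N :=
  Sum.elim
    (Sum.elim (fun i => ⟨d.p - 1 - i, by have := i.2; have := d.sizes; omega⟩)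
      fun i => ⟨d.p + i, by have := i.2; have := d.sizes; omega⟩)
    (Sum.elim (fun i => ⟨d.p + d.q + i, by have := i.2; have := d.sizes; omega⟩)
      fun i => ⟨d.p + d.q + d.t + i, by have := i.2; have := d.sizes; omega⟩)

/-- The map of `rowEquiv`. -/
def rowFun : (Fin d.q ⊕ Fin d.p) ⊕ (Fin d.t ⊕ Fin d.p) → Fin d.N :=
  Sum.elim
    (Sum.elim (fun i => ⟨i, by have := i.2; have := d.sizes; omega⟩)
      fun i => ⟨d.q + i, by have := i.2; have := d.sizes; omega⟩)
    (Sum.elim (fun i => ⟨d.a + i, by have := i.2; have := d.sizes; omega⟩)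
      fun i => ⟨d.a + d.t + i, by have := i.2; have := d.sizes; omega⟩)

lemma embFun_bijective : Function.Bijective (embFun d) := by
  refine (Fintype.bijective_iff_injective_and_card _).2 ⟨?_, ?_⟩
  · rintro ((i | i) | (i | i)) ((j | j) | (j | j)) h <;> have h' := congrArg Fin.val h <;>
      have hi := i.2 <;> have hj := j.2 <;> simp only [embFun, Sum.elim_inl, Sum.elim_inr] at h' <;>
      simp only [Sum.inl.injEq, Sum.inr.injEq, reduceCtorEq, Fin.ext_iff] <;> omega
  · simp only [Fintype.card_sum, Fintype.card_fin]
    have := d.sizes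
    omega

lemma rowFun_bijective : Function.Bijective (rowFun d) := by
  have := d.sizes
  refine (Fintype.bijective_iff_injective_and_card _).2 ⟨?_, ?_⟩
  · rintro ((i | i) | (i | i)) ((j | j) | (j | j)) h <;> have h' := congrArg Fin.val h <;>
      have hi := i.2 <;> have hj := j.2 <;> simp only [rowFun, Sum.elim_inl, Sum.elim_inr] at h' <;>
      simp only [Sum.inl.injEq, Sum.inr.injEq, reduceCtorEq, Fin.ext_iff] <;> omega
  · simp only [Fintype.card_sum, Fintype.card_fin]
    omega

/-- Indices in blocks of sizes `p, q, t, p`, the first block in reversed order. -/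
noncomputable def embEquiv : (Fin d.p ⊕ Fin d.q) ⊕ (Fin d.t ⊕ Fin d.p) ≃ Fin d.N :=
  Equiv.ofBijective _ (embFun_bijective d)

/-- Row indices in blocks of sizes `q, p, t, p`. -/
noncomputable def rowEquiv : (Fin d.q ⊕ Fin d.p) ⊕ (Fin d.t ⊕ Fin d.p) ≃ Fin d.N :=
  Equiv.ofBijective _ (rowFun_bijective d)

/-- Column indices, in the order given by `w`. -/
noncomputable def colEquiv : (Fin d.p ⊕ Fin d.q) ⊕ (Fin d.t ⊕ Fin d.p) ≃ Fin d.N :=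
  (embEquiv d).trans (wPerm d)

@[simp] lemma embEquiv_inl_inl (i : Fin d.p) :
    (embEquiv d (Sum.inl (Sum.inl i)) : ℕ) = d.p - 1 - i := rfl
@[simp] lemma embEquiv_inl_inr (i : Fin d.q) :
    (embEquiv d (Sum.inl (Sum.inr i)) : ℕ) = d.p + i := rfl
@[simp] lemma embEquiv_inr_inl (i : Fin d.t) :
    (embEquiv d (Sum.inr (Sum.inl i)) : ℕ) = d.p + d.q + i := rfl
@[simp] lemma embEquiv_inr_inr (i : Fin d.p) :
    (embEquiv d (Sum.inr (Sum.inr i)) : ℕ) = d.p + d.q + d.t + i := rfl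
@[simp] lemma rowEquiv_inl_inl (i : Fin d.q) :
    (rowEquiv d (Sum.inl (Sum.inl i)) : ℕ) = i := rfl
@[simp] lemma rowEquiv_inl_inr (i : Fin d.p) :
    (rowEquiv d (Sum.inl (Sum.inr i)) : ℕ) = d.q + i := rfl
@[simp] lemma rowEquiv_inr_inl (i : Fin d.t) :
    (rowEquiv d (Sum.inr (Sum.inl i)) : ℕ) = d.a + i := rfl
@[simp] lemma rowEquiv_inr_inr (i : Fin d.p) :
    (rowEquiv d (Sum.inr (Sum.inr i)) : ℕ) = d.a + d.t + i := rfl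

/-- The two cases reflect p = r + s: w sends the r part to the last r columns and the s part to the
second block of s columns. The reversal in `embEquiv` cancels the blocks J of w, so the order is
increasing on each part. -/
lemma colEquiv_inl_inl (i : Fin d.p) :
    (i : ℕ) < d.r ∧ (colEquiv d (Sum.inl (Sum.inl i)) : ℕ) = 2 * d.s + d.r + d.q + d.t + i ∨
      d.r ≤ (i : ℕ) ∧ (colEquiv d (Sum.inl (Sum.inl i)) : ℕ) = d.s + i - d.r := by
  have h : WAt d (embEquiv d _) (colEquiv d (Sum.inl (Sum.inl i))) := WAt_wPerm d (embEquiv d _)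
  have hs := d.sizes
  have hi := i.2
  generalize (colEquiv d _ : ℕ) = e at *
  simp only [embEquiv_inl_inl, WAt] at h
  omega

lemma colEquiv_inl_inr (i : Fin d.q) :
    (colEquiv d (Sum.inl (Sum.inr i)) : ℕ) = 2 * d.s + d.r + d.q - 1 - i := by
  have h : WAt d (embEquiv d _) (colEquiv d (Sum.inl (Sum.inr i))) := WAt_wPerm d (embEquiv d _)
  have hs := d.sizes
  have hi := i.2
  generalize (colEquiv d _ : ℕ) = e at *
  simp only [embEquiv_inl_inr, WAt] at h
  omega

lemma colEquiv_inr_inl (i : Fin d.t) :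
    (colEquiv d (Sum.inr (Sum.inl i)) : ℕ) = 2 * d.s + d.r + d.q + i := by
  have h : WAt d (embEquiv d _) (colEquiv d (Sum.inr (Sum.inl i))) := WAt_wPerm d (embEquiv d _)
  have hs := d.sizes
  have hi := i.2
  generalize (colEquiv d _ : ℕ) = e at *
  simp only [embEquiv_inr_inl, WAt] at h
  omega

lemma colEquiv_inr_inr (i : Fin d.p) :
    (i : ℕ) < d.r ∧ (colEquiv d (Sum.inr (Sum.inr i)) : ℕ) = 2 * d.s + d.r - 1 - i ∨
      d.r ≤ (i : ℕ) ∧ (colEquiv d (Sum.inr (Sum.inr i)) : ℕ) = d.s + d.r - 1 - i := by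
  have h : WAt d (embEquiv d _) (colEquiv d (Sum.inr (Sum.inr i))) := WAt_wPerm d (embEquiv d _)
  have hs := d.sizes
  have hi := i.2
  generalize (colEquiv d _ : ℕ) = e at *
  simp only [embEquiv_inr_inr, WAt] at h
  omega

/-- Each matching pair of an r-block and an s-block of v₀ merges into one identity block of size p.
The columns meeting a block J are listed in decreasing order, which turns J into 1. -/
lemma v0_submatrix (k : Type u) [Field k] :
    (v0 k d).1.submatrix (rowEquiv d) (colEquiv d) = blockV0 k d.p (Fin d.q) (Fin d.t) := by
  have key : ∀ a c, ∀ P : Prop, [Decidable P] → (V0At d (rowEquiv d a) (colEquiv d c) ↔ P) →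
      (v0 k d).1.submatrix (rowEquiv d) (colEquiv d) a c = if P then 1 else 0 := fun a c P _ h => by
    change (if V0At d (rowEquiv d a) (colEquiv d c) then (1 : k) else 0) = _
    simp only [h]
  have key0 : ∀ a c, (¬ V0At d (rowEquiv d a) (colEquiv d c)) →
      (v0 k d).1.submatrix (rowEquiv d) (colEquiv d) a c = 0 := fun a c h => if_neg h
  have hs := d.sizes
  ext a c
  obtain ⟨e, he⟩ : ∃ e : ℕ, e = colEquiv d c := ⟨_, rfl⟩
  rcases c with (c | c) | (c | c)
  · have h := colEquiv_inl_inl d c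
    have hc := c.2
    rw [← he] at h
    rcases a with (a | a) | (a | a) <;> have ha := a.2
    · refine key0 _ _ fun hv => ?_
      rw [← he, rowEquiv_inl_inl] at hv
      rcases h with h | h <;> rcases hv with hv | hv | hv | hv | hv | hv | hv | hv <;> omega
    · refine key0 _ _ fun hv => ?_
      rw [← he, rowEquiv_inl_inr] at hv
      rcases h with h | h <;> rcases hv with hv | hv | hv | hv | hv | hv | hv | hv <;> omega
    · refine key0 _ _ fun hv => ?_
      rw [← he, rowEquiv_inr_inl] at hv
      rcases h with h | h <;> rcases hv with hv | hv | hv | hv | hv | hv | hv | hv <;> omega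
    · refine key _ _ (a = c) ?_
      rw [← he, rowEquiv_inr_inr, Fin.ext_iff]
      refine ⟨fun hv => ?_, fun hac => ?_⟩
      · rcases h with h | h <;> rcases hv with hv | hv | hv | hv | hv | hv | hv | hv <;> omega
      · rcases h with h | h
        · exact Or.inr (Or.inr (Or.inr (Or.inr (Or.inr (Or.inl (by omega))))))
        · exact Or.inr (Or.inr (Or.inr (Or.inr (Or.inr (Or.inr (Or.inr (by omega)))))))
  · have h := colEquiv_inl_inr d c
    have hc := c.2
    rw [← he] at h
    rcases a with (a | a) | (a | a) <;> have ha := a.2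
    · refine key _ _ (a = c) ?_
      rw [← he, rowEquiv_inl_inl, Fin.ext_iff]
      refine ⟨fun hv => ?_, fun hac => ?_⟩
      · rcases hv with hv | hv | hv | hv | hv | hv | hv | hv <;> omega
      · exact Or.inl (by omega)
    · refine key0 _ _ fun hv => ?_
      rw [← he, rowEquiv_inl_inr] at hv
      rcases hv with hv | hv | hv | hv | hv | hv | hv | hv <;> omega
    · refine key0 _ _ fun hv => ?_
      rw [← he, rowEquiv_inr_inl] at hv
      rcases hv with hv | hv | hv | hv | hv | hv | hv | hv <;> omega
    · refine key0 _ _ fun hv => ?_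
      rw [← he, rowEquiv_inr_inr] at hv
      rcases hv with hv | hv | hv | hv | hv | hv | hv | hv <;> omega
  · have h := colEquiv_inr_inl d c
    have hc := c.2
    rw [← he] at h
    rcases a with (a | a) | (a | a) <;> have ha := a.2
    · refine key0 _ _ fun hv => ?_
      rw [← he, rowEquiv_inl_inl] at hv
      rcases hv with hv | hv | hv | hv | hv | hv | hv | hv <;> omega
    · refine key0 _ _ fun hv => ?_
      rw [← he, rowEquiv_inl_inr] at hv
      rcases hv with hv | hv | hv | hv | hv | hv | hv | hv <;> omega
    · refine key _ _ (a = c) ?_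
      rw [← he, rowEquiv_inr_inl, Fin.ext_iff]
      refine ⟨fun hv => ?_, fun hac => ?_⟩
      · rcases hv with hv | hv | hv | hv | hv | hv | hv | hv <;> omega
      · exact Or.inr (Or.inr (Or.inr (Or.inl (by omega))))
    · refine key0 _ _ fun hv => ?_
      rw [← he, rowEquiv_inr_inr] at hv
      rcases hv with hv | hv | hv | hv | hv | hv | hv | hv <;> omega
  · have h := colEquiv_inr_inr d c
    have hc := c.2
    rw [← he] at h
    rcases a with (a | a) | (a | a) <;> have ha := a.2
    · refine key0 _ _ fun hv => ?_
      rw [← he, rowEquiv_inl_inl] at hv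
      rcases h with h | h <;> rcases hv with hv | hv | hv | hv | hv | hv | hv | hv <;> omega
    · refine key _ _ (a = c) ?_
      rw [← he, rowEquiv_inl_inr, Fin.ext_iff]
      refine ⟨fun hv => ?_, fun hac => ?_⟩
      · rcases h with h | h <;> rcases hv with hv | hv | hv | hv | hv | hv | hv | hv <;> omega
      · rcases h with h | h
        · exact Or.inr (Or.inl (by omega))
        · exact Or.inr (Or.inr (Or.inl (by omega)))
    · refine key0 _ _ fun hv => ?_
      rw [← he, rowEquiv_inr_inl] at hv
      rcases h with h | h <;> rcases hv with hv | hv | hv | hv | hv | hv | hv | hv <;> omega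
    · refine key _ _ (a = c) ?_
      rw [← he, rowEquiv_inr_inr, Fin.ext_iff]
      refine ⟨fun hv => ?_, fun hac => ?_⟩
      · rcases h with h | h <;> rcases hv with hv | hv | hv | hv | hv | hv | hv | hv <;> omega
      · rcases h with h | h
        · exact Or.inr (Or.inr (Or.inr (Or.inr (Or.inl (by omega)))))
        · exact Or.inr (Or.inr (Or.inr (Or.inr (Or.inr (Or.inr (Or.inl (by omega)))))))

end Indices

end KGSlice

/-! ### Membership in K, B', Q₁ and Q₂ in blocks -/

namespace KGSlice

variable {k : Type u} [Field k] {d : BlockSizes}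

lemma mem_groupK_iff {g : Matrix.GeneralLinearGroup (Fin d.N) k} :
    g ∈ groupK k d ↔ ∃ κ₁ κ₂, g.1.submatrix (rowEquiv d) (rowEquiv d) =
      Matrix.fromBlocks κ₁ 0 0 κ₂ := by
  have hinl : ∀ a, (rowEquiv d (Sum.inl a) : ℕ) < d.a := by
    have := d.sizes
    rintro (a | a)
    · rw [rowEquiv_inl_inl]; omega
    · rw [rowEquiv_inl_inr]; omega
  have hinr : ∀ a, ¬ (rowEquiv d (Sum.inr a) : ℕ) < d.a := by
    rintro (a | a)
    · rw [rowEquiv_inr_inl]; omega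
    · rw [rowEquiv_inr_inr]; omega
  refine ⟨fun ⟨h1, h2⟩ => ?_, fun ⟨κ₁, κ₂, h⟩ => ?_⟩
  · let b := g.1.submatrix (rowEquiv d) (rowEquiv d)
    refine ⟨b.toBlocks₁₁, b.toBlocks₂₂, (Matrix.fromBlocks_toBlocks b).symm.trans ?_⟩
    congr 1
    · ext i j
      exact h2 (by simp [hinl, hinr])
    · ext i j
      exact h1 (by simp [hinl, hinr])
  · have h12 : ∀ a c, g.1 (rowEquiv d (Sum.inl a)) (rowEquiv d (Sum.inr c)) = 0 := fun a c =>
      congrFun (congrFun h (Sum.inl a)) (Sum.inr c)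
    have h21 : ∀ a c, g.1 (rowEquiv d (Sum.inr a)) (rowEquiv d (Sum.inl c)) = 0 := fun a c =>
      congrFun (congrFun h (Sum.inr a)) (Sum.inl c)
    refine ⟨fun i j hij => ?_, fun i j hij => ?_⟩
    all_goals
      obtain ⟨a, rfl⟩ := (rowEquiv d).surjective i
      obtain ⟨c, rfl⟩ := (rowEquiv d).surjective j
      rcases a with a | a <;> rcases c with c | c <;> simp only [hinl, hinr, if_true, if_false] at hij
      all_goals first | exact absurd hij (by decide) | exact h12 a c | exact h21 a c

/-- Since `embEquiv` reverses the first p indices, the lower triangular block ℓ appears as an upper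
triangular one, as an LU-factorization requires. The fields X and Y do not enter `matB` and are set
to zero. -/
lemma mem_conjB'_iff {g : Matrix.GeneralLinearGroup (Fin d.N) k} :
    g ∈ conjInvW k d (groupB' k d) ↔ ∃ D : BlockData k d.p (Fin d.q) (Fin d.t), D.Good ∧
      g.1.submatrix (colEquiv d) (colEquiv d) = D.matB := by
  have e : ∀ a c, (w k d * g * (w k d)⁻¹).1 (embEquiv d a) (embEquiv d c) =
      g.1.submatrix (colEquiv d) (colEquiv d) a c := fun a c => w_conj_apply _ _ _
  have hs := d.sizes
  refine ⟨fun ⟨h1, h2, h3⟩ => ?_, fun ⟨D, hD, h⟩ => ⟨fun i j => ?_, fun i j => ?_, fun i => ?_⟩⟩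
  · let b := g.1.submatrix (colEquiv d) (colEquiv d)
    have h1' : ∀ a c, (embEquiv d a : ℕ) < embEquiv d c → b a c = 0 := fun a c hac =>
      (e a c).symm.trans (h1 _ _ hac)
    have h2' : ∀ a c, (d.p ≤ (embEquiv d a : ℕ) ∧ (embEquiv d a : ℕ) < d.p + d.q + d.t) →
        (d.p ≤ (embEquiv d c : ℕ) ∧ (embEquiv d c : ℕ) < d.p + d.q + d.t) →
        b a c = if a = c then 1 else 0 := fun a c ha hc =>
      (e a c).symm.trans ((h2 _ _ ha.1 ha.2 hc.1 hc.2).trans (by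
        simp only [EmbeddingLike.apply_eq_iff_eq]))
    have h3' : ∀ a, d.p + d.q + d.t ≤ (embEquiv d a : ℕ) → b a a = 1 := fun a ha =>
      (e a a).symm.trans (h3 _ ha)
    refine ⟨⟨b.toBlocks₁₁.toBlocks₁₁, b.toBlocks₁₁.toBlocks₂₁, b.toBlocks₂₁.toBlocks₁₁,
      b.toBlocks₂₁.toBlocks₂₁, b.toBlocks₂₁.toBlocks₂₂, b.toBlocks₂₂.toBlocks₂₁,
      b.toBlocks₂₂.toBlocks₂₂, 0, 0⟩, ⟨fun i j hij => ?_, fun i => ?_, fun i j hij => ?_,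
      fun i => ?_⟩, ?_⟩
    · refine h1' (Sum.inl (Sum.inl i)) (Sum.inl (Sum.inl j)) ?_
      rw [embEquiv_inl_inl, embEquiv_inl_inl]
      have := i.2
      omega
    · have hdet : (w k d * g * (w k d)⁻¹).1.det ≠ 0 :=
        (Matrix.GeneralLinearGroup.det (w k d * g * (w k d)⁻¹)).ne_zero
      rw [Matrix.det_of_isLowerTriangular _ fun i j hij => h1 i j hij] at hdet
      exact (e (Sum.inl (Sum.inl i)) (Sum.inl (Sum.inl i))).symm.trans_ne
        (Finset.prod_ne_zero_iff.1 hdet _ (Finset.mem_univ _))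
    · refine h1' (Sum.inr (Sum.inr i)) (Sum.inr (Sum.inr j)) ?_
      rw [embEquiv_inr_inr, embEquiv_inr_inr]
      omega
    · refine h3' (Sum.inr (Sum.inr i)) ?_
      rw [embEquiv_inr_inr]
      omega
    · change b = _
      ext a c
      rcases a with (a | a) | (a | a) <;> rcases c with (c | c) | (c | c)
      all_goals
        have ha := a.2
        have hc := c.2
        first
          | rfl
          | refine h1' _ _ ?_
            simp only [embEquiv_inl_inl, embEquiv_inl_inr, embEquiv_inr_inl, embEquiv_inr_inr]
            omega
          | refine (h2' _ _ ?_ ?_).trans ?_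
            · simp only [embEquiv_inl_inr, embEquiv_inr_inl]
              omega
            · simp only [embEquiv_inl_inr, embEquiv_inr_inl]
              omega
            · simp [BlockData.matB, Matrix.one_apply]
  all_goals
    have h' : ∀ a c, (w k d * g * (w k d)⁻¹).1 (embEquiv d a) (embEquiv d c) = D.matB a c :=
      fun a c => (e a c).trans (congrFun (congrFun h a) c)
    obtain ⟨a, rfl⟩ := (embEquiv d).surjective i
  · obtain ⟨c, rfl⟩ := (embEquiv d).surjective j
    intro hij
    rw [h']
    rw [Fin.lt_def] at hij
    rcases a with (a | a) | (a | a) <;> rcases c with (c | c) | (c | c)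
    all_goals
      have ha := a.2
      have hc := c.2
      simp only [embEquiv_inl_inl, embEquiv_inl_inr, embEquiv_inr_inl, embEquiv_inr_inr] at hij
      first
        | omega
        | rfl
        | exact hD.l_upper a c (Fin.lt_def.2 (by omega))
        | exact hD.u_lower.1 a c (Fin.lt_def.2 (by omega))
        | exact Matrix.one_apply_ne (Fin.ne_of_lt (Fin.lt_def.2 (by omega)))
  · obtain ⟨c, rfl⟩ := (embEquiv d).surjective j
    intro i1 i2 i3 i4
    rw [h']
    rcases a with (a | a) | (a | a) <;> rcases c with (c | c) | (c | c)
    all_goals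
      have ha := a.2
      have hc := c.2
      simp only [embEquiv_inl_inl, embEquiv_inl_inr, embEquiv_inr_inl, embEquiv_inr_inr] at i1 i2 i3 i4
      first
        | omega
        | simp [BlockData.matB, Matrix.one_apply]
  · intro hi
    rw [h']
    rcases a with (a | a) | (a | a)
    all_goals
      have ha := a.2
      simp only [embEquiv_inl_inl, embEquiv_inl_inr, embEquiv_inr_inl, embEquiv_inr_inr] at hi
      first
        | omega
        | exact hD.u_lower.2 a

lemma mem_conjQ1_iff {g : Matrix.GeneralLinearGroup (Fin d.N) k} :
    g ∈ conjInvW k d (groupQ1 k d) ↔ ∃ D : BlockData k d.p (Fin d.q) (Fin d.t),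
      g.1.submatrix (colEquiv d) (colEquiv d) = D.mat₁ := by
  have e : ∀ a c, (w k d * g * (w k d)⁻¹).1 (embEquiv d a) (embEquiv d c) =
      g.1.submatrix (colEquiv d) (colEquiv d) a c := fun a c => w_conj_apply _ _ _
  refine ⟨fun h => ?_, fun ⟨D, h⟩ i j hij => ?_⟩
  · let b := g.1.submatrix (colEquiv d) (colEquiv d)
    refine ⟨⟨0, 0, 0, 0, 0, 0, 0, b.toBlocks₁₂.toBlocks₂₁, 0⟩, ?_⟩
    change b = _
    have h' := fun a c hac => ((e a c).symm.trans (h (embEquiv d a) (embEquiv d c) hac)).trans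
      (if_congr (EmbeddingLike.apply_eq_iff_eq (embEquiv d)) rfl rfl)
    ext a c
    rcases a with (a | a) | (a | a) <;> rcases c with (c | c) | (c | c)
    all_goals
      have ha := a.2
      have hc := c.2
      first
        | rfl
        | refine (h' _ _ ?_).trans ?_
          · simp only [embEquiv_inl_inl, embEquiv_inl_inr, embEquiv_inr_inl, embEquiv_inr_inr]
            omega
          · simp [BlockData.mat₁, Matrix.one_apply]
  · obtain ⟨a, rfl⟩ := (embEquiv d).surjective i
    obtain ⟨c, rfl⟩ := (embEquiv d).surjective j
    rw [e, h, if_congr (EmbeddingLike.apply_eq_iff_eq (embEquiv d)) rfl rfl]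
    rcases a with (a | a) | (a | a) <;> rcases c with (c | c) | (c | c)
    all_goals
      have ha := a.2
      have hc := c.2
      simp only [embEquiv_inl_inl, embEquiv_inl_inr, embEquiv_inr_inl, embEquiv_inr_inr] at hij
      first
        | omega
        | simp [BlockData.mat₁, Matrix.one_apply]

lemma mem_conjQ2_iff {g : Matrix.GeneralLinearGroup (Fin d.N) k} :
    g ∈ conjInvW k d (groupQ2 k d) ↔ ∃ D : BlockData k d.p (Fin d.q) (Fin d.t),
      g.1.submatrix (colEquiv d) (colEquiv d) = D.mat₂ := by
  have e : ∀ a c, (w k d * g * (w k d)⁻¹).1 (embEquiv d a) (embEquiv d c) =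
      g.1.submatrix (colEquiv d) (colEquiv d) a c := fun a c => w_conj_apply _ _ _
  refine ⟨fun h => ?_, fun ⟨D, h⟩ i j hij => ?_⟩
  · let b := g.1.submatrix (colEquiv d) (colEquiv d)
    refine ⟨⟨0, 0, 0, 0, 0, 0, 0, 0, b.toBlocks₂₁.toBlocks₁₂⟩, ?_⟩
    change b = _
    have h' := fun a c hac => ((e a c).symm.trans (h (embEquiv d a) (embEquiv d c) hac)).trans
      (if_congr (EmbeddingLike.apply_eq_iff_eq (embEquiv d)) rfl rfl)
    ext a c
    rcases a with (a | a) | (a | a) <;> rcases c with (c | c) | (c | c)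
    all_goals
      have ha := a.2
      have hc := c.2
      first
        | rfl
        | refine (h' _ _ ?_).trans ?_
          · simp only [embEquiv_inl_inl, embEquiv_inl_inr, embEquiv_inr_inl, embEquiv_inr_inr]
            omega
          · simp [BlockData.mat₂, Matrix.one_apply]
  · obtain ⟨a, rfl⟩ := (embEquiv d).surjective i
    obtain ⟨c, rfl⟩ := (embEquiv d).surjective j
    rw [e, h, if_congr (EmbeddingLike.apply_eq_iff_eq (embEquiv d)) rfl rfl]
    rcases a with (a | a) | (a | a) <;> rcases c with (c | c) | (c | c)
    all_goals
      have ha := a.2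
      have hc := c.2
      simp only [embEquiv_inl_inl, embEquiv_inl_inr, embEquiv_inr_inl, embEquiv_inr_inr] at hij
      first
        | omega
        | simp [BlockData.mat₂, Matrix.one_apply]

end KGSlice

/-! ### Factorization of elements of w⁻¹B'w -/

namespace KGSlice

variable {k : Type u} [Field k] {d : BlockSizes}

lemma mul_mem_groupB' {g h : Matrix.GeneralLinearGroup (Fin d.N) k} (hg : g ∈ groupB' k d)
    (hh : h ∈ groupB' k d) : g * h ∈ groupB' k d := by
  refine ⟨lower_mul hg.1 hh.1, fun i j h1 h2 h3 h4 => ?_, fun i hi => ?_⟩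
  · rw [Units.val_mul, Matrix.mul_apply, Finset.sum_eq_single i (fun l _ hl => ?_) (by simp),
      hg.2.1 i i h1 h2 h1 h2, if_pos rfl, one_mul, hh.2.1 i j h1 h2 h3 h4]
    -- For l < i within the middle range, g has a zero at (i, l); for l below the range, l < p ≤ j
    -- and the other factor has a zero at (l, j).
    rcases lt_or_gt_of_ne hl with h | h
    · by_cases hm : d.p ≤ (l : ℕ)
      · rw [hg.2.1 i l h1 h2 hm ((Fin.lt_def.1 h).trans h2), if_neg hl.symm, zero_mul]
      · rw [hh.1 l j (Fin.lt_def.2 (by omega)), mul_zero]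
    · rw [hg.1 i l h, zero_mul]
  · exact (mul_apply_self_of_lower hg.1 hh.1 i).trans (by rw [hg.2.2 i hi, hh.2.2 i hi, one_mul])

lemma mul_mem_conjInvW {Γ : Set (Matrix.GeneralLinearGroup (Fin d.N) k)}
    (hΓ : ∀ g ∈ Γ, ∀ h ∈ Γ, g * h ∈ Γ) {g h : Matrix.GeneralLinearGroup (Fin d.N) k}
    (hg : g ∈ conjInvW k d Γ) (hh : h ∈ conjInvW k d Γ) : g * h ∈ conjInvW k d Γ := by
  have := hΓ _ hg _ hh
  rw [mem_conjInvW]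
  convert this using 1
  group

lemma mul_mem_conjB' {u v y : Matrix.GeneralLinearGroup (Fin d.N) k} (hu : u ∈ groupSlice k d)
    (hv : v ∈ conjInvW k d (groupU'plus k d)) (hy : y ∈ conjInvW k d (groupT' k d)) :
    u * v * y ∈ conjInvW k d (groupB' k d) :=
  mul_mem_conjInvW (fun _ hg _ hh => mul_mem_groupB' hg hh)
    (mul_mem_conjInvW (fun _ hg _ hh => mul_mem_groupB' hg hh) hu.1.1 hv.1.1) hy.1

lemma conjInvW_T'_diag {y : Matrix.GeneralLinearGroup (Fin d.N) k}
    (hy : y ∈ conjInvW k d (groupT' k d)) (i j : Fin d.N) (hij : i ≠ j) : y.1 i j = 0 := by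
  rw [conjInvW_T'_eq] at hy
  rw [hy i j fun h => hij ((wPerm d).symm.injective h.1), if_neg hij]

/-- The factorization of elements of `w⁻¹ B' w` in regular families. -/
lemma exists_factorization {X : FunctionSpace k} (b : X.Hom (glSpace k d.N))
    (hb : ∀ x, b.toFun x ∈ conjInvW k d (groupB' k d)) :
    ∃ (u : X.Hom ((glSpace k d.N).sub (groupSlice k d)))
      (v : X.Hom ((glSpace k d.N).sub (conjInvW k d (groupU'plus k d))))
      (y : X.Hom ((glSpace k d.N).sub (conjInvW k d (groupT' k d)))),
      ∀ x, (u.toFun x).1 * (v.toFun x).1 * (y.toFun x).1 = b.toFun x := by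
  let σ := wPerm d
  have hbσ : ∀ x i j, (b.toFun x).1 i j =
      (w k d * b.toFun x * (w k d)⁻¹).1 (σ.symm i) (σ.symm j) := fun x i j => by
    rw [w_conj_apply, Equiv.apply_symm_apply, Equiv.apply_symm_apply]
  -- Conjugation by w makes b lower triangular, so its diagonal part has the same determinant. This
  -- gives the diagonal part a regular inverse determinant.
  have hdet : ∀ x, (Matrix.diagonal fun i => (b.toFun x).1 i i).det = (b.toFun x).1.det := by
    intro x
    have h1 : (w k d * b.toFun x * (w k d)⁻¹).1.det = (b.toFun x).1.det := by
      rw [Units.val_mul, Units.val_mul, Matrix.det_mul_right_comm, ← Units.val_mul,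
        mul_inv_cancel, Units.val_one, one_mul]
    rw [← h1, Matrix.det_of_isLowerTriangular _ fun i j hij => (hb x).1 i j hij,
      Matrix.det_diagonal, ← Equiv.prod_comp σ fun i => (b.toFun x).1 i i]
    exact Finset.prod_congr rfl fun i _ => (w_conj_apply _ _ _).symm
  have hreg : ∀ i j, (fun x => (b.toFun x).1 i j) ∈ X.fn := fun i j => b.regular _ (entry_mem i j)
  let y' : X.Hom (glSpace k d.N) := homToGL (fun x => Matrix.GeneralLinearGroup.mkOfDetNeZero
    (Matrix.diagonal fun i => (b.toFun x).1 i i)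
      (by rw [hdet]; exact (Matrix.GeneralLinearGroup.det (b.toFun x)).ne_zero))
    (fun i j => by
      by_cases h : i = j
      · subst h
        simpa [Matrix.GeneralLinearGroup.mkOfDetNeZero] using hreg i i
      · change (fun x => Matrix.diagonal (fun i => (b.toFun x).1 i i) i j) ∈ X.fn
        simp only [Matrix.diagonal_apply_ne _ h]
        exact X.fn.zero_mem)
    (by
      have : (fun x => ((Matrix.diagonal fun i => (b.toFun x).1 i i).det)⁻¹) ∈ X.fn := by
        simp only [hdet]
        exact b.regular _ det_inv_mem
      exact this)
  have hy' : ∀ x i j, (y'.toFun x).1 i j = if i = j then (b.toFun x).1 i i else 0 := fun x i j =>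
    Matrix.diagonal_apply _ _ _
  have hyT : ∀ x, y'.toFun x ∈ conjInvW k d (groupT' k d) := by
    intro x
    rw [conjInvW_T'_eq]
    intro i j hij
    rw [hy']
    split_ifs with e
    · subst e
      rw [hbσ]
      have hi : d.p ≤ (σ.symm i : ℕ) := not_lt.1 fun h => hij ⟨rfl, h⟩
      by_cases h : (σ.symm i : ℕ) < d.p + d.q + d.t
      · rw [(hb x).2.1 _ _ hi h hi h, if_pos rfl]
      · exact (hb x).2.2 _ (not_lt.1 h)
    · rfl
  let h' : X.Hom (glSpace k d.N) := mulHom b (y'.comp glInv)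
  have hh' : ∀ x, h'.toFun x * y'.toFun x = b.toFun x := fun x => inv_mul_cancel_right _ _
  have hent : ∀ x i j, (h'.toFun x).1 i j * (b.toFun x).1 j j = (b.toFun x).1 i j := by
    intro x i j
    conv_rhs => rw [← hh' x, Units.val_mul, Matrix.mul_apply]
    rw [Finset.sum_eq_single j (fun l _ hl => by rw [hy', if_neg hl, mul_zero]) (by simp), hy',
      if_pos rfl]
  have hne : ∀ x i, (b.toFun x).1 i i ≠ 0 := fun x i h => by
    have := diag_ne_zero (t := y'.toFun x) (fun i j hij => by rw [hy', if_neg hij]) i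
    rw [hy', if_pos rfl] at this
    exact this h
  have hb0 : ∀ x i j, i ≠ j → ¬ conjRel d i j → (b.toFun x).1 i j = 0 := by
    intro x i j hij h
    rw [hbσ]
    rcases not_and_or.1 h with h | h
    · exact (hb x).1 _ _ (Fin.lt_def.2 (lt_of_le_of_ne (not_lt.1 h) fun e =>
        hij (σ.symm.injective (Fin.ext e))))
    · rw [not_not] at h
      rw [(hb x).2.1 _ _ h.1.1 h.1.2 h.2.1 h.2.2, if_neg fun e => hij (σ.symm.injective e)]
  -- The unipotent part is factored as one matrix over the ring of regular functions instead of
  -- point by point, so regularity of the two factors is automatic.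
  let H : Matrix (Fin d.N) (Fin d.N) X.fn :=
    Matrix.of fun i j => ⟨fun x => (h'.toFun x).1 i j, h'.regular _ (entry_mem i j)⟩
  obtain ⟨U, V, hUV, hU1, hV1, hU0, hV0⟩ := exists_unipotent_factorization (conjRel d)
    (fun i j => j < i) (fun i j => i < j) (fun i => σ.symm i) (fun i j h => h.1)
    (fun i j l h h' => uRel_trans h h')
    (fun i j h => ⟨fun h' => lt_asymm h', fun h' => lt_of_le_of_ne (not_lt.1 h') fun e =>
      not_conjRel_self i (by rw [e] at h; exact h)⟩) H
    (fun i => Subtype.ext (funext fun x => mul_right_cancel₀ (hne x i)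
      ((hent x i i).trans (one_mul _).symm)))
    (fun i j hij h => Subtype.ext (funext fun x => mul_right_cancel₀ (hne x j)
      ((hent x i j).trans ((hb0 x i j hij h).trans (zero_mul _).symm))))
  let ev : X.pts → X.fn →+* k := fun x => (Pi.evalRingHom (fun _ => k) x).comp X.fn.val.toRingHom
  let M : Matrix (Fin d.N) (Fin d.N) X.fn → X.pts → Matrix (Fin d.N) (Fin d.N) k :=
    fun A x => A.map (ev x)
  have hMU : ∀ x, (M U x).det = 1 := fun x =>
    IsUnipLower.det ⟨fun i j hij => congrFun (congrArg Subtype.val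
      (hU0 i j (ne_of_lt hij) fun h => lt_asymm hij h.2)) x,
      fun i => congrFun (congrArg Subtype.val (hU1 i)) x⟩
  have hMV : ∀ x, (M V x).det = 1 := fun x => by
    rw [← Matrix.det_transpose]
    exact IsUnipLower.det ⟨fun i j hij => congrFun (congrArg Subtype.val
      (hV0 j i (ne_of_gt hij) fun h => lt_asymm hij h.2)) x,
      fun i => congrFun (congrArg Subtype.val (hV1 i)) x⟩
  have hpat : ∀ (A : Matrix (Fin d.N) (Fin d.N) X.fn) (R : Fin d.N → Fin d.N → Prop)
      (hA : ∀ x, (M A x).det = 1), (∀ i, A i i = 1) → (∀ i j, i ≠ j → ¬ R i j → A i j = 0) →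
      ∀ x, Matrix.GeneralLinearGroup.mkOfDetNeZero (M A x) (by rw [hA]; exact one_ne_zero) ∈
        pat k R := by
    intro A R hA h1 h0 x i j hij
    change (A i j).1 x = _
    split_ifs with e
    · rw [← e, h1]
      rfl
    · rw [h0 i j e hij]
      rfl
  let toHom : ∀ A : Matrix (Fin d.N) (Fin d.N) X.fn, (∀ x, (M A x).det = 1) →
      X.Hom (glSpace k d.N) := fun A hA =>
    homToGL (fun x => Matrix.GeneralLinearGroup.mkOfDetNeZero (M A x)
      (by rw [hA]; exact one_ne_zero)) (fun i j => (A i j).2)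
      (by
        have : (fun x => ((M A x).det)⁻¹) ∈ X.fn := by
          simp only [hA, inv_one]
          exact X.fn.one_mem
        exact this)
  refine ⟨(toHom U hMU).codRestrict _ fun x => ?_, (toHom V hMV).codRestrict _ fun x => ?_,
    y'.codRestrict _ hyT, fun x => ?_⟩
  · rw [groupSlice_eq]
    exact hpat U _ hMU hU1 hU0 x
  · rw [conjInvW_U'plus_eq]
    exact hpat V _ hMV hV1 hV0 x
  · rw [← hh' x]
    refine congrArg (· * y'.toFun x) (Units.ext ?_)
    change U.map (ev x) * V.map (ev x) = (h'.toFun x).1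
    rw [← Matrix.map_mul, hUV]
    rfl

/-- Uniqueness of the factorization of elements of `w⁻¹ B' w`. -/
lemma factorization_unique {u u' v v' y y' : Matrix.GeneralLinearGroup (Fin d.N) k}
    (hu : u ∈ groupSlice k d) (hu' : u' ∈ groupSlice k d)
    (hv : v ∈ conjInvW k d (groupU'plus k d)) (hv' : v' ∈ conjInvW k d (groupU'plus k d))
    (hy : y ∈ conjInvW k d (groupT' k d)) (hy' : y' ∈ conjInvW k d (groupT' k d))
    (h : u * v * y = u' * v' * y') : u = u' ∧ v = v' ∧ y = y' := by
  rw [conjInvW_U'plus_eq, ← mem_unipUpper_inter_pat not_conjRel_self] at hv hv'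
  have hmul : ∀ {v y : Matrix.GeneralLinearGroup (Fin d.N) k},
      y ∈ conjInvW k d (groupT' k d) → ∀ i j, (v * y).1 i j = v.1 i j * y.1 j j := by
    intro v y hy i j
    rw [Units.val_mul, Matrix.mul_apply]
    exact Finset.sum_eq_single j (fun l _ hl => by rw [conjInvW_T'_diag hy l j hl, mul_zero])
      (by simp)
  have hup : ∀ {v y : Matrix.GeneralLinearGroup (Fin d.N) k}, v ∈ unipUpper k d.N →
      y ∈ conjInvW k d (groupT' k d) → IsUpper (v * y).1 := fun hv hy i j hij => by
    rw [hmul hy, hv.1 i j hij, zero_mul]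
  have h1 : (u'⁻¹ * u) * (v * y) = v' * y' := by
    rw [mul_assoc, ← mul_assoc u, h, mul_assoc, inv_mul_cancel_left]
  have hu1 : IsUnipLower u'⁻¹.1 := by
    rw [Matrix.coe_units_inv]
    exact IsUnipLower.inv hu'.2
  -- u'⁻¹u takes 1 to a unipotent lower triangular matrix and the upper triangular v y to the upper
  -- triangular v' y'.
  have h2 : (u'⁻¹ * u).1 = 1 := by
    refine eq_one_of_mul_triangular (u := 1) (u' := (u'⁻¹ * u).1)
      ⟨fun i j hij => Matrix.one_apply_ne (ne_of_lt hij), fun i => Matrix.one_apply_eq i⟩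
      ⟨lower_mul hu1.1 hu.2.1, fun i => ?_⟩ (mul_one _) (hup hv.2 hy) ?_ (hup hv'.2 hy')
      (congrArg Units.val h1)
    · exact (mul_apply_self_of_lower hu1.1 hu.2.1 i).trans (by rw [hu1.2, hu.2.2, one_mul])
    · exact isUnit_iff_ne_zero.2 (Matrix.GeneralLinearGroup.det (v * y)).ne_zero
  have h3 : u'⁻¹ * u = 1 := Units.ext h2
  obtain rfl : u = u' := (inv_mul_eq_one.1 h3).symm
  rw [h3, one_mul] at h1
  have h4 : ∀ i j, v.1 i j * y.1 j j = v'.1 i j * y'.1 j j := fun i j => by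
    rw [← hmul hy, ← hmul hy', h1]
  have h5 : ∀ i, y.1 i i = y'.1 i i := fun i => by
    have := h4 i i
    rwa [hv.2.2, hv'.2.2, one_mul, one_mul] at this
  refine ⟨rfl, Units.ext (Matrix.ext fun i j => ?_), Units.ext (Matrix.ext fun i j => ?_)⟩
  · have := h4 i j
    rw [h5] at this
    exact mul_right_cancel₀ (diag_ne_zero (conjInvW_T'_diag hy') j) this
  · by_cases e : i = j
    · rw [e, h5]
    · rw [conjInvW_T'_diag hy i j e, conjInvW_T'_diag hy' i j e]

end KGSlice

/-! ### Regular local representatives of cosets -/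

namespace KGSlice

variable {k : Type u} [Field k] {d : BlockSizes}

lemma quotMk_eq_iff {K : Subgroup (Matrix.GeneralLinearGroup (Fin d.N) k)}
    {g h : Matrix.GeneralLinearGroup (Fin d.N) k} :
    (quotMk K).toFun g = (quotMk K).toFun h ↔ h * g⁻¹ ∈ K :=
  Quotient.eq.trans QuotientGroup.rightRel_apply

/-- The projection to the first `a` coordinates. -/
def halfProj (k : Type u) [Field k] (d : BlockSizes) : Matrix (Fin d.N) (Fin d.N) k :=
  Matrix.diagonal fun i => if (i : ℕ) < d.a then 1 else 0

lemma halfProj_mul_self : halfProj k d * halfProj k d = halfProj k d := by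
  simp [halfProj]

/-- Describing K as the centralizer of a projection F makes g⁻¹Fg an invariant of the coset Kg. -/
lemma mem_groupK_iff_commute {g : Matrix.GeneralLinearGroup (Fin d.N) k} :
    g ∈ groupK k d ↔ halfProj k d * g.1 = g.1 * halfProj k d := by
  refine ⟨fun ⟨h1, h2⟩ => ?_, fun h => ?_⟩
  · ext i j
    rw [halfProj, Matrix.diagonal_mul, Matrix.mul_diagonal]
    by_cases hi : (i : ℕ) < d.a <;> by_cases hj : (j : ℕ) < d.a
    · simp [hi, hj]
    · simp [h2 (show (if (j : ℕ) < d.a then 1 else 0) < if (i : ℕ) < d.a then 1 else 0 by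
        simp [hi, hj])]
    · simp [h1 (show (if (j : ℕ) < d.a then 0 else 1) < if (i : ℕ) < d.a then 0 else 1 by
        simp [hi, hj])]
    · simp [hi, hj]
  · have h' : ∀ i j : Fin d.N, (if (i : ℕ) < d.a then (1 : k) else 0) * g.1 i j =
        g.1 i j * if (j : ℕ) < d.a then 1 else 0 := fun i j => by
      have := congrFun (congrFun h i) j
      rwa [halfProj, Matrix.diagonal_mul, Matrix.mul_diagonal] at this
    refine ⟨fun i j hij => ?_, fun i j hij => ?_⟩
    all_goals
      have := h' i j
      by_cases hi : (i : ℕ) < d.a <;> by_cases hj : (j : ℕ) < d.a <;> simp_all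

/-- Locally, cosets of `K` have representatives that depend regularly on the coset. -/
lemma exists_local_representative (g₀ : Matrix.GeneralLinearGroup (Fin d.N) k) :
    ∃ r : (quotSpace (groupK k d)).pts → Matrix (Fin d.N) (Fin d.N) k,
      RegMat ((quotSpace (groupK k d)).localAt ((quotMk (groupK k d)).toFun g₀)) r ∧
      r ((quotMk (groupK k d)).toFun g₀) = g₀.1 ∧
      ∀ᶠ x in (quotSpace (groupK k d)).nhd ((quotMk (groupK k d)).toFun g₀),
        ∃ h : Matrix.GeneralLinearGroup (Fin d.N) k, h.1 = r x ∧ (quotMk (groupK k d)).toFun h = x := by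
  let K := groupK k d
  let F := halfProj k d
  have hF : F * F = F := halfProj_mul_self
  have hF' : (1 - F) * (1 - F) = 1 - F := by
    rw [mul_sub, sub_mul, sub_mul, hF]; simp
  let E : (quotSpace K).pts → Matrix (Fin d.N) (Fin d.N) k :=
    Quotient.lift (fun g => (g⁻¹).1 * F * g.1) fun g h hgh => by
      have hκ := mem_groupK_iff_commute.1 (QuotientGroup.rightRel_apply.1 hgh)
      have h1 : h = h * g⁻¹ * g := (inv_mul_cancel_right h g).symm
      have h2 : (h⁻¹).1 * (h * g⁻¹).1 = (g⁻¹).1 := by rw [← Units.val_mul, inv_mul_cancel_left]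
      have h3 : h.1 = (h * g⁻¹).1 * g.1 := congrArg Units.val h1
      change (g⁻¹).1 * F * g.1 = (h⁻¹).1 * F * h.1
      rw [h3, mul_assoc (h⁻¹).1, ← mul_assoc F, hκ, ← h2]
      simp only [mul_assoc]
      rfl
  have hE : RegMat (quotSpace K) E := fun i j => by
    have h1 : RegMat (glSpace k d.N) fun g => (g⁻¹).1 := fun i j => glInv.regular _ (entry_mem i j)
    have h2 : RegMat (glSpace k d.N) fun g => g.1 := fun i j => entry_mem i j
    exact (h1.mul (RegMat.const F)).mul h2 i j
  let x₀ := (quotMk K).toFun g₀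
  -- At Kg this is g⁻¹ times the block diagonal part of g g₀⁻¹. It equals g₀⁻¹ at the base point,
  -- and where it is invertible its inverse differs from g by a block diagonal factor on the left,
  -- hence represents Kg.
  let D := fun x => E x * ((g₀⁻¹).1 * F) + (1 - E x) * ((g₀⁻¹).1 * (1 - F))
  have hD : RegMat (quotSpace K) D :=
    (hE.mul (RegMat.const _)).add (((RegMat.const 1).sub hE).mul (RegMat.const _))
  have hD' : RegMat ((quotSpace K).localAt x₀) D := fun i j => FunctionSpace.fn_le_locFn (hD i j)
  have hval : ∀ g : Matrix.GeneralLinearGroup (Fin d.N) k, D ((quotMk K).toFun g) = (g⁻¹).1 *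
      (F * (g.1 * (g₀⁻¹).1) * F + (1 - F) * (g.1 * (g₀⁻¹).1) * (1 - F)) := fun g => by
    have h1 : (1 : Matrix (Fin d.N) (Fin d.N) k) = (g⁻¹).1 * g.1 := (Units.inv_mul g).symm
    have h2 : (1 : Matrix (Fin d.N) (Fin d.N) k) - (g⁻¹).1 * F * g.1 = (g⁻¹).1 * (1 - F) * g.1 := by
      rw [mul_sub, sub_mul, mul_one, ← h1]
    change (g⁻¹).1 * F * g.1 * ((g₀⁻¹).1 * F) + (1 - (g⁻¹).1 * F * g.1) * ((g₀⁻¹).1 * (1 - F)) = _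
    rw [h2, mul_add]
    simp only [mul_assoc]
  have hx₀ : D x₀ = (g₀⁻¹).1 := by
    rw [hval, Units.mul_inv, mul_one, mul_one, hF, hF', add_sub_cancel, mul_one]
  have hdet : (D x₀).det ≠ 0 := by
    rw [hx₀]
    exact (Matrix.GeneralLinearGroup.det g₀⁻¹).ne_zero
  refine ⟨fun x => (D x)⁻¹, hD'.inv hdet, ?_, ?_⟩
  · change (D x₀)⁻¹ = _
    rw [hx₀, ← Matrix.coe_units_inv, inv_inv]
  · filter_upwards [hD'.eventually_det hdet] with x hx
    let D' := Matrix.GeneralLinearGroup.mkOfDetNeZero (D x) hx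
    refine ⟨D'⁻¹, Matrix.coe_units_inv D', ?_⟩
    induction x using Quotient.inductionOn with
    | h g =>
      refine quotMk_eq_iff.2 (mem_groupK_iff_commute.2 ?_)
      have h1 : (g * D'⁻¹⁻¹).1 =
          F * (g.1 * (g₀⁻¹).1) * F + (1 - F) * (g.1 * (g₀⁻¹).1) * (1 - F) := by
        rw [inv_inv]
        refine (congrArg (g.1 * ·) (hval g)).trans ?_
        rw [← mul_assoc, Units.mul_inv, one_mul]
      rw [h1]
      change F * _ = _ * F
      have h2 : F * (1 - F) = 0 := by rw [mul_sub, hF, mul_one, sub_self]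
      have h3 : (1 - F) * F = 0 := by rw [sub_mul, hF, one_mul, sub_self]
      rw [mul_add, add_mul]
      have e1 : F * ((1 - F) * (g.1 * (g₀⁻¹).1) * (1 - F)) = 0 := by
        rw [mul_assoc, ← mul_assoc F, h2, zero_mul]
      have e2 : (1 - F) * (g.1 * (g₀⁻¹).1) * (1 - F) * F = 0 := by rw [mul_assoc, h3, mul_zero]
      rw [e1, e2, mul_assoc, ← mul_assoc F F, hF, mul_assoc F _ F, mul_assoc _ F F, hF]

section BlockFamilies

variable {p : ℕ} {Q T : Type*} [DecidableEq Q] [DecidableEq T] {S : FunctionSpace k} {x₀ : S.pts}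

lemma RegMat.congr {m n : Type*} {A B : S.pts → Matrix m n k} (hA : RegMat (S.localAt x₀) A)
    (h : ∀ᶠ x in S.nhd x₀, B x = A x) : RegMat (S.localAt x₀) B := fun i j =>
  FunctionSpace.locFn_congr (hA i j) (by
    filter_upwards [h] with x hx
    rw [hx])

/-- A version of `exists_local_blockData` in which the data are good at all points. -/
lemma exists_local_good_blockData [Fintype Q] [Fintype T]
    (A : S.pts → Matrix ((Q ⊕ Fin p) ⊕ (T ⊕ Fin p)) ((Fin p ⊕ Q) ⊕ (T ⊕ Fin p)) k)
    (hA : RegMat (S.localAt x₀) A) (D₀ : BlockData k p Q T) (hD₀ : D₀.Good) (h₀ : A x₀ = D₀.mat) :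
    ∃ D : S.pts → BlockData k p Q T, BlockData.Regular (S.localAt x₀) D ∧ (∀ x, (D x).Good) ∧
      ∀ᶠ x in S.nhd x₀,
        ∃ (κ₁ : Matrix (Q ⊕ Fin p) (Q ⊕ Fin p) k) (κ₂ : Matrix (T ⊕ Fin p) (T ⊕ Fin p) k),
          Matrix.fromBlocks κ₁ 0 0 κ₂ * A x = (D x).mat := by
  classical
  obtain ⟨D, hD, h⟩ := exists_local_blockData A hA D₀ hD₀ h₀
  -- Regular maps into the groups must be defined at all points, so data that are not good are
  -- replaced by `D₀`. This happens only away from a neighbourhood of `x₀` and does not affect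
  -- regularity there.
  let D' : S.pts → BlockData k p Q T := fun x => if (D x).Good then D x else D₀
  have h' : ∀ᶠ x in S.nhd x₀, D' x = D x := by
    filter_upwards [h] with x hx
    exact if_pos hx.1
  refine ⟨D', ⟨hD.l.congr ?_, hD.b₂₁.congr ?_, hD.b₃₁.congr ?_, hD.b₄₁.congr ?_, hD.b₄₂.congr ?_,
    hD.b₄₃.congr ?_, hD.u.congr ?_, hD.X.congr ?_, hD.Y.congr ?_⟩, fun x => ?_, ?_⟩
  iterate 9
    filter_upwards [h'] with x hx
    rw [hx]
  · by_cases hx : (D x).Good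
    · simpa only [D', if_pos hx] using hx
    · simpa only [D', if_neg hx] using hD₀
  · filter_upwards [h, h'] with x hx hx'
    rw [hx']
    exact hx.2

lemma BlockData.Regular.matB {D : S.pts → BlockData k p Q T} (hD : BlockData.Regular S D) :
    RegMat S fun x => (D x).matB := by
  rintro ((i | i) | (i | i)) ((j | j) | (j | j))
  all_goals first
    | exact S.fn.algebraMap_mem _
    | exact hD.l i j
    | exact hD.b₂₁ i j
    | exact hD.b₃₁ i j
    | exact hD.b₄₁ i j
    | exact hD.b₄₂ i j
    | exact hD.b₄₃ i j
    | exact hD.u i j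

lemma BlockData.Regular.mat₁ {D : S.pts → BlockData k p Q T} (hD : BlockData.Regular S D) :
    RegMat S fun x => (D x).mat₁ := by
  rintro ((i | i) | (i | i)) ((j | j) | (j | j))
  all_goals first
    | exact S.fn.algebraMap_mem _
    | exact hD.X i j

lemma BlockData.Regular.mat₂ {D : S.pts → BlockData k p Q T} (hD : BlockData.Regular S D) :
    RegMat S fun x => (D x).mat₂ := by
  rintro ((i | i) | (i | i)) ((j | j) | (j | j))
  all_goals first
    | exact S.fn.algebraMap_mem _
    | exact hD.Y i j

variable [Fintype Q] [Fintype T]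

lemma BlockData.Good.det_matB {D : BlockData k p Q T} (hD : D.Good) : D.matB.det ≠ 0 := by
  rw [BlockData.matB, Matrix.det_fromBlocks_zero₁₂, Matrix.det_fromBlocks_zero₁₂,
    Matrix.det_fromBlocks_zero₁₂, Matrix.det_one, Matrix.det_one, hD.u_lower.det,
    Matrix.det_of_isUpperTriangular (M := D.l) fun i j hij => hD.l_upper i j hij, mul_one, mul_one,
    mul_one]
  exact Finset.prod_ne_zero_iff.2 fun i _ => hD.l_diag i

lemma BlockData.det_mat₁ (D : BlockData k p Q T) : D.mat₁.det ≠ 0 := by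
  rw [BlockData.mat₁, Matrix.det_fromBlocks_zero₂₁, Matrix.det_one, Matrix.det_one, mul_one]
  exact one_ne_zero

lemma BlockData.det_mat₂ (D : BlockData k p Q T) : D.mat₂.det ≠ 0 := by
  rw [BlockData.mat₂, Matrix.det_fromBlocks_zero₁₂, Matrix.det_one, Matrix.det_one, mul_one]
  exact one_ne_zero

end BlockFamilies

lemma exists_local_hom {S : FunctionSpace k} {x₀ : S.pts} {ι : Type*} [Fintype ι] [DecidableEq ι]
    (γ : ι ≃ Fin d.N) (M : S.pts → Matrix ι ι k) (hM : RegMat (S.localAt x₀) M)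
    (hdet : ∀ x, (M x).det ≠ 0) :
    ∃ h : (S.localAt x₀).Hom (glSpace k d.N), ∀ x, (h.toFun x).1.submatrix γ γ = M x := by
  have hdet' : ∀ x, ((M x).submatrix γ.symm γ.symm).det ≠ 0 := fun x => by
    rw [Matrix.det_submatrix_equiv_self]
    exact hdet x
  have hM' : RegMat (S.localAt x₀) fun x => (M x).submatrix γ.symm γ.symm := hM.submatrix _ _
  refine ⟨homToGL (fun x => Matrix.GeneralLinearGroup.mkOfDetNeZero _ (hdet' x)) hM'
    (FunctionSpace.locFn_inv hM'.det (hdet' x₀)), fun x => ?_⟩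
  change ((M x).submatrix γ.symm γ.symm).submatrix γ γ = M x
  simp

end KGSlice

/-! ### The map (u, z) ↦ Kv₀ u p(z) is an open immersion -/

namespace KGSlice

variable {k : Type u} [Field k] {d : BlockSizes}

lemma isVariety_zSpace : (ZSpace k d).IsVariety := by
  obtain ⟨R₁, h₁⟩ := conjInvW_Q1_eq (k := k) (d := d)
  obtain ⟨R₂, h₂⟩ := conjInvW_Q2_eq (k := k) (d := d)
  rw [ZSpace, conjInvW_U'plus_eq, conjInvW_T'_eq, h₁, h₂]
  exact (isVariety_pat _).prod ((isVariety_pat _).prod ((isVariety_pat _).prod (isVariety_pat _)))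

lemma smooth_zSpace [Infinite k] : Algebra.Smooth k (ZSpace k d).fn := by
  classical
  obtain ⟨R₁, h₁⟩ := conjInvW_Q1_eq (k := k) (d := d)
  obtain ⟨R₂, h₂⟩ := conjInvW_Q2_eq (k := k) (d := d)
  rw [ZSpace, conjInvW_U'plus_eq, conjInvW_T'_eq, h₁, h₂]
  exact smooth_prod (smooth_pat _) (smooth_prod (smooth_pat _)
    (smooth_prod (smooth_pat _) (smooth_pat _)))

lemma isVariety_groupSlice : ((glSpace k d.N).sub (groupSlice k d)).IsVariety := by
  rw [groupSlice_eq]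
  exact isVariety_pat _

variable (k d) in
/-- The map `(u, z) ↦ K v₀ u p(z)`. -/
noncomputable def sliceMap :
    (((glSpace k d.N).sub (groupSlice k d)).prod (ZSpace k d)).Hom (quotSpace (groupK k d)) :=
  (((FunctionSpace.prodFst _ _).comp (orbitMap k d (v0 k d) (groupSlice k d))).pair
    ((FunctionSpace.prodSnd _ _).comp (pMap k d))).comp (quotAct (groupK k d))

lemma sliceMap_apply (u : groupSlice k d) (z : (ZSpace k d).pts) :
    (sliceMap k d).toFun (u, z) = (quotMk (groupK k d)).toFun (v0 k d *
      (u.1 * z.1.1 * z.2.1.1) * z.2.2.1.1 * z.2.2.2.1) := by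
  change (quotMk (groupK k d)).toFun (v0 k d * u.1 * (z.1.1 * (z.2.1.1 * (z.2.2.1.1 * z.2.2.2.1)))) = _
  simp only [mul_assoc]

/-- The blocks of an element of `v₀ B' Q`. -/
lemma exists_blockData {b y₁ y₂ : Matrix.GeneralLinearGroup (Fin d.N) k}
    (hb : b ∈ conjInvW k d (groupB' k d)) (h₁ : y₁ ∈ conjInvW k d (groupQ1 k d))
    (h₂ : y₂ ∈ conjInvW k d (groupQ2 k d)) :
    ∃ D : BlockData k d.p (Fin d.q) (Fin d.t), D.Good ∧
      b.1.submatrix (colEquiv d) (colEquiv d) = D.matB ∧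
      y₁.1.submatrix (colEquiv d) (colEquiv d) = D.mat₁ ∧
      y₂.1.submatrix (colEquiv d) (colEquiv d) = D.mat₂ := by
  obtain ⟨D, hD, hb⟩ := mem_conjB'_iff.1 hb
  obtain ⟨D₁, h₁⟩ := mem_conjQ1_iff.1 h₁
  obtain ⟨D₂, h₂⟩ := mem_conjQ2_iff.1 h₂
  exact ⟨{ D with X := D₁.X, Y := D₂.Y }, ⟨hD.1, hD.2, hD.3⟩, hb, h₁, h₂⟩

lemma submatrix_v0_mul {D : BlockData k d.p (Fin d.q) (Fin d.t)}
    {b y₁ y₂ : Matrix.GeneralLinearGroup (Fin d.N) k}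
    (hb : b.1.submatrix (colEquiv d) (colEquiv d) = D.matB)
    (h₁ : y₁.1.submatrix (colEquiv d) (colEquiv d) = D.mat₁)
    (h₂ : y₂.1.submatrix (colEquiv d) (colEquiv d) = D.mat₂) :
    (v0 k d * b * y₁ * y₂).1.submatrix (rowEquiv d) (colEquiv d) = D.mat := by
  rw [← blockV0_mul, ← hb, ← h₁, ← h₂, ← v0_submatrix, Matrix.submatrix_mul_equiv,
    Matrix.submatrix_mul_equiv, Matrix.submatrix_mul_equiv]
  rfl

lemma eq_of_submatrix_eq {g h : Matrix.GeneralLinearGroup (Fin d.N) k} {ι : Type*} (γ : ι ≃ Fin d.N)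
    (e : g.1.submatrix γ γ = h.1.submatrix γ γ) : g = h :=
  Units.ext (Matrix.ext fun i j => by
    have := congrFun (congrFun e (γ.symm i)) (γ.symm j)
    simpa using this)

/-- Equal cosets differ by an element of K, so `BlockData.mat_unique` identifies the factors in
w⁻¹B'w, w⁻¹Q₁w and w⁻¹Q₂w. The first of these is split further by `factorization_unique`. -/
lemma sliceMap_injective : Function.Injective (sliceMap k d).toFun := by
  rintro ⟨⟨u, hu⟩, ⟨v, hv⟩, ⟨y, hy⟩, ⟨y₁, h₁⟩, ⟨y₂, h₂⟩⟩
    ⟨⟨u', hu'⟩, ⟨v', hv'⟩, ⟨y', hy'⟩, ⟨y₁', h₁'⟩, ⟨y₂', h₂'⟩⟩ h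
  rw [sliceMap_apply, sliceMap_apply, quotMk_eq_iff] at h
  dsimp only at h
  obtain ⟨D, hD, e1, e2, e3⟩ := exists_blockData (mul_mem_conjB' hu hv hy) h₁ h₂
  obtain ⟨D', hD', e1', e2', e3'⟩ := exists_blockData (mul_mem_conjB' hu' hv' hy') h₁' h₂'
  obtain ⟨κ₁, κ₂, hκ⟩ := mem_groupK_iff.1 h
  obtain rfl : D = D' := by
    refine BlockData.mat_unique hD hD' κ₁ κ₂ ?_
    rw [← hκ, ← submatrix_v0_mul e1 e2 e3, ← submatrix_v0_mul e1' e2' e3',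
      Matrix.submatrix_mul_equiv, ← Units.val_mul, inv_mul_cancel_right]
  obtain rfl := eq_of_submatrix_eq _ (e2.trans e2'.symm)
  obtain rfl := eq_of_submatrix_eq _ (e3.trans e3'.symm)
  obtain ⟨rfl, rfl, rfl⟩ := factorization_unique hu hu' hv hv' hy hy'
    (eq_of_submatrix_eq _ (e1.trans e1'.symm))
  rfl

/-- A coset near the given one is lifted to a matrix, brought into normal form by a regular family
of blocks, and the factor in w⁻¹B'w is split regularly into its three parts. -/
lemma exists_local_section (a : (((glSpace k d.N).sub (groupSlice k d)).prod (ZSpace k d)).pts) :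
    ∃ s : ((quotSpace (groupK k d)).localAt ((sliceMap k d).toFun a)).Hom
        (((glSpace k d.N).sub (groupSlice k d)).prod (ZSpace k d)),
      ∀ᶠ x in (quotSpace (groupK k d)).nhd ((sliceMap k d).toFun a),
        (sliceMap k d).toFun (s.toFun x) = x := by
  obtain ⟨⟨u, hu⟩, ⟨v, hv⟩, ⟨y, hy⟩, ⟨y₁, h₁⟩, ⟨y₂, h₂⟩⟩ := a
  rw [sliceMap_apply]
  dsimp only
  obtain ⟨D₀, hD₀, e1, e2, e3⟩ := exists_blockData (mul_mem_conjB' hu hv hy) h₁ h₂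
  obtain ⟨r, hr, hr₀, hrx⟩ := exists_local_representative (v0 k d * (u * v * y) * y₁ * y₂)
  obtain ⟨D, hDr, hD, hDx⟩ := exists_local_good_blockData _
    (hr.submatrix (rowEquiv d) (colEquiv d)) D₀ hD₀ (by
      rw [hr₀]
      exact submatrix_v0_mul e1 e2 e3)
  obtain ⟨b, hb⟩ := exists_local_hom (colEquiv d) _ hDr.matB fun x => (hD x).det_matB
  obtain ⟨b₁, hb₁⟩ := exists_local_hom (colEquiv d) _ hDr.mat₁ fun x => (D x).det_mat₁
  obtain ⟨b₂, hb₂⟩ := exists_local_hom (colEquiv d) _ hDr.mat₂ fun x => (D x).det_mat₂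
  obtain ⟨u', v', y', h'⟩ := exists_factorization b fun x => mem_conjB'_iff.2 ⟨D x, hD x, hb x⟩
  refine ⟨u'.pair (v'.pair (y'.pair ((b₁.codRestrict _ fun x => mem_conjQ1_iff.2 ⟨D x, hb₁ x⟩).pair
    (b₂.codRestrict _ fun x => mem_conjQ2_iff.2 ⟨D x, hb₂ x⟩)))), ?_⟩
  filter_upwards [hrx, hDx] with x ⟨h, hh, hx⟩ ⟨κ₁, κ₂, hκ⟩
  refine Eq.trans ?_ hx
  refine (sliceMap_apply _ _).trans ?_
  change (quotMk (groupK k d)).toFun (v0 k d * ((u'.toFun x).1 * (v'.toFun x).1 * (y'.toFun x).1) *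
    b₁.toFun x * b₂.toFun x) = _
  rw [h', eq_comm, quotMk_eq_iff]
  refine mem_groupK_iff.2 ⟨κ₁, κ₂, ?_⟩
  rw [Units.val_mul, ← Matrix.submatrix_mul_equiv _ _ _ (colEquiv d),
    submatrix_v0_mul (hb x) (hb₁ x) (hb₂ x), ← hκ, Matrix.mul_assoc, ← hh,
    Matrix.submatrix_mul_equiv, ← Units.val_mul, mul_inv_cancel, Units.val_one,
    Matrix.submatrix_one_equiv, Matrix.mul_one]

lemma isOpenImmersion_sliceMap [IsAlgClosed k] : IsOpenImmersion (sliceMap k d).toScheme.left :=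
  FunctionSpace.isOpenImmersion_of_localSections (sliceMap k d) (isVariety_groupSlice.prod isVariety_zSpace)
    sliceMap_injective exists_local_section

end KGSlice

/-! ### Scheme-theoretic operations, orbit closures and the slice -/

namespace KGSlice

open FunctionSpace

variable {k : Type u} [Field k] {d : BlockSizes}

/-- On morphisms that come from regular maps the scheme-theoretic operation is given by the
operation on points. Identities between morphisms are thereby reduced to identities between
matrices. -/
lemma lift_actG {X A : FunctionSpace k} (φ : X.Hom (quotSpace (groupK k d))) (ψ : X.Hom A)
    (χ : A.Hom (glSpace k d.N)) :
    lift φ.toScheme ψ.toScheme ≫ (KG k d ◁ χ.toScheme) ≫ actG k d =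
      ((φ.pair (ψ.comp χ)).comp (quotAct (groupK k d))).toScheme := by
  rw [toScheme_comp, ← lift_toScheme_inv, toScheme_comp, lift_whiskerLeft_assoc, actG,
    Category.assoc]

lemma lift_actTS {X : FunctionSpace k} (φ : X.Hom (quotSpace (groupK k d)))
    (τ : X.Hom (TSSpace k d)) :
    lift φ.toScheme τ.toScheme ≫ actTS k d =
      ((φ.pair (τ.comp (FunctionSpace.incl _ _))).comp (quotAct (groupK k d))).toScheme :=
  lift_actG φ τ _

lemma lift_actZ {X : FunctionSpace k} (ψ : X.Hom (ZSpace k d)) (τ : X.Hom (TSSpace k d)) :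
    lift ψ.toScheme τ.toScheme ≫ actZ k d = ((ψ.pair τ).comp (conjZ k d)).toScheme := by
  rw [toScheme_comp, ← lift_toScheme_inv, actZ, Category.assoc]

/-- The image of an orbit map determines the orbit closure. -/
lemma exists_iso_orbitClosure (g : Matrix.GeneralLinearGroup (Fin d.N) k)
    (Γ : Set (Matrix.GeneralLinearGroup (Fin d.N) k)) :
    ∃ o : ((quotSpace (groupK k d)).sub (Set.range (orbitMap k d g Γ).toFun)).toScheme ≅
        orbitClosure k d g Γ, o.hom ≫ orbitClosureι k d g Γ =
      ((quotSpace (groupK k d)).incl (Set.range (orbitMap k d g Γ).toFun)).toScheme := by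
  have : IsClosedImmersion
      ((quotSpace (groupK k d)).incl (Set.range (orbitMap k d g Γ).toFun)).toScheme.left := by
    refine isClosedImmersion_toScheme _ ?_
    rintro _ ⟨f, hf, rfl⟩
    exact ⟨f, hf, fun _ => rfl⟩
  have : IsReduced ((quotSpace (groupK k d)).sub (Set.range (orbitMap k d g Γ).toFun)).toScheme.left :=
    isReduced_toScheme
  -- The set of points of the orbit need not be closed: the restrictions of regular functions to it
  -- already form the coordinate ring of its closure.
  exact exists_iso_reducedClosure _ (closure_range_toScheme _).symm

/-- A family of elements of a subgroup `P` operates on the closures of `P`-orbits. -/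
lemma exists_act_orbitClosure (g : Matrix.GeneralLinearGroup (Fin d.N) k)
    (P : Subgroup (Matrix.GeneralLinearGroup (Fin d.N) k)) {A : FunctionSpace k}
    (χ : A.Hom (glSpace k d.N)) (hχ : ∀ a, χ.toFun a ∈ P) :
    ∃ β : orbitClosure k d g P ⊗ A.toScheme ⟶ orbitClosure k d g P,
      β ≫ orbitClosureι k d g P =
        (orbitClosureι k d g P ▷ A.toScheme) ≫ (KG k d ◁ χ.toScheme) ≫ actG k d := by
  obtain ⟨o, ho⟩ := exists_iso_orbitClosure g (P : Set (Matrix.GeneralLinearGroup (Fin d.N) k))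
  let E := Set.range (orbitMap k d g P).toFun
  let O := (quotSpace (groupK k d)).sub E
  -- For the same reason it suffices to define the operation on the points of the orbit itself,
  -- where it is well defined because P is a group.
  let a : (O.prod A).Hom O := ((((prodFst O A).comp (FunctionSpace.incl _ E)).pair
    ((prodSnd O A).comp χ)).comp (quotAct (groupK k d))).codRestrict E (by
      rintro ⟨⟨_, p, rfl⟩, x⟩
      refine ⟨⟨p.1 * χ.toFun x, P.mul_mem p.2 (hχ x)⟩, ?_⟩
      change (quotMk (groupK k d)).toFun (g * (p.1 * χ.toFun x)) =
        (quotMk (groupK k d)).toFun (g * p.1 * χ.toFun x)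
      rw [mul_assoc])
  refine ⟨(o.inv ▷ A.toScheme) ≫ inv (prodComparison O A) ≫ a.toScheme ≫ o.hom, ?_⟩
  rw [← cancel_epi (o.hom ▷ A.toScheme), ← cancel_epi (prodComparison O A)]
  have h1 : prodComparison O A ≫ (o.hom ▷ A.toScheme) ≫
      ((o.inv ▷ A.toScheme) ≫ inv (prodComparison O A) ≫ a.toScheme ≫ o.hom) ≫
        orbitClosureι k d g P = (a.comp (FunctionSpace.incl _ E)).toScheme := by
    simp only [Category.assoc, hom_inv_whiskerRight_assoc, IsIso.hom_inv_id_assoc, ho]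
    rw [toScheme_comp]
  rw [h1, ← comp_whiskerRight_assoc, ho, FunctionSpace.prodComparison, lift_whiskerRight_assoc, ← toScheme_comp]
  exact (lift_actG _ _ _).symm

section Slice

/-- The map `u ↦ (u, 1)`. -/
noncomputable def sliceUnit (k : Type u) [Field k] (d : BlockSizes) :
    ((glSpace k d.N).sub (groupSlice k d)).Hom
      (((glSpace k d.N).sub (groupSlice k d)).prod (ZSpace k d)) :=
  let X := (glSpace k d.N).sub (groupSlice k d)
  have h : ∀ R : Fin d.N → Fin d.N → Prop, (1 : Matrix.GeneralLinearGroup (Fin d.N) k) ∈ pat k R :=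
    fun R i j _ => Matrix.one_apply
  (⟨id, fun f hf => hf⟩ : X.Hom X).pair
    (((glConst X 1).codRestrict _ fun _ => conjInvW_U'plus_eq (k := k) (d := d) ▸ h _).pair
      (((glConst X 1).codRestrict _ fun _ => conjInvW_T'_eq (k := k) (d := d) ▸ h _).pair
        (((glConst X 1).codRestrict _ fun _ => by
            obtain ⟨R, hR⟩ := conjInvW_Q1_eq (k := k) (d := d)
            exact hR ▸ h R).pair
          ((glConst X 1).codRestrict _ fun _ => by
            obtain ⟨R, hR⟩ := conjInvW_Q2_eq (k := k) (d := d)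
            exact hR ▸ h R))))

lemma sliceUnit_comp : (sliceUnit k d).comp (sliceMap k d) =
    orbitMap k d (v0 k d) (groupSlice k d) := Hom.ext fun u => by
  refine (sliceMap_apply _ _).trans ?_
  change (quotMk (groupK k d)).toFun (v0 k d * (u.1 * 1 * 1) * 1 * 1) =
    (quotMk (groupK k d)).toFun (v0 k d * u.1)
  simp only [mul_one]

/-- The orbit map is u ↦ (u, 1), a closed immersion split by the projection, followed by the open
immersion `sliceMap`. It is therefore an immersion with reduced source, which determines the reduced
structure on its image. -/
lemma exists_iso_slice [IsAlgClosed k] :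
    ∃ e : ((glSpace k d.N).sub (groupSlice k d)).toScheme ≅ slice k d,
      e.hom ≫ sliceι k d = (orbitMap k d (v0 k d) (groupSlice k d)).toScheme := by
  have h1 : IsClosedImmersion (sliceUnit k d).toScheme.left :=
    isClosedImmersion_toScheme _ fun f hf => ⟨_, (prodFst _ _).regular f hf, fun _ => rfl⟩
  have h2 : IsOpenImmersion (sliceMap k d).toScheme.left := isOpenImmersion_sliceMap
  have h3 : (orbitMap k d (v0 k d) (groupSlice k d)).toScheme.left =
      (sliceUnit k d).toScheme.left ≫ (sliceMap k d).toScheme.left := by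
    rw [← sliceUnit_comp, toScheme_comp]
    rfl
  have : IsImmersion (orbitMap k d (v0 k d) (groupSlice k d)).toScheme.left := by
    rw [h3]
    infer_instance
  have : QuasiCompact (orbitMap k d (v0 k d) (groupSlice k d)).toScheme.left :=
    inferInstanceAs (QuasiCompact (Spec.map _))
  have : IsReduced ((glSpace k d.N).sub (groupSlice k d)).toScheme.left := isReduced_toScheme
  exact exists_iso_reducedInduced _ rfl

lemma lift_Psi (e : ((glSpace k d.N).sub (groupSlice k d)).toScheme ≅ slice k d)
    (he : e.hom ≫ sliceι k d = (orbitMap k d (v0 k d) (groupSlice k d)).toScheme) {X : FunctionSpace k} (φ : X.Hom ((glSpace k d.N).sub (groupSlice k d)))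
    (ψ : X.Hom (ZSpace k d)) :
    lift (φ.toScheme ≫ e.hom) ψ.toScheme ≫ Psi k d =
      ((φ.pair ψ).comp (sliceMap k d)).toScheme := by
  rw [Psi, lift_map_assoc, Category.assoc, he, ← toScheme_comp, ← toScheme_comp, actG,
    ← Category.assoc, lift_toScheme_inv, ← toScheme_comp]
  rfl

end Slice

end KGSlice

/-! ### Equivariance under T_S and containment in P' -/

namespace KGSlice

open FunctionSpace

section Formal

variable {B : Scheme.{u}}

/-- The operation on O ∩ S is induced by those on O and S. The operation on O ∩ W is transported
along φ, so φ is equivariant by construction, and compatibility with the operation on X is what `hσ`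
provides. -/
lemma exists_equivariant_iso {X Z T O S W : Over B} (i : O ⟶ X) [Mono i] (j : S ⟶ X) [Mono j]
    (v : W ⟶ X) (α α' : X ⊗ Z ⟶ X) (h : lift α (snd X Z) ≫ α' = fst X Z)
    (β β' : O ⊗ Z ⟶ O) (hβ : β ≫ i = (i ▷ Z) ≫ α) (hβ' : β' ≫ i = (i ▷ Z) ≫ α')
    (m : S ⊗ Z ≅ W) (hm : m.hom ≫ v = (j ▷ Z) ≫ α) (act : X ⊗ T ⟶ X)
    (βT : O ⊗ T ⟶ O) (hβT : βT ≫ i = (i ▷ T) ≫ act)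
    (ρ : S ⊗ T ⟶ S) (hρ : ρ ≫ j = (j ▷ T) ≫ act)
    (σ : Z ⊗ T ⟶ Z) (hσ : diagAct ρ σ ≫ (j ▷ Z) ≫ α = (((j ▷ Z) ≫ α) ▷ T) ≫ act) :
    ∃ (ρ₁ : Limits.pullback i j ⊗ T ⟶ Limits.pullback i j)
      (ρ₂ : Limits.pullback i v ⊗ T ⟶ Limits.pullback i v)
      (φ : Limits.pullback i j ⊗ Z ≅ Limits.pullback i v),
      ρ₁ ≫ Limits.pullback.snd _ _ = (Limits.pullback.snd _ _ ▷ T) ≫ ρ ∧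
      ρ₂ ≫ Limits.pullback.fst _ _ ≫ i = ((Limits.pullback.fst _ _ ≫ i) ▷ T) ≫ act ∧
      φ.hom ≫ Limits.pullback.fst _ _ ≫ i = (Limits.pullback.snd _ _ ▷ Z) ≫ (j ▷ Z) ≫ α ∧
      diagAct ρ₁ σ ≫ φ.hom = (φ.hom ▷ T) ≫ ρ₂ := by
  obtain ⟨e, he⟩ := exists_iso_pullback α α' h i β β' hβ hβ' j
  let f : Limits.pullback i ((j ▷ Z) ≫ α) ⟶ Limits.pullback i v :=
    Limits.pullback.map _ _ _ _ (𝟙 O) m.hom (𝟙 X) (by simp) (by simp [hm])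
  let φ : Limits.pullback i j ⊗ Z ≅ Limits.pullback i v := e ≪≫ asIso f
  have hφ : φ.hom ≫ Limits.pullback.fst _ _ ≫ i = (Limits.pullback.snd _ _ ▷ Z) ≫ (j ▷ Z) ≫ α := by
    have h1 : f ≫ Limits.pullback.snd _ _ = Limits.pullback.snd _ _ ≫ m.hom :=
      Limits.pullback.lift_snd _ _ _
    calc φ.hom ≫ Limits.pullback.fst _ _ ≫ i = e.hom ≫ (f ≫ Limits.pullback.snd _ _) ≫ v := by
          rw [Limits.pullback.condition]
          simp [φ]
      _ = _ := by rw [h1, Category.assoc, hm, reassoc_of% he]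
  let ρ₁ : Limits.pullback i j ⊗ T ⟶ Limits.pullback i j :=
    Limits.pullback.lift ((Limits.pullback.fst i j ▷ T) ≫ βT) ((Limits.pullback.snd i j ▷ T) ≫ ρ) (by
      rw [Category.assoc, Category.assoc, hβT, hρ, ← comp_whiskerRight_assoc,
        ← comp_whiskerRight_assoc, Limits.pullback.condition])
  have hρ₁ : ρ₁ ≫ Limits.pullback.snd _ _ = (Limits.pullback.snd _ _ ▷ T) ≫ ρ :=
    Limits.pullback.lift_snd _ _ _
  have hdiag : diagAct ρ₁ σ ≫ (Limits.pullback.snd i j ▷ Z) =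
      ((Limits.pullback.snd i j ▷ Z) ▷ T) ≫ diagAct ρ σ := by
    rw [diagAct, diagAct, lift_whiskerRight, comp_lift, Category.assoc, hρ₁]
    congr 1
    · rw [← comp_whiskerRight_assoc, ← comp_whiskerRight_assoc, whiskerRight_fst]
    · rw [← comp_whiskerRight_assoc, whiskerRight_snd]
  refine ⟨ρ₁, (φ.inv ▷ T) ≫ diagAct ρ₁ σ ≫ φ.hom, φ, hρ₁, ?_, hφ, ?_⟩
  · have h2 : Limits.pullback.fst i v ≫ i =
        φ.inv ≫ (Limits.pullback.snd i j ▷ Z) ≫ (j ▷ Z) ≫ α := by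
      rw [← hφ, Iso.inv_hom_id_assoc]
    rw [Category.assoc, Category.assoc, hφ, reassoc_of% hdiag, hσ, h2]
    simp only [comp_whiskerRight, Category.assoc]
  · rw [hom_inv_whiskerRight_assoc]

end Formal

variable {k : Type u} [Field k] {d : BlockSizes}

lemma diagStable_pat (R : Fin d.N → Fin d.N → Prop) : DiagStable (pat k R) :=
  fun _ hg _ ht i j hij => conj_apply_one ht (hg i j hij)

lemma diagStable_groupSlice : DiagStable (groupSlice k d) := groupSlice_eq (k := k) ▸ diagStable_pat _

/-- In block order the last row of v₀ has identities in both columns of size p. The conditions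
defining T_S say exactly that the two corresponding blocks of τ agree, so v₀ τ equals a block
diagonal matrix times v₀. -/
lemma v0_conj_mem_groupK {τ : Matrix.GeneralLinearGroup (Fin d.N) k} (hτ : τ ∈ torusTS k d) :
    v0 k d * τ * (v0 k d)⁻¹ ∈ groupK k d := by
  obtain ⟨h1, h2, h3⟩ := hτ
  let t := τ.1.submatrix (colEquiv d) (colEquiv d)
  have ht : ∀ a c, a ≠ c → t a c = 0 := fun a c hac => h1 _ _ fun e => hac ((colEquiv d).injective e)
  have hs := d.sizes
  have h4 : t.toBlocks₂₂.toBlocks₂₂ = t.toBlocks₁₁.toBlocks₁₁ := by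
    ext i j
    change t (Sum.inr (Sum.inr i)) (Sum.inr (Sum.inr j)) = t (Sum.inl (Sum.inl i)) (Sum.inl (Sum.inl j))
    by_cases e : i = j
    · subst e
      have hi := i.2
      rcases colEquiv_inl_inl d i with ⟨hi1, e1⟩ | ⟨hi1, e1⟩ <;>
        rcases colEquiv_inr_inr d i with ⟨hi2, e2⟩ | ⟨hi2, e2⟩
      · exact h3 _ _ (by rw [e1, e2]; omega)
      · omega
      · omega
      · exact h2 _ _ (by rw [e1, e2]; omega)
    · rw [ht _ _ (by simpa using e), ht _ _ (by simpa using e)]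
  have h5 : t = Matrix.fromBlocks
      (Matrix.fromBlocks t.toBlocks₁₁.toBlocks₁₁ 0 0 t.toBlocks₁₁.toBlocks₂₂) 0 0
      (Matrix.fromBlocks t.toBlocks₂₂.toBlocks₁₁ 0 0 t.toBlocks₁₁.toBlocks₁₁) := by
    nth_rewrite 2 [← h4]
    ext ((i | i) | (i | i)) ((j | j) | (j | j)) <;> first | rfl | exact ht _ _ (by simp)
  refine mem_groupK_iff.2
    ⟨Matrix.fromBlocks t.toBlocks₁₁.toBlocks₂₂ 0 0 t.toBlocks₁₁.toBlocks₁₁,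
      Matrix.fromBlocks t.toBlocks₂₂.toBlocks₁₁ 0 0 t.toBlocks₁₁.toBlocks₁₁, ?_⟩
  rw [Units.val_mul, Units.val_mul, ← Matrix.submatrix_mul_equiv _ _ _ (colEquiv d),
    ← Matrix.submatrix_mul_equiv _ _ _ (colEquiv d)]
  have h6 : (v0 k d).1.submatrix (rowEquiv d) (colEquiv d) * t = Matrix.fromBlocks
      (Matrix.fromBlocks t.toBlocks₁₁.toBlocks₂₂ 0 0 t.toBlocks₁₁.toBlocks₁₁) 0 0
      (Matrix.fromBlocks t.toBlocks₂₂.toBlocks₁₁ 0 0 t.toBlocks₁₁.toBlocks₁₁) *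
        (v0 k d).1.submatrix (rowEquiv d) (colEquiv d) := by
    rw [v0_submatrix, blockV0]
    conv_lhs => rw [h5]
    simp only [Matrix.fromBlocks_multiply, Matrix.mul_zero, Matrix.zero_mul, Matrix.mul_one,
      Matrix.one_mul, add_zero, zero_add]
  change (v0 k d).1.submatrix (rowEquiv d) (colEquiv d) * t * _ = _
  rw [h6, Matrix.mul_assoc, Matrix.submatrix_mul_equiv, Units.mul_inv, Matrix.submatrix_one_equiv,
    Matrix.mul_one]

lemma quotMk_v0_conj {τ : Matrix.GeneralLinearGroup (Fin d.N) k} (hτ : τ ∈ torusTS k d)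
    (g : Matrix.GeneralLinearGroup (Fin d.N) k) :
    (quotMk (groupK k d)).toFun (v0 k d * (τ⁻¹ * g)) = (quotMk (groupK k d)).toFun (v0 k d * g) := by
  refine quotMk_eq_iff.2 ?_
  have := v0_conj_mem_groupK hτ
  convert this using 1
  group

lemma mem_parabolicP' {g : Matrix.GeneralLinearGroup (Fin d.N) k}
    (h : ∀ i j : Fin d.N, (j : ℕ) < i → ¬ ((2 * d.s + d.r ≤ (i : ℕ) ∧
      (i : ℕ) < 2 * d.s + d.r + (d.q + d.t)) ∧ 2 * d.s + d.r ≤ (j : ℕ) ∧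
      (j : ℕ) < 2 * d.s + d.r + (d.q + d.t)) → g.1 i j = 0) : g ∈ parabolicP' k d := by
  intro i j hij
  dsimp only at hij
  refine h i j ?_ ?_ <;> split_ifs at hij <;> omega

/-- The permutation w carries the middle range of sizes q and t to the large diagonal block of P'.
This is why the conjugates of Q₁ and Q₂ lie in P' although they need not be upper triangular. -/
lemma wPerm_of_q {i : Fin d.N} (h : d.p ≤ ((wPerm d).symm i : ℕ))
    (h' : ((wPerm d).symm i : ℕ) < d.p + d.q + d.t) :
    2 * d.s + d.r ≤ (i : ℕ) ∧ (i : ℕ) < 2 * d.s + d.r + (d.q + d.t) := by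
  have hw := WAt_wPerm d ((wPerm d).symm i)
  rw [Equiv.apply_symm_apply] at hw
  have := d.sizes
  generalize ((wPerm d).symm i : ℕ) = e at *
  rcases hw with hw | hw | hw | hw | hw | hw <;> omega

lemma conjInvW_Q1_le {g : Matrix.GeneralLinearGroup (Fin d.N) k}
    (hg : g ∈ conjInvW k d (groupQ1 k d)) : g ∈ parabolicP' k d := by
  rw [groupQ1_eq, mem_conjInvW_pat] at hg
  refine mem_parabolicP' fun i j hij h => ?_
  rw [hg i j fun h' => h ⟨wPerm_of_q h'.1.1 (by omega), wPerm_of_q (by omega) h'.2.2⟩,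
    if_neg (ne_of_gt (Fin.lt_def.2 hij))]

lemma conjInvW_Q2_le {g : Matrix.GeneralLinearGroup (Fin d.N) k}
    (hg : g ∈ conjInvW k d (groupQ2 k d)) : g ∈ parabolicP' k d := by
  rw [groupQ2_eq, mem_conjInvW_pat] at hg
  refine mem_parabolicP' fun i j hij h => ?_
  rw [hg i j fun h' => h ⟨wPerm_of_q (by omega) h'.1.2, wPerm_of_q h'.2.1 (by omega)⟩,
    if_neg (ne_of_gt (Fin.lt_def.2 hij))]

lemma diag_mem_parabolicP' {g : Matrix.GeneralLinearGroup (Fin d.N) k}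
    (hg : ∀ i j, i ≠ j → g.1 i j = 0) : g ∈ parabolicP' k d :=
  mem_parabolicP' fun i j hij _ => hg i j (ne_of_gt (Fin.lt_def.2 hij))

/-- The first factor of Z is upper triangular by the definition of U'₊, the second is diagonal, and
the last two stay within the block of size q + t. -/
lemma pMap_mem_parabolicP' (z : (ZSpace k d).pts) : (pMap k d).toFun z ∈ parabolicP' k d := by
  obtain ⟨⟨v, hv⟩, ⟨y, hy⟩, ⟨y₁, h₁⟩, ⟨y₂, h₂⟩⟩ := z
  refine mul_mem ?_ (mul_mem ?_ (mul_mem (conjInvW_Q1_le h₁) (conjInvW_Q2_le h₂)))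
  · rw [conjInvW_U'plus_eq, ← mem_unipUpper_inter_pat not_conjRel_self] at hv
    exact mem_parabolicP' fun i j hij _ => hv.2.1 i j (Fin.lt_def.2 hij)
  · exact diag_mem_parabolicP' (conjInvW_T'_diag hy)

lemma isParabolic_parabolicP' : IsParabolic (parabolicP' k d) := by
  let c : Fin d.N → ℕ := fun i =>
    if 2 * d.s + d.r ≤ (i : ℕ) ∧ (i : ℕ) < 2 * d.s + d.r + (d.q + d.t) then 2 * d.s + d.r else (i : ℕ)
  refine ⟨⟨{f | ∃ i j, c j < c i ∧ f = fun g => g.1 i j}, ?_, ?_⟩, 1, fun x hx => ?_⟩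
  · rintro _ ⟨i, j, -, rfl⟩
    exact entry_mem i j
  · ext g
    refine ⟨?_, fun h i j hij => h _ ⟨i, j, hij, rfl⟩⟩
    rintro h _ ⟨i, j, hij, rfl⟩
    exact h hij
  · rw [one_mul, inv_one, mul_one]
    exact mem_parabolicP' fun i j hij _ => hx (Fin.lt_def.2 hij)

end KGSlice

/-! ### Properties of Ψ and conclusion -/

namespace KGSlice

open FunctionSpace

variable {k : Type u} [Field k] {d : BlockSizes}

lemma Psi_eq : Psi k d =
    (sliceι k d ▷ Z k d) ≫ (KG k d ◁ (pMap k d).toScheme) ≫ actG k d := by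
  rw [Psi, MonoidalCategory.tensorHom_def, Category.assoc]

/-- Under the identification of the slice with a matrix group, Ψ becomes `sliceMap`. -/
lemma isOpenImmersion_Psi [IsAlgClosed k] : IsOpenImmersion (Psi k d).left := by
  obtain ⟨e, he⟩ := exists_iso_slice (k := k) (d := d)
  let c : (((glSpace k d.N).sub (groupSlice k d)).prod (ZSpace k d)).toScheme ≅
      slice k d ⊗ Z k d :=
    asIso (FunctionSpace.prodComparison ((glSpace k d.N).sub (groupSlice k d)) (ZSpace k d)) ≪≫
      whiskerRightIso e (Z k d)
  have hc : c.hom ≫ Psi k d = (sliceMap k d).toScheme := by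
    have := lift_Psi e he (prodFst _ (ZSpace k d)) (prodSnd _ _)
    simp only [c, Iso.trans_hom, asIso_hom, whiskerRightIso_hom, FunctionSpace.prodComparison,
      lift_whiskerRight]
    exact this
  have h1 : Psi k d = c.inv ≫ (sliceMap k d).toScheme := by rw [← hc, Iso.inv_hom_id_assoc]
  have h2 : (Psi k d).left = c.inv.left ≫ (sliceMap k d).toScheme.left := by
    rw [h1]
    rfl
  have := isOpenImmersion_sliceMap (k := k) (d := d)
  have : IsIso c.inv.left := inferInstanceAs (IsIso ((Over.forget _).map c.inv))
  rw [h2]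
  infer_instance

/-- The torus `T_S` operates on the slice, and `Ψ` is equivariant. -/
lemma exists_slice_action [IsAlgClosed k] : ∃ ρS : slice k d ⊗ TS k d ⟶ slice k d,
    ρS ≫ sliceι k d = (sliceι k d ▷ TS k d) ≫ actTS k d ∧
    diagAct ρS (actZ k d) ≫ Psi k d = (Psi k d ▷ TS k d) ≫ actTS k d := by
  obtain ⟨e, he⟩ := exists_iso_slice (k := k) (d := d)
  let X := (glSpace k d.N).sub (groupSlice k d)
  let a : (X.prod (TSSpace k d)).Hom X := conjTS d diagStable_groupSlice (prodFst _ _) (prodSnd _ _)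
  let ρS : slice k d ⊗ TS k d ⟶ slice k d :=
    (e.inv ▷ TS k d) ≫ inv (FunctionSpace.prodComparison X (TSSpace k d)) ≫ a.toScheme ≫ e.hom
  have hρ : ∀ {Y : FunctionSpace k} (φ : Y.Hom X) (τ : Y.Hom (TSSpace k d)),
      lift (φ.toScheme ≫ e.hom) τ.toScheme ≫ ρS =
        (conjTS d diagStable_groupSlice φ τ).toScheme ≫ e.hom := by
    intro Y φ τ
    have h1 : conjTS d diagStable_groupSlice φ τ = (φ.pair τ).comp a := rfl
    rw [h1, toScheme_comp, ← lift_toScheme_inv]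
    simp [ρS]
  clear_value ρS
  refine ⟨ρS, ?_, ?_⟩
  · rw [← cancel_epi (e.hom ▷ TS k d),
      ← cancel_epi (FunctionSpace.prodComparison X (TSSpace k d)), ← comp_whiskerRight_assoc, he,
      FunctionSpace.prodComparison, lift_whiskerRight_assoc, lift_whiskerRight_assoc,
      reassoc_of% hρ (prodFst X (TSSpace k d)) (prodSnd X (TSSpace k d)), he, ← toScheme_comp,
      ← toScheme_comp]
    refine Eq.trans ?_ (lift_actTS _ _).symm
    refine congrArg Hom.toScheme (Hom.ext ?_)
    rintro ⟨⟨u, hu⟩, ⟨τ, hτ⟩⟩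
    change (quotMk (groupK k d)).toFun (v0 k d * (τ⁻¹ * u * τ)) =
      (quotMk (groupK k d)).toFun (v0 k d * u * τ)
    rw [mul_assoc τ⁻¹, quotMk_v0_conj hτ, mul_assoc]
  · let Y := (X.prod (ZSpace k d)).prod (TSSpace k d)
    let f₁ : Y.Hom X := (prodFst _ _).comp (prodFst _ _)
    let f₂ : Y.Hom (ZSpace k d) := (prodFst _ _).comp (prodSnd _ _)
    let f₃ : Y.Hom (TSSpace k d) := prodSnd _ _
    have hc : FunctionSpace.prodComparison (X.prod (ZSpace k d)) (TSSpace k d) ≫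
        ((FunctionSpace.prodComparison X (ZSpace k d) ≫ (e.hom ▷ Z k d)) ▷ TS k d) =
        lift (lift (f₁.toScheme ≫ e.hom) f₂.toScheme) f₃.toScheme := by
      rw [FunctionSpace.prodComparison, FunctionSpace.prodComparison, lift_whiskerRight,
        lift_whiskerRight, comp_lift, ← Category.assoc, ← toScheme_comp, ← toScheme_comp]
    have hepi : IsIso (lift (lift (f₁.toScheme ≫ e.hom) f₂.toScheme) f₃.toScheme) := by
      rw [← hc]
      infer_instance
    rw [← cancel_epi (lift (lift (f₁.toScheme ≫ e.hom) f₂.toScheme) f₃.toScheme),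
      lift_whiskerRight_assoc, lift_Psi e he]
    refine Eq.trans ?_ (lift_actTS _ _).symm
    rw [diagAct, comp_lift_assoc, lift_whiskerRight_assoc, lift_whiskerRight_assoc, lift_fst,
      lift_snd, hρ, lift_actZ, lift_Psi e he]
    refine congrArg Hom.toScheme (Hom.ext ?_)
    rintro ⟨⟨⟨u, hu⟩, ⟨v, hv⟩, ⟨y, hy⟩, ⟨y₁, h₁⟩, ⟨y₂, h₂⟩⟩, ⟨τ, hτ⟩⟩
    change (quotMk (groupK k d)).toFun (v0 k d * (τ⁻¹ * u * τ) *
        ((τ⁻¹ * v * τ) * ((τ⁻¹ * y * τ) * ((τ⁻¹ * y₁ * τ) * (τ⁻¹ * y₂ * τ))))) =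
      (quotMk (groupK k d)).toFun (v0 k d * u * (v * (y * (y₁ * y₂))) * τ)
    -- All inner products τ τ⁻¹ cancel, and the remaining τ⁻¹ next to v₀ is absorbed into K.
    rw [mul_assoc τ⁻¹, mul_assoc (v0 k d), mul_assoc τ⁻¹, quotMk_v0_conj hτ]
    congr 1
    group

end KGSlice

theorem theorem4p7 {k : Type u} [Field k] [IsAlgClosed k] (d : BlockSizes) :
    Smooth (Z k d).hom ∧
    ∃ _ : IsOpenImmersion (Psi k d).left,
    ∃ ρS : slice k d ⊗ TS k d ⟶ slice k d,
      ρS ≫ sliceι k d = (sliceι k d ▷ TS k d) ≫ actTS k d ∧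
      diagAct ρS (actZ k d) ≫ Psi k d = (Psi k d ▷ TS k d) ≫ actTS k d ∧
      IsParabolic (parabolicP' k d) ∧
      ∀ P : Subgroup (Matrix.GeneralLinearGroup (Fin d.N) k), IsParabolic P →
        parabolicP' k d ≤ P → ∀ g : Matrix.GeneralLinearGroup (Fin d.N) k,
        ∃ (ρ₁ : Limits.pullback (orbitClosureι k d g P) (sliceι k d) ⊗ TS k d ⟶
            Limits.pullback (orbitClosureι k d g P) (sliceι k d))
          (ρ₂ : Limits.pullback (orbitClosureι k d g P)
              (openSubι (KG k d) (Psi k d).left.opensRange) ⊗ TS k d ⟶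
            Limits.pullback (orbitClosureι k d g P)
              (openSubι (KG k d) (Psi k d).left.opensRange))
          (φ : Limits.pullback (orbitClosureι k d g P) (sliceι k d) ⊗ Z k d ≅
            Limits.pullback (orbitClosureι k d g P)
              (openSubι (KG k d) (Psi k d).left.opensRange)),
          ρ₁ ≫ Limits.pullback.snd _ _ = (Limits.pullback.snd _ _ ▷ TS k d) ≫ ρS ∧
          ρ₂ ≫ Limits.pullback.fst _ _ ≫ orbitClosureι k d g P =
            ((Limits.pullback.fst _ _ ≫ orbitClosureι k d g P) ▷ TS k d) ≫ actTS k d ∧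
          φ.hom ≫ Limits.pullback.fst _ _ ≫ orbitClosureι k d g P =
            (Limits.pullback.snd _ _ ▷ Z k d) ≫ Psi k d ∧
          diagAct ρ₁ (actZ k d) ≫ φ.hom = (φ.hom ▷ TS k d) ≫ ρ₂ := by
  have hopen : IsOpenImmersion (Psi k d).left := isOpenImmersion_Psi
  obtain ⟨ρS, hρS, hΨ⟩ := exists_slice_action (k := k) (d := d)
  refine ⟨smooth_toScheme smooth_zSpace, hopen, ρS, hρS, hΨ, isParabolic_parabolicP',
    fun P _ hP g => ?_⟩
  obtain ⟨β, hβ⟩ := exists_act_orbitClosure g P (pMap k d) fun z => hP (pMap_mem_parabolicP' z)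
  obtain ⟨β', hβ'⟩ := exists_act_orbitClosure g P ((pMap k d).comp glInv) fun z =>
    P.inv_mem (hP (pMap_mem_parabolicP' z))
  obtain ⟨βT, hβT⟩ := exists_act_orbitClosure g P ((glSpace k d.N).incl (torusTS k d)) fun τ =>
    hP (diag_mem_parabolicP' τ.2.1)
  -- Multiplication by p(z)⁻¹ undoes multiplication by p(z). This is the hypothesis of
  -- `exists_iso_pullback`; Z itself is not a group, so the inverse is taken in G.
  have hinv : lift ((KG k d ◁ (pMap k d).toScheme) ≫ actG k d) (snd (KG k d) (Z k d)) ≫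
      (KG k d ◁ ((pMap k d).comp glInv).toScheme) ≫ actG k d = fst (KG k d) (Z k d) := by
    let X := quotSpace (groupK k d)
    rw [← cancel_epi (FunctionSpace.prodComparison X (ZSpace k d)), comp_lift_assoc]
    have h1 : FunctionSpace.prodComparison X (ZSpace k d) ≫
        (KG k d ◁ (pMap k d).toScheme) ≫ actG k d = _ :=
      lift_actG (FunctionSpace.prodFst X (ZSpace k d)) (FunctionSpace.prodSnd X (ZSpace k d))
        (pMap k d)
    rw [h1, FunctionSpace.prodComparison, lift_snd, lift_fst]
    refine (lift_actG _ _ _).trans (congrArg FunctionSpace.Hom.toScheme (FunctionSpace.Hom.ext ?_))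
    rintro ⟨x, z⟩
    induction x using Quotient.inductionOn with
    | h g => exact congrArg (quotMk (groupK k d)).toFun (mul_inv_cancel_right g _)
  -- As Ψ is an open immersion, its source is isomorphic to its image, so the inverse image of the
  -- orbit closure under Ψ may be replaced by the intersection with the image.
  let m : slice k d ⊗ Z k d ≅ openSub (KG k d) (Psi k d).left.opensRange :=
    Over.isoMk (Psi k d).left.isoOpensRange (by
      change (Psi k d).left.isoOpensRange.hom ≫ (Psi k d).left.opensRange.ι ≫ (KG k d).hom = _
      rw [← Category.assoc, Scheme.Hom.isoOpensRange_hom_ι]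
      exact Over.w (Psi k d))
  have hm : m.hom ≫ openSubι (KG k d) (Psi k d).left.opensRange =
      (sliceι k d ▷ Z k d) ≫ (KG k d ◁ (pMap k d).toScheme) ≫ actG k d :=
    (Over.OverMorphism.ext (Scheme.Hom.isoOpensRange_hom_ι (Psi k d).left)).trans Psi_eq
  rw [Psi_eq] at hΨ
  obtain ⟨ρ₁, ρ₂, φ, h1, h2, h3, h4⟩ := exists_equivariant_iso (orbitClosureι k d g P) (sliceι k d)
    (openSubι (KG k d) (Psi k d).left.opensRange) _ _ hinv β β' hβ hβ' m hm (actTS k d) βT hβT ρS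
    hρS (actZ k d) hΨ
  exact ⟨ρ₁, ρ₂, φ, h1, h2, h3.trans (congrArg _ Psi_eq.symm), h4⟩
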